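/- Let $\mathcal X=[a_1,b_1]\times\cdots\times[a_k,b_k]\subseteq\mathbb R^k$, where $a_i=-\infty$ and $b_i=\infty$ are allowed, and let the mother distribution and the model distribution be two probability distributions on $\mathcal X$ whose one-dimensional marginals are continuous. Let $\bm X^{(1)}=(\bm X^{(1)}_1,\dots,\bm X^{(1)}_{n_1})$ be an i.i.d. sample from the mother distribution and $\bm X^{(2)}=(\bm X^{(2)}_1,\dots,\bm X^{(2)}_{n_2})$ an i.i.d. sample from the model distribution, independent of $\bm X^{(1)}$. Fix a depth $l\le k$ and nonnegative integers $p,\ p_{j_1},\ p_{j_1j_2},\dots,\ p_{j_1\ldots j_{l-1}}$. Bins are built from $\bm X^{(2)}$ by the moving-region method: in step $i=1,\dots,l$ each region $A=A_{j_1\ldots j_{i-1}}$ of the previous step (the region $\mathcal X$ if $i=1$), which contains $n(A)$ individuals of $\bm X^{(2)}$, is split into the regions $$A_{j_1\ldots j_{i-1}j_i}=\{\bm X\in A : X_i\in(c_{j_i},c_{j_i+1}]\},\qquad j_i=0,\dots,p_{j_1\ldots j_{i-1}},$$ where $c_0=a_i$, $c_{p_{j_1\ldots j_{i-1}}+1}=b_i$,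 and otherwise $c_s$ is the order statistic of rank $\lfloor n(A)s/(p_{j_1\ldots j_{i-1}}+1)\rfloor$ of the $i$-th coordinates of the individuals of $\bm X^{(2)}$ in $A$ (and $c_s=-\infty$ if this rank is $0$). The bins are the regions $A_{\bm j}$, $\bm j=(j_1,\dots,j_l)$, and $p'$ is their number minus one. Put $$m^{(1)}_{\bm j}=P(\bm X\in A_{\bm j}\mid\text{mother}),\qquad m^{(2)}_{\bm j}=P(\bm X\in A_{\bm j}\mid\text{model}),$$ $$\hat m^{(1)}_{\bm j}=\frac{\#\{\tau:\bm X^{(1)}_\tau\in A_{\bm j}\}}{n_1},\qquad \hat m^{(2)}_{\bm j}=\frac1{(p+1)(p_{j_1}+1)\cdots(p_{j_1\ldots j_{l-1}}+1)},$$ and let $D[u:v]=2\sum_{\bm j}(\sqrt{u_{\bm j}}-\sqrt{v_{\bm j}})^2$ be the Hellinger distance. Then there are functions $r_1(n)=o(n^{-1})$ and $r_2(n)=o(n^{-1/2})$ such that for all $n_1,n_2\ge1$ both expectations below exist and $$E\,D[m^{(1)}:m^{(2)}]\ \le\ E\,D[\hat m^{(1)}:\hat m^{(2)}]+\sqrt{\frac{8p'}{n_2}}+r_1(n_1)+r_2(n_2).$$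 -/

import Mathlib

open MeasureTheory ProbabilityTheory Asymptotics Filter

namespace MovingRegion

/-- The box `[a₁, b₁] × ⋯ × [a_k, b_k]` in `ℝ^k`, where infinite end points are allowed. -/
def box {k : ℕ} (a b : Fin k → EReal) : Set (Fin k → ℝ) :=
  {y | ∀ i, a i ≤ (y i : EReal) ∧ (y i : EReal) ≤ b i}

/-- `μ` is carried by the box, and its one-dimensional marginals are continuous
(the distribution function of each coordinate has no jumps). -/
structure IsContinuousOnBox {k : ℕ} (a b : Fin k → EReal) (μ : Measure (Fin k → ℝ)) : Prop where
  ae_mem_box : ∀ᵐ y ∂μ, y ∈ box a b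
  marginal_no_atoms : ∀ (i : Fin k) (t : ℝ), μ {y | y i = t} = 0

/-- The multi-indices `(j₁, …, j_l)` of the bins at depth `l`. The numbers `p` say how regions are
split: the region with index `(j₁, …, j_i)` is split into `p [j₁, …, j_i] + 1` regions (the whole
box into `p [] + 1`), so `j₁` runs over `0, …, p []`, then `j₂` over `0, …, p [j₁]`, and so on. -/
def BinIndex : (l : ℕ) → (p : List ℕ → ℕ) → Type
  | 0, _ => Unit
  | l + 1, p => (j : Fin (p [] + 1)) × BinIndex l (fun t => p ((j : ℕ) :: t))

noncomputable instance instFintypeBinIndex : (l : ℕ) → (p : List ℕ → ℕ) → Fintype (BinIndex l p)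
  | 0, _ => inferInstanceAs (Fintype Unit)
  | l + 1, p =>
    letI (j : Fin (p [] + 1)) : Fintype (BinIndex l (fun t => p ((j : ℕ) :: t))) :=
      instFintypeBinIndex l _
    inferInstanceAs (Fintype ((j : Fin (p [] + 1)) × BinIndex l (fun t => p ((j : ℕ) :: t))))

/-- The `r`-th order statistic (`1 ≤ r ≤ #S`) of the values `v τ`, `τ ∈ S`: the least `t` such that
at least `r` of the values are `≤ t`. -/
noncomputable def orderStat {n : ℕ} (S : Finset (Fin n)) (v : Fin n → ℝ) (r : ℕ) : EReal :=
  sInf {t : EReal | r ≤ (S.filter (fun τ => (v τ : EReal) ≤ t)).card}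

/-- The individuals of the sample `x` that belong to the region `A`. -/
noncomputable def members {k n : ℕ} (x : Fin n → Fin k → ℝ) (A : Set (Fin k → ℝ)) :
    Finset (Fin n) :=
  open scoped Classical in Finset.univ.filter (fun τ => x τ ∈ A)

/-- The `s`-th cut point (`0 ≤ s ≤ q + 1`) for the splitting of the region `A` into `q + 1`
regions along coordinate `i`: the end points of the box for `s = 0` and `s = q + 1`, and otherwise
the order statistic of rank `⌊n(A) s / (q + 1)⌋` of the `i`-th coordinates of the individuals
in `A`, where `n(A)` is the number of these individuals. -/
noncomputable def cut {k n : ℕ} (a b : Fin k → EReal) (x : Fin n → Fin k → ℝ)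
    (A : Set (Fin k → ℝ)) (i : Fin k) (q s : ℕ) : EReal :=
  if s = 0 then a i
  else if s = q + 1 then b i
  else orderStat (members x A) (fun τ => x τ i) ((members x A).card * s / (q + 1))

/-- Start from a region `A`, and split recursively, `l` times, along the coordinates
`i`, `i + 1`, …, `i + l - 1` (counted from `0`). -/
noncomputable def regionFrom {k n : ℕ} (a b : Fin k → EReal) (x : Fin n → Fin k → ℝ) :
    (l i : ℕ) → i + l ≤ k → (p : List ℕ → ℕ) → Set (Fin k → ℝ) → BinIndex l p →
      Set (Fin k → ℝ)
  | 0, _, _, _, A, _ => A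
  | l + 1, i, h, p, A, ⟨j, J⟩ =>
    regionFrom a b x l (i + 1) (by omega) (fun t => p ((j : ℕ) :: t))
      (A ∩ {y | (y ⟨i, by omega⟩ : EReal) ∈
        Set.Ioc (cut a b x A ⟨i, by omega⟩ (p []) j) (cut a b x A ⟨i, by omega⟩ (p []) (j + 1))})
      J

/-- The bins of depth `l` that the moving-region method builds from the sample `x`. -/
noncomputable def region {k n : ℕ} (a b : Fin k → EReal) (x : Fin n → Fin k → ℝ)
    {l : ℕ} (hl : l ≤ k) (p : List ℕ → ℕ) (J : BinIndex l p) : Set (Fin k → ℝ) :=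
  regionFrom a b x l 0 (by omega) p (box a b) J

/-- The distribution `μ` discretized over the bins built from the sample `x`. -/
noncomputable def discretized {k n : ℕ} (a b : Fin k → EReal) (x : Fin n → Fin k → ℝ)
    {l : ℕ} (hl : l ≤ k) (p : List ℕ → ℕ) (μ : Measure (Fin k → ℝ)) (J : BinIndex l p) : ℝ :=
  μ.real (region a b x hl p J)

/-- The proportions of the individuals of the sample `z` that fall in the bins built from the
sample `x`. -/
noncomputable def proportion {k n m : ℕ} (a b : Fin k → EReal) (x : Fin n → Fin k → ℝ)
    {l : ℕ} (hl : l ≤ k) (p : List ℕ → ℕ) (z : Fin m → Fin k → ℝ) (J : BinIndex l p) : ℝ :=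
  ((members z (region a b x hl p J)).card : ℝ) / (m : ℝ)

/-- The weights `1 / ((p [] + 1) (p [j₁] + 1) ⋯ (p [j₁, …, j_{l-1}] + 1))`. -/
noncomputable def nominal : (l : ℕ) → (p : List ℕ → ℕ) → BinIndex l p → ℝ
  | 0, _, _ => 1
  | l + 1, p, ⟨j, J⟩ => 1 / ((p [] : ℝ) + 1) * nominal l (fun t => p ((j : ℕ) :: t)) J

/-- The Hellinger distance `2 ∑ (√u - √v)²` between two multinomial distributions. -/
noncomputable def hellinger {ι : Type*} [Fintype ι] (u v : ι → ℝ) : ℝ :=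
  2 * ∑ J, (√(u J) - √(v J)) ^ 2

end MovingRegion

open scoped ENNReal

namespace MovingRegion

/-! Write `m₁`, `m₂` for the bin masses under the mother and model distributions, `m̂₁` for the
proportions and `q` for the nominal weights. Given the second sample the bins are fixed and `m̂₁`
has mean `m₁`, so concavity of the square root gives `D[m₁ : q] ≤ E D[m̂₁ : q]`
(`hellinger_discretized_le_integral`); the first sample costs nothing. Replacing `q` by `m₂` changes
the cross term `4 ∑ √u √v` of the distance, which by weighted AM-GM costs at most `(4/t) D[m₂ : q] +
t/2` for every `t > 0` (`hellinger_triangle`); after taking expectations the best `t` gives `√(8 E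
D[m₂ : q])`. What remains is `E D[m₂ : q] ≤ p'/n₂` for all large `n₂`
(`exists_integral_hellinger_nominal_le`).

For this bound each multiway split is rewritten as successive binary splits that peel off one slab
at a time (`exists_cutTree`), which makes `p'` binary splits in all. Almost surely `D[m₂ : q]` is at
most four times the deficit `1 - ∑ √(q m₂)`, and the deficit of a node is that of its own binary
split plus those of its children with weights `√v` and `√(1 - v)`, where `v` is the fraction aimed
at. The mass below an order statistic of `N` individuals has a Beta law with mean near `v` and
variance about `v (1 - v) / N`, so a Taylor expansion makes the binary deficit about `1/(8N)` on
average. A child of mass `u ≈ v` carries the weight `√v √u ≈ v` but contains only about `v N`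
individuals, so each split inside it again costs about `1/(8N)` (`exists_lintegral_deficit_le`).
With the cruder Taylor coefficient `3/16` in place of `1/8` this gives every constant above `3/4` in
front of `p'/n₂`, and the room up to `1` absorbs all errors.

The induction needs independence inside a child region. Given which individual lies on the cut and
which others lie in the child, the latter are i.i.d. with the conditional law, apart from
individuals that were already fixed by earlier cuts. The induction therefore concerns regions whose
members are an i.i.d. set `S` and at most `w` fixed strays (`partialSample`), and `w` grows by one
per level. Strays shift ranks by at most `w`, so the cut is squeezed between two order statistics of
`S` whose mean masses differ by `w/(N + 1)`. -/

/-! ### Order statistics of a finite family. -/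

/-- The value `t = ⊤` is excluded because for a rank above the size of `S` the infimum is over the
empty set, hence `⊤`, while no count reaches the rank. -/
theorem orderStat_le_iff {n : ℕ} {S : Finset (Fin n)} {v : Fin n → ℝ} {r : ℕ} {t : EReal}
    (ht : t ≠ ⊤) :
    orderStat S v r ≤ t ↔ r ≤ (S.filter (fun τ => (v τ : EReal) ≤ t)).card := by
  refine ⟨fun h => ?_, fun h => sInf_le h⟩
  have hmono : ∀ {s t : EReal}, s ≤ t → (S.filter (fun τ => (v τ : EReal) ≤ s)).card ≤
      (S.filter (fun τ => (v τ : EReal) ≤ t)).card := fun hst =>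
    Finset.card_le_card (Finset.monotone_filter_right _ fun _ _ h => h.trans hst)
  refine le_trans ?_ (hmono h)
  have hO : orderStat S v r < ⊤ := lt_of_le_of_lt h (lt_top_iff_ne_top.2 ht)
  -- The infimum is attained by finiteness: some `u` in the defining set lies strictly below every
  -- value that exceeds the infimum, so `u` counts no value beyond those counted at the infimum.
  have hlt : orderStat S v r <
      (S.filter (fun τ => orderStat S v r < (v τ : EReal))).inf (fun τ => (v τ : EReal)) := by
    rw [Finset.lt_inf_iff hO]
    intro τ hτ
    exact (Finset.mem_filter.1 hτ).2
  obtain ⟨u, hu, hut⟩ := sInf_lt_iff.1 hlt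
  refine le_trans hu (Finset.card_le_card fun τ hτ => ?_)
  simp only [Finset.mem_filter] at hτ ⊢
  refine ⟨hτ.1, not_lt.1 fun hc => ?_⟩
  have := (Finset.lt_inf_iff (lt_of_lt_of_le hut le_top)).1 hut τ
    (Finset.mem_filter.2 ⟨hτ.1, hc⟩)
  exact absurd hτ.2 (not_le.2 this)

theorem orderStat_lt_iff {n : ℕ} {S : Finset (Fin n)} {v : Fin n → ℝ} {r : ℕ} {t : EReal} :
    orderStat S v r < t ↔ ∃ s < t, r ≤ (S.filter (fun τ => (v τ : EReal) ≤ s)).card := by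
  unfold orderStat
  rw [sInf_lt_iff]
  exact ⟨fun ⟨s, h, h'⟩ => ⟨s, h', h⟩, fun ⟨s, h, h'⟩ => ⟨s, h', h⟩⟩

theorem orderStat_anti {n : ℕ} {S S' : Finset (Fin n)} {v : Fin n → ℝ} {r r' : ℕ}
    (h : ∀ t : EReal, r ≤ (S.filter (fun τ => (v τ : EReal) ≤ t)).card →
      r' ≤ (S'.filter (fun τ => (v τ : EReal) ≤ t)).card) :
    orderStat S' v r' ≤ orderStat S v r :=
  sInf_le_sInf fun t ht => h t ht

theorem orderStat_eq_of_card {n : ℕ} {S : Finset (Fin n)} {v : Fin n → ℝ} {r : ℕ} {τ : Fin n}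
    (hτ : τ ∈ S) (h : (S.filter (fun σ => v σ ≤ v τ)).card = r) :
    orderStat S v r = (v τ : EReal) := by
  apply le_antisymm
  · rw [orderStat_le_iff (EReal.coe_ne_top _)]
    simp [h]
  · refine not_lt.1 fun hlt => ?_
    obtain ⟨s, hs, hr⟩ := orderStat_lt_iff.1 hlt
    have : (S.filter (fun σ => (v σ : EReal) ≤ s)).card <
        (S.filter (fun σ => v σ ≤ v τ)).card := by
      apply Finset.card_lt_card
      refine ⟨fun σ hσ => ?_, fun hsub => ?_⟩
      · simp only [Finset.mem_filter] at hσ ⊢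
        exact ⟨hσ.1, EReal.coe_le_coe_iff.1 (hσ.2.trans hs.le)⟩
      · have := hsub (Finset.mem_filter.2 ⟨hτ, le_rfl⟩)
        exact absurd (Finset.mem_filter.1 this).2 (not_le.2 hs)
    omega

/-- As long as more than `r` values are left, the largest one can be deleted. -/
theorem exists_card_filter_le_eq {ι : Type*} [DecidableEq ι] (S : Finset ι) (v : ι → ℝ)
    (hv : Set.InjOn v S) {r : ℕ} (hr : 1 ≤ r) (hrS : r ≤ S.card) :
    ∃ τ ∈ S, (S.filter (fun σ => v σ ≤ v τ)).card = r := by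
  induction hn : S.card - r generalizing S with
  | zero =>
    have hcard : S.card = r := by omega
    obtain ⟨τ, hτ, hmax⟩ := S.exists_max_image v (Finset.card_pos.1 (by omega))
    refine ⟨τ, hτ, ?_⟩
    rw [Finset.filter_true_of_mem (fun σ hσ => hmax σ hσ), hcard]
  | succ d ih =>
    obtain ⟨τ, hτ, hmax⟩ := S.exists_max_image v (Finset.card_pos.1 (by omega))
    have hc := Finset.card_erase_of_mem hτ
    obtain ⟨σ, hσ, hcard⟩ := ih (S.erase τ)
      (hv.mono (Finset.coe_subset.2 (S.erase_subset τ))) (by omega) (by omega)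
    refine ⟨σ, Finset.mem_of_mem_erase hσ, ?_⟩
    rw [← hcard]
    congr 1
    ext ρ
    simp only [Finset.mem_filter, Finset.mem_erase]
    constructor
    · rintro ⟨h1, h2⟩
      refine ⟨⟨?_, h1⟩, h2⟩
      rintro rfl
      have h3 := hmax σ (Finset.mem_of_mem_erase hσ)
      exact (Finset.ne_of_mem_erase hσ) (hv (Finset.mem_of_mem_erase hσ) h1 (le_antisymm h3 h2))
    · rintro ⟨⟨-, h1⟩, h2⟩
      exact ⟨h1, h2⟩

/-- The part of the region `A` on or below the cut `c` along coordinate `i`. -/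
def lowerPart {k : ℕ} (A : Set (Fin k → ℝ)) (i : Fin k) (c : EReal) : Set (Fin k → ℝ) :=
  A ∩ {y | (y i : EReal) ≤ c}

/-- The part of the region `A` above the cut `c` along coordinate `i`. -/
def upperPart {k : ℕ} (A : Set (Fin k → ℝ)) (i : Fin k) (c : EReal) : Set (Fin k → ℝ) :=
  A ∩ {y | c < (y i : EReal)}

theorem mem_members {k n : ℕ} {x : Fin n → Fin k → ℝ} {A : Set (Fin k → ℝ)} {τ : Fin n} :
    τ ∈ members x A ↔ x τ ∈ A := by
  simp [members]

/-! ### Measurability -/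

/-- A region that depends on a sample in a jointly measurable way. -/
def MeasurableGraph {k : ℕ} {β : Type*} [MeasurableSpace β] (A : β → Set (Fin k → ℝ)) : Prop :=
  MeasurableSet {q : β × (Fin k → ℝ) | q.2 ∈ A q.1}

section Measurability
variable {k n : ℕ} {A : (Fin n → Fin k → ℝ) → Set (Fin k → ℝ)}

theorem MeasurableGraph.measurableSet_mem {m : ℕ} {B : (Fin n → Fin k → ℝ) → Set (Fin k → ℝ)}
    (hB : MeasurableGraph B) (τ : Fin m) : MeasurableSet
      {q : (Fin m → Fin k → ℝ) × (Fin n → Fin k → ℝ) | q.1 τ ∈ B q.2} :=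
  hB.preimage (f := fun q : (Fin m → Fin k → ℝ) × (Fin n → Fin k → ℝ) => (q.2, q.1 τ))
    (by fun_prop)

theorem MeasurableGraph.measurableSet_self_mem (hA : MeasurableGraph A) (τ : Fin n) :
    MeasurableSet {x : Fin n → Fin k → ℝ | x τ ∈ A x} :=
  hA.preimage (f := fun x : Fin n → Fin k → ℝ => (x, x τ)) (by fun_prop)

theorem measurable_card_filter {α : Type*} [MeasurableSpace α] {m : ℕ}
    (p : Fin m → α → Prop) [∀ a, DecidablePred fun τ => p τ a] (hp : ∀ τ, MeasurableSet {a | p τ a}) :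
    Measurable fun a => (Finset.univ.filter (fun τ => p τ a)).card := by
  classical
  simp only [Finset.card_filter]
  exact Finset.measurable_sum _ fun τ _ =>
    Measurable.ite (hp τ) measurable_const measurable_const

theorem MeasurableGraph.measurable_card_members (hA : MeasurableGraph A) :
    Measurable fun x => (members x (A x)).card :=
  by
  classical
  exact measurable_card_filter (fun τ x => x τ ∈ A x) fun τ => hA.measurableSet_self_mem τ

theorem measurableSet_coord_le (i : Fin k) (τ : Fin n) (t : EReal) :
    MeasurableSet {x : Fin n → Fin k → ℝ | (x τ i : EReal) ≤ t} :=
  measurableSet_le (measurable_coe_real_ereal.comp (by fun_prop)) measurable_const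

theorem MeasurableGraph.measurable_orderStat (hA : MeasurableGraph A) (i : Fin k)
    {r : (Fin n → Fin k → ℝ) → ℕ} (hr : Measurable r) :
    Measurable fun x => orderStat (members x (A x)) (fun τ => x τ i) (r x) := by
  classical
  refine measurable_of_Iic fun t => ?_
  rcases eq_or_ne t ⊤ with rfl | ht
  · simp
  have : (fun x => orderStat (members x (A x)) (fun τ => x τ i) (r x)) ⁻¹' Set.Iic t =
      {x | r x ≤ (Finset.univ.filter (fun τ => x τ ∈ A x ∧ (x τ i : EReal) ≤ t)).card} := by
    ext x
    simp only [Set.mem_preimage, Set.mem_Iic, orderStat_le_iff ht, Set.mem_ofPred_eq, members,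
      Finset.filter_filter]
  rw [this]
  refine measurableSet_le hr (measurable_card_filter
    (fun τ x => x τ ∈ A x ∧ (x τ i : EReal) ≤ t) fun τ => ?_)
  exact (hA.measurableSet_self_mem τ).inter (measurableSet_coord_le i τ t)

theorem MeasurableGraph.lowerPart {β : Type*} [MeasurableSpace β] {A : β → Set (Fin k → ℝ)}
    (hA : MeasurableGraph A) (i : Fin k)
    {c : β → EReal} (hc : Measurable c) :
    MeasurableGraph fun x => lowerPart (A x) i (c x) :=
  hA.inter (measurableSet_le (measurable_coe_real_ereal.comp (by fun_prop))
    (hc.comp measurable_fst))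

theorem MeasurableGraph.upperPart {β : Type*} [MeasurableSpace β] {A : β → Set (Fin k → ℝ)}
    (hA : MeasurableGraph A) (i : Fin k)
    {c : β → EReal} (hc : Measurable c) :
    MeasurableGraph fun x => upperPart (A x) i (c x) :=
  hA.inter (measurableSet_lt (hc.comp measurable_fst)
    (measurable_coe_real_ereal.comp (by fun_prop)))

theorem MeasurableGraph.measurable_real {β : Type*} [MeasurableSpace β] {A : β → Set (Fin k → ℝ)}
    (hA : MeasurableGraph A) (ν : Measure (Fin k → ℝ)) [IsFiniteMeasure ν] :
    Measurable fun x => ν.real (A x) :=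
  (measurable_measure_prodMk_left hA).ennreal_toReal

theorem MeasurableGraph.const {β : Type*} [MeasurableSpace β] {B : Set (Fin k → ℝ)}
    (hB : MeasurableSet B) : MeasurableGraph fun _ : β => B :=
  measurable_snd hB

theorem MeasurableGraph.measurable_cut (hA : MeasurableGraph A) (a b : Fin k → EReal) (i : Fin k)
    (q s : ℕ) : Measurable fun x => cut a b x (A x) i q s := by
  unfold cut
  split_ifs
  · exact measurable_const
  · exact measurable_const
  · exact hA.measurable_orderStat i
      ((measurable_from_nat (f := fun m => m * s / (q + 1))).comp hA.measurable_card_members)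

theorem MeasurableGraph.regionFrom (a b : Fin k → EReal) (l i : ℕ) (h : i + l ≤ k)
    (p : List ℕ → ℕ) (J : BinIndex l p) {A : (Fin n → Fin k → ℝ) → Set (Fin k → ℝ)}
    (hA : MeasurableGraph A) :
    MeasurableGraph fun x => regionFrom a b x l i h p (A x) J := by
  induction l generalizing i p A with
  | zero => exact hA
  | succ l ih =>
    obtain ⟨j, J⟩ := J
    refine ih (i + 1) _ _ J (A := fun x => A x ∩ {y | (y ⟨i, by omega⟩ : EReal) ∈
        Set.Ioc (cut a b x (A x) ⟨i, by omega⟩ (p []) j)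
          (cut a b x (A x) ⟨i, by omega⟩ (p []) (j + 1))}) ?_
    have h1 := (hA.upperPart ⟨i, by omega⟩
      (hA.measurable_cut a b ⟨i, by omega⟩ (p []) j)).lowerPart ⟨i, by omega⟩
      (hA.measurable_cut a b ⟨i, by omega⟩ (p []) (j + 1))
    convert h1 using 2
    ext y
    simp only [MovingRegion.lowerPart, MovingRegion.upperPart, Set.mem_inter_iff, Set.mem_ofPred_eq,
      Set.mem_Ioc, and_assoc]

theorem measurableSet_box (a b : Fin k → EReal) : MeasurableSet (box a b) := by
  unfold box
  simp only [Set.ofPred_forall]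
  refine MeasurableSet.iInter fun i => ?_
  exact (measurableSet_le measurable_const (measurable_coe_real_ereal.comp (by fun_prop))).inter
    (measurableSet_le (measurable_coe_real_ereal.comp (by fun_prop)) measurable_const)

theorem measurableGraph_region (a b : Fin k → EReal) {l : ℕ} (hl : l ≤ k) (p : List ℕ → ℕ)
    (J : BinIndex l p) :
    MeasurableGraph fun x : Fin n → Fin k → ℝ => region a b x hl p J :=
  MeasurableGraph.regionFrom a b l 0 (by omega) p J (.const (measurableSet_box a b))

end Measurability

/-! ### Samples with some members redrawn and the others fixed. -/

section PartialSample
variable {ι α : Type*} [Fintype ι] [DecidableEq ι] [MeasurableSpace α]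

/-- Redrawing some coordinates from an independent copy preserves a product law: a box pulls back to
a product of two boxes, and each coordinate contributes its factor exactly once. -/
theorem map_piecewise_prod_pi (θ : ι → Measure α) [∀ τ, IsProbabilityMeasure (θ τ)]
    (S : Finset ι) :
    Measure.map (fun q : (ι → α) × (ι → α) => S.piecewise q.2 q.1)
      ((Measure.pi θ).prod (Measure.pi θ)) = Measure.pi θ := by
  have hm : Measurable (fun q : (ι → α) × (ι → α) => S.piecewise q.2 q.1) := by
    refine measurable_pi_lambda _ fun τ => ?_
    by_cases h : τ ∈ S
    · simp only [h, Finset.piecewise_eq_of_mem]; fun_prop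
    · simp only [h, not_false_eq_true, Finset.piecewise_eq_of_notMem]; fun_prop
  symm
  refine Measure.pi_eq fun s hs => ?_
  rw [Measure.map_apply hm (MeasurableSet.univ_pi hs)]
  have : (fun q : (ι → α) × (ι → α) => S.piecewise q.2 q.1) ⁻¹' Set.univ.pi s =
      (Set.univ.pi fun τ => if τ ∈ S then Set.univ else s τ) ×ˢ
        (Set.univ.pi fun τ => if τ ∈ S then s τ else Set.univ) := by
    ext q
    simp only [Set.mem_preimage, Set.mem_pi, Set.mem_univ, true_implies, Set.mem_prod]
    rw [← forall_and]
    refine forall_congr' fun τ => ?_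
    by_cases h : τ ∈ S <;> simp [h]
  rw [this, Measure.prod_prod, Measure.pi_pi, Measure.pi_pi, ← Finset.prod_mul_distrib]
  refine Finset.prod_congr rfl fun τ _ => ?_
  by_cases h : τ ∈ S <;> simp [h]

/-- The law of a sample whose members with index in `S` are independent with law `ν`, the others
being fixed to the values `y`. -/
noncomputable def partialSample (S : Finset ι) (ν : Measure α) (y : ι → α) : Measure (ι → α) :=
  Measure.pi fun τ => if τ ∈ S then ν else Measure.dirac (y τ)

variable {S S' : Finset ι} {ν : Measure α} [IsProbabilityMeasure ν] {y : ι → α}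

instance instIsProbabilityMeasureIteDirac (τ : ι) :
    IsProbabilityMeasure (if τ ∈ S then ν else Measure.dirac (y τ)) := by
  split_ifs <;> infer_instance

instance : IsProbabilityMeasure (partialSample S ν y) := by
  unfold partialSample; infer_instance

omit [Fintype ι] in
theorem measurable_piecewise (S : Finset ι) (y : ι → α) :
    Measurable (fun z : ι → α => S.piecewise z y) := by
  refine measurable_pi_lambda _ fun τ => ?_
  by_cases h : τ ∈ S
  · simp only [h, Finset.piecewise_eq_of_mem]; fun_prop
  · simp only [h, not_false_eq_true, Finset.piecewise_eq_of_notMem]; fun_prop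

theorem map_piecewise_partialSample (hS : S' ⊆ S) (y' : ι → α) :
    Measure.map (fun z => S'.piecewise z y') (partialSample S ν y) = partialSample S' ν y' := by
  symm
  refine Measure.pi_eq fun s hs => ?_
  rw [Measure.map_apply (measurable_piecewise S' y') (MeasurableSet.univ_pi hs)]
  by_cases hy : ∀ τ ∉ S', y' τ ∈ s τ
  · have : (fun z => S'.piecewise z y') ⁻¹' Set.univ.pi s =
        Set.univ.pi fun τ => if τ ∈ S' then s τ else Set.univ := by
      ext z
      simp only [Set.mem_preimage, Set.mem_pi, Set.mem_univ, true_implies]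
      refine forall_congr' fun τ => ?_
      by_cases h : τ ∈ S'
      · simp [h]
      · simp [h, hy τ h]
    rw [this, partialSample, Measure.pi_pi]
    refine Finset.prod_congr rfl fun τ _ => ?_
    by_cases h : τ ∈ S'
    · simp [h, hS h]
    · simp [h, Measure.dirac_apply' _ (hs τ), hy τ h]
  · push Not at hy
    obtain ⟨τ, hτ, hyτ⟩ := hy
    rw [Finset.prod_eq_zero (Finset.mem_univ τ)]
    · have : (fun z => S'.piecewise z y') ⁻¹' Set.univ.pi s = ∅ := by
        ext z
        simp only [Set.mem_preimage, Set.mem_pi, Set.mem_univ, true_implies, Set.mem_empty_iff_false,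
          iff_false, not_forall]
        exact ⟨τ, by simpa [hτ] using hyτ⟩
      rw [this, measure_empty]
    · simp [hτ, Measure.dirac_apply' _ (hs τ), hyτ]

/-- Tower property: the inner integral redraws the members in `S'` while all others are frozen at
the outer draw. -/
theorem lintegral_partialSample (hS : S' ⊆ S) {f : (ι → α) → ℝ≥0∞} (hf : Measurable f) :
    ∫⁻ z, f z ∂partialSample S ν y =
      ∫⁻ y', ∫⁻ z, f z ∂partialSample S' ν y' ∂partialSample S ν y := by
  have h := map_piecewise_prod_pi (fun τ => if τ ∈ S then ν else Measure.dirac (y τ)) S'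
  have hm : Measurable (fun q : (ι → α) × (ι → α) => S'.piecewise q.2 q.1) := by
    refine measurable_pi_lambda _ fun τ => ?_
    by_cases h : τ ∈ S'
    · simp only [h, Finset.piecewise_eq_of_mem]; fun_prop
    · simp only [h, not_false_eq_true, Finset.piecewise_eq_of_notMem]; fun_prop
  conv_lhs => rw [partialSample, ← h, lintegral_map hf hm,
    lintegral_prod (fun q => f (S'.piecewise q.2 q.1))
      (hf.comp hm).aemeasurable]
  refine lintegral_congr fun y' => ?_
  rw [← map_piecewise_partialSample (y := y) hS y', lintegral_map hf (measurable_piecewise S' y')]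
  rfl

theorem map_eval_partialSample {τ : ι} (hτ : τ ∈ S) :
    Measure.map (Function.eval τ) (partialSample S ν y) = ν := by
  have := (measurePreserving_eval (fun τ => if τ ∈ S then ν else Measure.dirac (y τ)) τ).map_eq
  rw [partialSample, this, if_pos hτ]

theorem ae_partialSample_mem {p : α → Prop} (hp : ∀ᵐ x ∂ν, p x) :
    ∀ᵐ z ∂partialSample S ν y, ∀ τ ∈ S, p (z τ) := by
  rw [ae_all_iff]
  intro τ
  by_cases hτ : τ ∈ S
  · have hp' : ∀ᵐ x ∂(if τ ∈ S then ν else Measure.dirac (y τ)), p x := by rwa [if_pos hτ]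
    have h := (Measure.tendsto_eval_ae_ae
      (μ := fun τ => if τ ∈ S then ν else Measure.dirac (y τ)) (i := τ)).eventually hp'
    exact h.mono fun z hz _ => hz
  · exact Eventually.of_forall fun z h => absurd h hτ

theorem ae_partialSample_eq [MeasurableSingletonClass α] :
    ∀ᵐ z ∂partialSample S ν y, ∀ τ ∉ S, z τ = y τ := by
  rw [ae_all_iff]
  intro τ
  by_cases hτ : τ ∈ S
  · exact Eventually.of_forall fun z h => absurd hτ h
  · have hp' : ∀ᵐ x ∂(if τ ∈ S then ν else Measure.dirac (y τ)), x = y τ := by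
      rw [if_neg hτ, ae_dirac_eq]; exact rfl
    have h := (Measure.tendsto_eval_ae_ae
      (μ := fun τ => if τ ∈ S then ν else Measure.dirac (y τ)) (i := τ)).eventually hp'
    exact h.mono fun z hz _ => hz

/-- The source of conditional independence: restricting a product law to a product event restricts
each factor, and normalizing each factor in `S` produces the power of `ν L`. -/
theorem setLIntegral_partialSample {L : Set α} (hL : MeasurableSet L) (hνL : ν L ≠ 0)
    (f : (ι → α) → ℝ≥0∞) :
    ∫⁻ z in {z | ∀ τ ∈ S, z τ ∈ L}, f z ∂partialSample S ν y =
      ν L ^ S.card * ∫⁻ z, f z ∂partialSample S (ν[|L]) y := by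
  have : IsProbabilityMeasure (ν[|L]) := cond_isProbabilityMeasure hνL
  have hset : {z : ι → α | ∀ τ ∈ S, z τ ∈ L} =
      Set.univ.pi fun τ => if τ ∈ S then L else Set.univ := by
    ext z
    simp only [Set.mem_ofPred_eq, Set.mem_pi, Set.mem_univ, true_implies]
    refine forall_congr' fun τ => ?_
    by_cases h : τ ∈ S <;> simp [h]
  have hmeas : (partialSample S ν y).restrict {z | ∀ τ ∈ S, z τ ∈ L} =
      ν L ^ S.card • partialSample S (ν[|L]) y := by
    rw [hset, partialSample, Measure.restrict_pi_pi]
    refine Measure.pi_eq fun s hs => ?_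
    rw [Measure.smul_apply, partialSample, Measure.pi_pi, smul_eq_mul]
    have hc : ν L ^ S.card = ∏ τ : ι, if τ ∈ S then ν L else 1 := by
      rw [Finset.prod_ite_mem]; simp
    rw [hc, ← Finset.prod_mul_distrib]
    refine Finset.prod_congr rfl fun τ _ => ?_
    by_cases h : τ ∈ S
    · simp only [h, if_true]
      rw [cond_apply hL, Measure.restrict_apply (hs τ), ← mul_assoc,
        ENNReal.mul_inv_cancel hνL (measure_ne_top _ _), one_mul, Set.inter_comm]
    · simp [h]
  rw [hmeas, lintegral_smul_measure, smul_eq_mul]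

/-- Conditioning on the event that the members with index in `S'` fall in a region determined by
the member with index `τ₀`. -/
theorem lintegral_indicator_partialSample_le [MeasurableSingletonClass α] (hS : S' ⊆ S) {τ₀ : ι}
    (hτ₀ : τ₀ ∉ S') (hS' : S'.Nonempty)
    {G : Set (ι → α)} (hGm : MeasurableSet G)
    (hG : ∀ z z' : ι → α, (∀ σ ∉ S', z σ = z' σ) → z ∈ G → z' ∈ G)
    {L : α → Set α} (hL : MeasurableSet {q : α × α | q.2 ∈ L q.1})
    {f : (ι → α) → ℝ≥0∞} (hf : Measurable f) {g : α → ℝ≥0∞} (hg : Measurable g) {B : ℝ≥0∞}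
    (hB : B ≠ ⊤)
    (h : ∀ᵐ y' ∂partialSample S ν y, y' ∈ G → ν (L (y' τ₀)) ≠ 0 →
      ∫⁻ z, f z ∂partialSample S' (ν[|L (y' τ₀)]) y' ≤ B * g (y' τ₀)) :
    ∫⁻ z, (G ∩ {z | ∀ σ ∈ S', z σ ∈ L (z τ₀)}).indicator f z ∂partialSample S ν y ≤
      B * ∫⁻ z, (G ∩ {z | ∀ σ ∈ S', z σ ∈ L (z τ₀)}).indicator (fun z => g (z τ₀)) z
        ∂partialSample S ν y := by
  set E : Set (ι → α) := G ∩ {z | ∀ σ ∈ S', z σ ∈ L (z τ₀)} with hE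
  have hEm : MeasurableSet E := by
    refine hGm.inter ?_
    have : {z : ι → α | ∀ σ ∈ S', z σ ∈ L (z τ₀)} = ⋂ σ ∈ S', {z | z σ ∈ L (z τ₀)} := by
      ext z; simp
    rw [this]
    refine Finset.measurableSet_biInter _ fun σ _ => ?_
    exact hL.preimage (f := fun z : ι → α => (z τ₀, z σ)) (by fun_prop)
  have hgm : Measurable fun z : ι → α => g (z τ₀) := hg.comp (measurable_pi_apply τ₀)
  have hLm : ∀ x, MeasurableSet (L x) := fun x =>
    hL.preimage (f := fun x' : α => (x, x')) (by fun_prop)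
  have hset : ∀ x, MeasurableSet {z : ι → α | ∀ σ ∈ S', z σ ∈ L x} := fun x => by
    have : {z : ι → α | ∀ σ ∈ S', z σ ∈ L x} = ⋂ σ ∈ S', {z | z σ ∈ L x} := by
      ext z; simp
    rw [this]
    exact Finset.measurableSet_biInter _ fun σ _ => (hLm x).preimage (measurable_pi_apply σ)
  -- With the coordinates outside `S'` frozen, both `G` and the region `L (z τ₀)` are determined, so
  -- the event only constrains the coordinates in `S'`.
  have inner : ∀ (F : (ι → α) → ℝ≥0∞) (y' : ι → α), y' ∈ G →
      ∫⁻ z, E.indicator F z ∂partialSample S' ν y' =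
        ∫⁻ z in {z | ∀ σ ∈ S', z σ ∈ L (y' τ₀)}, F z ∂partialSample S' ν y' := by
    intro F y' hy'
    rw [← lintegral_indicator (hset _)]
    refine lintegral_congr_ae ?_
    filter_upwards [ae_partialSample_eq (S := S') (ν := ν) (y := y')] with z hz
    have hzG : z ∈ G := hG y' z (fun σ hσ => (hz σ hσ).symm) hy'
    have : z ∈ E ↔ z ∈ {z : ι → α | ∀ σ ∈ S', z σ ∈ L (y' τ₀)} := by
      rw [hE, Set.mem_inter_iff, Set.mem_ofPred_eq, Set.mem_ofPred_eq, hz τ₀ hτ₀]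
      exact and_iff_right hzG
    by_cases hzE : z ∈ E
    · rw [Set.indicator_of_mem hzE, Set.indicator_of_mem (this.1 hzE)]
    · rw [Set.indicator_of_notMem hzE, Set.indicator_of_notMem (fun h => hzE (this.2 h))]
  rw [lintegral_partialSample hS (hf.indicator hEm), lintegral_partialSample hS (hgm.indicator hEm)]
  rw [← lintegral_const_mul' _ _ hB]
  refine lintegral_mono_ae ?_
  filter_upwards [h] with y' hy'
  by_cases hyG : y' ∈ G
  · rw [inner _ _ hyG, inner _ _ hyG]
    -- On a null region the conditional law is not a probability measure, but there the event is
    -- null because `S'` is nonempty.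
    by_cases h0 : ν (L (y' τ₀)) = 0
    · have : ∀ F : (ι → α) → ℝ≥0∞,
          ∫⁻ z in {z | ∀ σ ∈ S', z σ ∈ L (y' τ₀)}, F z ∂partialSample S' ν y' = 0 := by
        intro F
        refine setLIntegral_measure_zero _ _ ?_
        obtain ⟨σ, hσ⟩ := hS'
        refine measure_mono_null (t := Function.eval σ ⁻¹' L (y' τ₀)) (fun z hz => hz σ hσ) ?_
        rw [← Measure.map_apply (measurable_pi_apply σ) (hLm _), map_eval_partialSample hσ, h0]
      simp [this]
    · have : IsProbabilityMeasure (ν[|L (y' τ₀)]) := cond_isProbabilityMeasure h0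
      rw [setLIntegral_partialSample (hLm _) h0, setLIntegral_partialSample (hLm _) h0]
      have hgc : ∫⁻ z, g (z τ₀) ∂partialSample S' (ν[|L (y' τ₀)]) y' = g (y' τ₀) := by
        rw [lintegral_congr_ae (g := fun _ => g (y' τ₀))]
        · simp
        · filter_upwards [ae_partialSample_eq (S := S') (ν := ν[|L (y' τ₀)]) (y := y')] with z hz
          rw [hz τ₀ hτ₀]
      rw [hgc, mul_left_comm]
      exact mul_le_mul_right (hy' hyG h0) _
  · have : ∫⁻ z, E.indicator f z ∂partialSample S' ν y' = 0 := by
      rw [lintegral_congr_ae (g := fun _ => 0)]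
      · simp
      · filter_upwards [ae_partialSample_eq (S := S') (ν := ν) (y := y')] with z hz
        refine Set.indicator_of_notMem (fun hzE => hyG ?_) _
        exact hG z y' hz hzE.1
    rw [this]
    exact zero_le
end PartialSample

/-! ### The probability integral transform -/

theorem continuous_cdf_of_noAtoms (ρ : Measure ℝ) [IsProbabilityMeasure ρ] (h : ∀ t, ρ {t} = 0) :
    Continuous (cdf ρ) := by
  refine continuous_iff_continuousAt.2 fun t => ?_
  rw [(monotone_cdf ρ).continuousAt_iff_leftLim_eq_rightLim]
  have h1 := (cdf ρ).measure_singleton t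
  rw [measure_cdf, h t] at h1
  have h2 : cdf ρ t - Function.leftLim (cdf ρ) t ≤ 0 := ENNReal.ofReal_eq_zero.1 h1.symm
  have h3 := (monotone_cdf ρ).leftLim_le (le_refl t)
  rw [StieltjesFunction.rightLim_eq]
  linarith

theorem exists_cdf_eq (ρ : Measure ℝ) [IsProbabilityMeasure ρ] (h : ∀ t, ρ {t} = 0) {u : ℝ}
    (h0 : 0 < u) (h1 : u < 1) : ∃ t, cdf ρ t = u := by
  obtain ⟨s, hs⟩ := ((tendsto_cdf_atBot ρ).eventually (gt_mem_nhds h0)).exists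
  obtain ⟨s', hs'⟩ := ((tendsto_cdf_atTop ρ).eventually (lt_mem_nhds h1)).exists
  exact mem_range_of_exists_le_of_exists_ge (continuous_cdf_of_noAtoms ρ h) ⟨s, hs.le⟩ ⟨s', hs'.le⟩

theorem map_cdf_eq (ρ : Measure ℝ) [IsProbabilityMeasure ρ] (h : ∀ t, ρ {t} = 0) :
    ρ.map (cdf ρ) = volume.restrict (Set.Icc 0 1) := by
  have hm : Measurable (cdf ρ) := (monotone_cdf ρ).measurable
  have : IsProbabilityMeasure (ρ.map (cdf ρ)) := Measure.isProbabilityMeasure_map hm.aemeasurable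
  refine Measure.ext_of_Iic _ _ fun u => ?_
  rw [Measure.map_apply hm measurableSet_Iic, Measure.restrict_apply measurableSet_Iic]
  rcases lt_or_ge u 0 with hu | hu
  · have e1 : cdf ρ ⁻¹' Set.Iic u = ∅ := by
      ext x
      simp only [Set.mem_preimage, Set.mem_Iic, Set.mem_empty_iff_false, iff_false, not_le]
      exact hu.trans_le (cdf_nonneg ρ x)
    have e2 : Set.Iic u ∩ Set.Icc (0 : ℝ) 1 = ∅ := by
      ext x
      simp only [Set.mem_inter_iff, Set.mem_Iic, Set.mem_Icc, Set.mem_empty_iff_false, iff_false]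
      intro hx; linarith [hx.1, hx.2.1]
    rw [e1, e2]; simp
  rcases le_or_gt 1 u with hu1 | hu1
  · have e1 : cdf ρ ⁻¹' Set.Iic u = Set.univ := by
      ext x
      simp only [Set.mem_preimage, Set.mem_Iic, Set.mem_univ, iff_true]
      exact (cdf_le_one ρ x).trans hu1
    have e2 : Set.Iic u ∩ Set.Icc (0 : ℝ) 1 = Set.Icc 0 1 :=
      Set.inter_eq_right.2 fun x hx => hx.2.trans hu1
    rw [e1, e2]; simp
  have e2 : Set.Iic u ∩ Set.Icc (0 : ℝ) 1 = Set.Icc 0 u := by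
    ext x
    simp only [Set.mem_inter_iff, Set.mem_Iic, Set.mem_Icc]
    constructor
    · rintro ⟨h1, h2, -⟩; exact ⟨h2, h1⟩
    · rintro ⟨h1, h2⟩; exact ⟨h2, h1, h2.trans hu1.le⟩
  rw [e2, Real.volume_Icc, sub_zero]
  apply le_antisymm
  · refine ENNReal.le_of_forall_pos_le_add fun ε hε _ => ?_
    -- The distribution function may be flat at level `u`, so the preimage is compared with a point
    -- where a slightly higher level is taken; the second bound keeps that level below `1`.
    have hmin : u < min (u + ε) ((u + 1) / 2) := by
      rw [lt_min_iff]; constructor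
      · have : (0 : ℝ) < ε := hε
        linarith
      · linarith
    obtain ⟨t, ht⟩ := exists_cdf_eq ρ h (hu.trans_lt hmin)
      ((min_le_right _ _).trans_lt (by linarith))
    calc ρ (cdf ρ ⁻¹' Set.Iic u) ≤ ρ (Set.Iic t) := by
          refine measure_mono fun x hx => ?_
          by_contra hc
          have h1 := monotone_cdf ρ (not_le.1 hc).le
          have h2 : cdf ρ x ≤ u := hx
          rw [ht] at h1
          linarith
      _ = ENNReal.ofReal (min (u + ε) ((u + 1) / 2)) := by rw [← ofReal_cdf, ht]
      _ ≤ ENNReal.ofReal (u + ε) := ENNReal.ofReal_le_ofReal (min_le_left _ _)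
      _ = ENNReal.ofReal u + ε := by
          rw [ENNReal.ofReal_add hu ε.coe_nonneg, ENNReal.ofReal_coe_nnreal]
  · rcases hu.eq_or_lt with rfl | hu0
    · simp
    obtain ⟨t, ht⟩ := exists_cdf_eq ρ h hu0 hu1
    rw [← ht, ofReal_cdf]
    exact measure_mono fun x hx => monotone_cdf ρ hx

/-! ### Moments of the Beta distribution -/

section Beta
variable (p q : ℕ)

/-- Stein identity for the Beta density: the function `u ^ (p + 1) * (1 - u) ^ (q + 1) * g u`
vanishes at both ends, so its derivative integrates to zero. The moment identities below come from
special choices of `g`, with no value of a Beta integral needed. -/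
theorem integral_beta_stein {g g' : ℝ → ℝ} (hg : ∀ u, HasDerivAt g (g' u) u)
    (hg' : Continuous g') :
    ((p : ℝ) + q + 2) * ∫ u in (0 : ℝ)..1, (u - (p + 1) / (p + q + 2)) * g u * (u ^ p * (1 - u) ^ q)
      = ∫ u in (0 : ℝ)..1, u * (1 - u) * g' u * (u ^ p * (1 - u) ^ q) := by
  have hgc : Continuous g := continuous_iff_continuousAt.2 fun u => (hg u).continuousAt
  have hd : ∀ u ∈ Set.uIcc (0 : ℝ) 1, HasDerivAt
      (fun u : ℝ => u ^ (p + 1) * (1 - u) ^ (q + 1) * g u)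
      (u * (1 - u) * g' u * (u ^ p * (1 - u) ^ q) - ((p : ℝ) + q + 2) *
        ((u - (p + 1) / (p + q + 2)) * g u * (u ^ p * (1 - u) ^ q))) u := by
    intro u _
    have h1 : HasDerivAt (fun u : ℝ => u ^ (p + 1)) (((p : ℝ) + 1) * u ^ p) u := by
      simpa using hasDerivAt_pow (p + 1) u
    have h2 : HasDerivAt (fun u : ℝ => (1 - u) ^ (q + 1)) (-(((q : ℝ) + 1) * (1 - u) ^ q)) u := by
      have := ((hasDerivAt_id u).const_sub 1).fun_pow (q + 1)
      simpa using this
    refine ((h1.fun_mul h2).fun_mul (hg u)).congr_deriv ?_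
    have : (p : ℝ) + q + 2 ≠ 0 := by positivity
    field_simp
    ring
  have h := intervalIntegral.integral_eq_sub_of_hasDerivAt hd
    (Continuous.intervalIntegrable (by fun_prop) _ _)
  rw [intervalIntegral.integral_sub (Continuous.intervalIntegrable (by fun_prop) _ _)
    (Continuous.intervalIntegrable (by fun_prop) _ _),
    intervalIntegral.integral_const_mul] at h
  simp at h
  linarith

variable {p q} {N : ℝ} (h1 : N * ∫ u in (0 : ℝ)..1, u ^ p * (1 - u) ^ q = 1)

theorem beta_centered :
    N * ∫ u in (0 : ℝ)..1, (u - (p + 1) / (p + q + 2)) * (u ^ p * (1 - u) ^ q) = 0 := by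
  have h := integral_beta_stein p q (g := fun _ => 1) (g' := fun _ => 0)
    (fun u => hasDerivAt_const u 1) continuous_const
  simp only [mul_one, mul_zero, zero_mul, intervalIntegral.integral_zero] at h
  have : (p : ℝ) + q + 2 ≠ 0 := by positivity
  rw [(mul_eq_zero.1 h).resolve_left this, mul_zero]

theorem beta_mono (hN : 0 ≤ N) {φ ψ : ℝ → ℝ} (hφ : Continuous φ) (hψ : Continuous ψ)
    (h : ∀ u ∈ Set.Icc (0 : ℝ) 1, φ u ≤ ψ u) :
    N * ∫ u in (0 : ℝ)..1, φ u * (u ^ p * (1 - u) ^ q) ≤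
      N * ∫ u in (0 : ℝ)..1, ψ u * (u ^ p * (1 - u) ^ q) := by
  refine mul_le_mul_of_nonneg_left ?_ hN
  refine intervalIntegral.integral_mono_on zero_le_one
    (Continuous.intervalIntegrable (by fun_prop) _ _)
    (Continuous.intervalIntegrable (by fun_prop) _ _) fun u hu => ?_
  exact mul_le_mul_of_nonneg_right (h u hu)
    (mul_nonneg (pow_nonneg hu.1 _) (pow_nonneg (by linarith [hu.2]) _))

include h1

theorem beta_mean :
    N * ∫ u in (0 : ℝ)..1, u * (u ^ p * (1 - u) ^ q) = (p + 1) / (p + q + 2) := by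
  have h := beta_centered (p := p) (q := q) (N := N)
  simp only [sub_mul] at h
  rw [intervalIntegral.integral_sub (Continuous.intervalIntegrable (by fun_prop) _ _)
    (Continuous.intervalIntegrable (by fun_prop) _ _),
    intervalIntegral.integral_const_mul, mul_sub] at h
  have h2 : N * ((p + 1) / (p + q + 2) * ∫ u in (0 : ℝ)..1, u ^ p * (1 - u) ^ q) =
      (p + 1) / (p + q + 2) * (N * ∫ u in (0 : ℝ)..1, u ^ p * (1 - u) ^ q) := by ring
  rw [h2, h1] at h
  linarith

theorem beta_variance :
    ((p : ℝ) + q + 3) *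
      (N * ∫ u in (0 : ℝ)..1, (u - (p + 1) / (p + q + 2)) ^ 2 * (u ^ p * (1 - u) ^ q)) =
      (p + 1) / (p + q + 2) * (1 - (p + 1) / (p + q + 2)) := by
  set μ : ℝ := ((p : ℝ) + 1) / (p + q + 2) with hμ
  have h := integral_beta_stein p q (g := fun u => u - μ) (g' := fun _ => 1)
    (fun u => (hasDerivAt_id u).sub_const μ) continuous_const
  have e : ∀ u : ℝ, u * (1 - u) * 1 * (u ^ p * (1 - u) ^ q) =
      μ * (1 - μ) * (u ^ p * (1 - u) ^ q) + (1 - 2 * μ) * ((u - μ) * (u ^ p * (1 - u) ^ q)) -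
        (u - μ) ^ 2 * (u ^ p * (1 - u) ^ q) := fun u => by ring
  have e2 : ∀ u : ℝ, (u - μ) * (u - μ) * (u ^ p * (1 - u) ^ q) =
      (u - μ) ^ 2 * (u ^ p * (1 - u) ^ q) := fun u => by ring
  simp only [← hμ, e, e2] at h
  rw [intervalIntegral.integral_sub (Continuous.intervalIntegrable (by fun_prop) _ _)
    (Continuous.intervalIntegrable (by fun_prop) _ _), intervalIntegral.integral_add
    (Continuous.intervalIntegrable (by fun_prop) _ _)
    (Continuous.intervalIntegrable (by fun_prop) _ _), intervalIntegral.integral_const_mul,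
    intervalIntegral.integral_const_mul] at h
  have hc := beta_centered (p := p) (q := q) (N := N)
  rw [← hμ] at hc
  have h' := congrArg (N * ·) h
  simp only at h'
  linear_combination h' + μ * (1 - μ) * h1 + (1 - 2 * μ) * hc

variable (hN : 0 ≤ N)
include hN

theorem beta_variance_le :
    N * ∫ u in (0 : ℝ)..1, (u - (p + 1) / (p + q + 2)) ^ 2 * (u ^ p * (1 - u) ^ q) ≤
      (p + 1) / (p + q + 2) * (1 - (p + 1) / (p + q + 2)) / (p + q + 2) := by
  have h := beta_variance h1
  have h0 : 0 ≤ N * ∫ u in (0 : ℝ)..1, (u - (p + 1) / (p + q + 2)) ^ 2 * (u ^ p * (1 - u) ^ q) := by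
    have := beta_mono (p := p) (q := q) hN (φ := fun _ => 0) (ψ := fun u => (u - (p + 1) / (p + q + 2)) ^ 2)
      (by fun_prop) (by fun_prop) (fun u _ => sq_nonneg _)
    simpa using this
  rw [le_div_iff₀ (by positivity), ← h]
  nlinarith

/-- The Stein identity with the cube of the centered variable, together with `3 u (1 - u) ≤ 1`,
reduces the fourth moment to the variance and gains a second factor `1 / (p + q + 2)`. -/
theorem beta_fourth_le :
    N * ∫ u in (0 : ℝ)..1, (u - (p + 1) / (p + q + 2)) ^ 4 * (u ^ p * (1 - u) ^ q) ≤
      1 / ((p : ℝ) + q + 2) ^ 2 := by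
  set μ : ℝ := ((p : ℝ) + 1) / (p + q + 2) with hμ
  have hm : (0 : ℝ) < p + q + 2 := by positivity
  have hμ0 : 0 ≤ μ := by positivity
  have hμ1 : μ ≤ 1 := by rw [hμ, div_le_one hm]; linarith [(Nat.cast_nonneg q : (0 : ℝ) ≤ q)]
  have h := integral_beta_stein p q (g := fun u => (u - μ) ^ 3) (g' := fun u => 3 * (u - μ) ^ 2)
    (fun u => by simpa using ((hasDerivAt_id u).sub_const μ).fun_pow 3) (by fun_prop)
  rw [← hμ] at h
  have e : ∀ u : ℝ, (u - μ) * (u - μ) ^ 3 * (u ^ p * (1 - u) ^ q) =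
      (u - μ) ^ 4 * (u ^ p * (1 - u) ^ q) := fun u => by ring
  simp only [e] at h
  have hle := beta_mono (p := p) (q := q) hN (φ := fun u => u * (1 - u) * (3 * (u - μ) ^ 2))
    (ψ := fun u => 1 * (u - μ) ^ 2) (by fun_prop) (by fun_prop) (fun u hu => by
      nlinarith [mul_nonneg (sq_nonneg (u - μ)) (sq_nonneg (2 * u - 1)), sq_nonneg (u - μ)])
  simp only [one_mul] at hle
  rw [← h] at hle
  have hv := beta_variance_le h1 hN
  rw [← hμ] at hv
  have hμ2 : μ * (1 - μ) ≤ 1 := by nlinarith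
  have hv2 : μ * (1 - μ) / (p + q + 2) ≤ 1 / ((p : ℝ) + q + 2) := by gcongr
  rw [le_div_iff₀ (by positivity)]
  have h4 := (hle.trans hv).trans hv2
  rw [le_div_iff₀ hm] at h4
  nlinarith

theorem beta_sq_dist_le (v : ℝ) :
    N * ∫ u in (0 : ℝ)..1, (u - v) ^ 2 * (u ^ p * (1 - u) ^ q) ≤
      (p + 1) / (p + q + 2) * (1 - (p + 1) / (p + q + 2)) / (p + q + 2) +
        ((p + 1) / (p + q + 2) - v) ^ 2 := by
  set μ : ℝ := ((p : ℝ) + 1) / (p + q + 2) with hμ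
  have e : ∀ u : ℝ, (u - v) ^ 2 * (u ^ p * (1 - u) ^ q) =
      (u - μ) ^ 2 * (u ^ p * (1 - u) ^ q) + 2 * (μ - v) * ((u - μ) * (u ^ p * (1 - u) ^ q)) +
        (μ - v) ^ 2 * (u ^ p * (1 - u) ^ q) := fun u => by ring
  simp only [e]
  rw [intervalIntegral.integral_add (Continuous.intervalIntegrable (by fun_prop) _ _)
    (Continuous.intervalIntegrable (by fun_prop) _ _), intervalIntegral.integral_add
    (Continuous.intervalIntegrable (by fun_prop) _ _)
    (Continuous.intervalIntegrable (by fun_prop) _ _), intervalIntegral.integral_const_mul,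
    intervalIntegral.integral_const_mul]
  have hc := beta_centered (p := p) (q := q) (N := N)
  have hv := beta_variance_le h1 hN
  rw [← hμ] at hc hv
  calc _ = N * (∫ u in (0 : ℝ)..1, (u - μ) ^ 2 * (u ^ p * (1 - u) ^ q)) + 2 * (μ - v) *
        (N * ∫ u in (0 : ℝ)..1, (u - μ) * (u ^ p * (1 - u) ^ q)) + (μ - v) ^ 2 *
        (N * ∫ u in (0 : ℝ)..1, (u ^ p * (1 - u) ^ q)) := by ring
    _ ≤ _ := by rw [hc, h1]; linarith

theorem beta_fourth_dist_le (v : ℝ) :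
    N * ∫ u in (0 : ℝ)..1, (u - v) ^ 4 * (u ^ p * (1 - u) ^ q) ≤
      8 * (1 / ((p : ℝ) + q + 2) ^ 2 + ((p + 1) / (p + q + 2) - v) ^ 4) := by
  set μ : ℝ := ((p : ℝ) + 1) / (p + q + 2) with hμ
  have hle := beta_mono (p := p) (q := q) hN (φ := fun u => (u - v) ^ 4)
    (ψ := fun u => 8 * (u - μ) ^ 4 + 8 * (μ - v) ^ 4) (by fun_prop) (by fun_prop)
    (fun u _ => by
      have : u - v = (u - μ) + (μ - v) := by ring
      rw [this]
      generalize u - μ = s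
      generalize μ - v = t
      nlinarith [sq_nonneg (s - t), sq_nonneg (s ^ 2 - t ^ 2), sq_nonneg (s + t),
        mul_nonneg (sq_nonneg (s - t)) (sq_nonneg (s + t)),
        mul_nonneg (sq_nonneg (s - t)) (sq_nonneg (s - t)), mul_nonneg (sq_nonneg (s - t)) (sq_nonneg s),
        mul_nonneg (sq_nonneg (s - t)) (sq_nonneg t)])
  refine hle.trans ?_
  simp only [add_mul, mul_assoc]
  rw [intervalIntegral.integral_add (Continuous.intervalIntegrable (by fun_prop) _ _)
    (Continuous.intervalIntegrable (by fun_prop) _ _), intervalIntegral.integral_const_mul,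
    intervalIntegral.integral_const_mul, intervalIntegral.integral_const_mul]
  have h4 := beta_fourth_le h1 hN
  rw [← hμ] at h4
  calc _ = 8 * (N * ∫ u in (0 : ℝ)..1, (u - μ) ^ 4 * (u ^ p * (1 - u) ^ q)) + 8 * (μ - v) ^ 4 *
        (N * ∫ u in (0 : ℝ)..1, (u ^ p * (1 - u) ^ q)) := by ring
    _ ≤ _ := by rw [h1]; linarith

end Beta

/-! ### The affinity of two binary distributions -/

/-- The second-order Taylor coefficient `1/8` is weakened to `3/16`, which leaves room for the cubic
term near `x = 1`; away from `1` the fourth power takes over. With `x = y ^ 2` a factor `(y - 1) ^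
2` divides out and `key` is left. -/
theorem sqrt_lower_bound {x : ℝ} (hx : 0 ≤ x) :
    1 + (x - 1) / 2 - 3 / 16 * (x - 1) ^ 2 - (x - 1) ^ 4 ≤ √x := by
  obtain ⟨y, hy, rfl⟩ : ∃ y, 0 ≤ y ∧ x = y ^ 2 := ⟨√x, Real.sqrt_nonneg x, (Real.sq_sqrt hx).symm⟩
  rw [Real.sqrt_sq hy]
  have key : 1 / 2 ≤ 3 / 16 * (y + 1) ^ 2 + (y - 1) ^ 2 * (y + 1) ^ 4 := by
    rcases le_or_gt (3 / 5) y with h | h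
    · have h1 : (1 - y) ^ 2 ≥ 0 := sq_nonneg _
      rcases le_or_gt (16 / 25) y with h2 | h2
      · nlinarith [mul_nonneg (sq_nonneg (y - 1)) (sq_nonneg ((y + 1) ^ 2))]
      · have a1 : (1 / 3 : ℝ) ≤ 1 - y := by linarith
        have a2 : (1 / 9 : ℝ) ≤ (y - 1) ^ 2 := by nlinarith
        have a3 : (1 : ℝ) ≤ (y + 1) ^ 4 := one_le_pow₀ (by linarith)
        nlinarith
    · have a2 : (4 / 25 : ℝ) ≤ (y - 1) ^ 2 := by nlinarith
      have a3 : (1 + y) ^ 2 ≤ (y + 1) ^ 4 := by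
        have : (1 : ℝ) ≤ (1 + y) ^ 2 := one_le_pow₀ (by linarith)
        nlinarith
      have a4 : (1 - y ^ 2) ^ 2 * (1 + y) ^ 2 = (y - 1) ^ 2 * (y + 1) ^ 4 := by ring
      rw [← a4]
      have a5 : (1 - y ^ 2) ≥ 16 / 25 := by nlinarith
      have a6 : (1 - y ^ 2) ^ 2 ≥ 2 / 5 := by nlinarith
      have : (1 : ℝ) ≤ (1 + y) ^ 2 := one_le_pow₀ (by linarith)
      nlinarith
  nlinarith [mul_le_mul_of_nonneg_left key (sq_nonneg (y - 1))]

theorem sqrt_mul_sqrt_lower_bound {u v : ℝ} (hu : 0 ≤ u) (hv : 0 < v) :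
    v + (u - v) / 2 - 3 / 16 * ((u - v) ^ 2 / v) - (u - v) ^ 4 / v ^ 3 ≤ √v * √u := by
  have h := mul_le_mul_of_nonneg_left (sqrt_lower_bound (div_nonneg hu hv.le)) hv.le
  have e : v * √(u / v) = √v * √u := by
    rw [Real.sqrt_div hu]
    have : v = √v * √v := (Real.mul_self_sqrt hv.le).symm
    have h0 : √v ≠ 0 := (Real.sqrt_pos.2 hv).ne'
    field_simp
    rw [Real.sq_sqrt hv.le, mul_comm]
  rw [e] at h
  refine le_trans (le_of_eq ?_) h
  field_simp

/-- The expansions for `(u, v)` and `(1 - u, 1 - v)` are added: the linear terms cancel, and `1 / v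
+ 1 / (1 - v) = 1 / (v (1 - v))`. -/
theorem binary_deficit_le {u v : ℝ} (hu0 : 0 ≤ u) (hu1 : u ≤ 1) (hv0 : 0 < v) (hv1 : v < 1) :
    1 - √v * √u - √(1 - v) * √(1 - u) ≤
      3 / 16 * ((u - v) ^ 2 / (v * (1 - v))) + (1 / v ^ 3 + 1 / (1 - v) ^ 3) * (u - v) ^ 4 := by
  have h1 := sqrt_mul_sqrt_lower_bound hu0 hv0
  have h2 := sqrt_mul_sqrt_lower_bound (sub_nonneg.2 hu1) (sub_pos.2 hv1)
  have hv1' : 1 - v ≠ 0 := (sub_pos.2 hv1).ne'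
  have e1 : (u - v) ^ 2 / (v * (1 - v)) = (u - v) ^ 2 / v + (1 - u - (1 - v)) ^ 2 / (1 - v) := by
    field_simp; ring
  have e2 : (1 / v ^ 3 + 1 / (1 - v) ^ 3) * (u - v) ^ 4 =
      (u - v) ^ 4 / v ^ 3 + (1 - u - (1 - v)) ^ 4 / (1 - v) ^ 3 := by
    field_simp; ring
  rw [e1, e2]
  linarith

/-- The mass of the half-space on or below the cut `c` along coordinate `i`. -/
noncomputable def coordCdf {k : ℕ} (ν : Measure (Fin k → ℝ)) (i : Fin k) (c : EReal) : ℝ :=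
  ν.real {y | (y i : EReal) ≤ c}

/-! ### The law of the mass below an order statistic. -/

section OrderStat
variable {k n : ℕ} {ν : Measure (Fin k → ℝ)} [IsProbabilityMeasure ν]
  {S : Finset (Fin n)} {y : Fin n → Fin k → ℝ}

theorem coordCdf_mono (i : Fin k) : Monotone (coordCdf ν i) := fun _ _ h =>
  measureReal_mono fun _ hx => le_trans hx h

omit [IsProbabilityMeasure ν] in
theorem coordCdf_nonneg (i : Fin k) (c : EReal) : 0 ≤ coordCdf ν i c := measureReal_nonneg

theorem coordCdf_le_one (i : Fin k) (c : EReal) : coordCdf ν i c ≤ 1 := measureReal_le_one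

theorem measurable_coordCdf (i : Fin k) : Measurable (coordCdf ν i) := (coordCdf_mono i).measurable

theorem coordCdf_coe (i : Fin k) (t : ℝ) :
    coordCdf ν i (t : EReal) = cdf (ν.map fun x => x i) t := by
  have hi : Measurable fun x : Fin k → ℝ => x i := by fun_prop
  have : IsProbabilityMeasure (ν.map fun x => x i) :=
    Measure.isProbabilityMeasure_map hi.aemeasurable
  rw [cdf_eq_real, map_measureReal_apply (by fun_prop) measurableSet_Iic, coordCdf]
  congr 1
  ext x
  simp

theorem measure_coord_lt (i : Fin k) (hν : ∀ t, ν {x | x i = t} = 0) (t : ℝ) :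
    ν {x | x i < t} = ENNReal.ofReal (coordCdf ν i (t : EReal)) := by
  rw [coordCdf, ofReal_measureReal]
  refine measure_congr ?_
  have : ∀ᵐ x ∂ν, x i ≠ t := by rw [ae_iff]; simpa using hν t
  filter_upwards [this] with x hx
  apply propext
  change x i < t ↔ (x i : EReal) ≤ t
  rw [EReal.coe_le_coe_iff]
  exact ⟨le_of_lt, fun h => lt_of_le_of_ne h hx⟩

theorem measure_coord_gt (i : Fin k) (t : ℝ) :
    ν {x | t < x i} = ENNReal.ofReal (1 - coordCdf ν i (t : EReal)) := by
  have hm : MeasurableSet {x : Fin k → ℝ | (x i : EReal) ≤ t} :=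
    measurableSet_le (measurable_coe_real_ereal.comp (by fun_prop)) measurable_const
  rw [coordCdf, ← probReal_compl_eq_one_sub hm, ofReal_measureReal]
  congr 1
  ext x
  simp

theorem lintegral_coordCdf (i : Fin k) (hν : ∀ t, ν {x | x i = t} = 0) {g : ℝ → ℝ≥0∞}
    (hg : Measurable g) :
    ∫⁻ x, g (coordCdf ν i (x i : EReal)) ∂ν = ∫⁻ u in Set.Icc 0 1, g u := by
  have hi : Measurable fun x : Fin k → ℝ => x i := by fun_prop
  have : IsProbabilityMeasure (ν.map fun x => x i) :=
    Measure.isProbabilityMeasure_map hi.aemeasurable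
  rw [← map_cdf_eq (ν.map fun x => x i)
    (fun t => by rw [Measure.map_apply hi (measurableSet_singleton t)]; exact hν t),
    lintegral_map hg (monotone_cdf _).measurable, lintegral_map (f := fun t => g (cdf (ν.map fun x => x i) t))
      (hg.comp (monotone_cdf _).measurable) hi]
  simp only [coordCdf_coe]

/-- When only the member `τ` is redrawn, its coordinate misses the frozen value of `σ`, because the
marginals have no atoms. This also covers members `σ` outside `S`. -/
theorem ae_partialSample_coord_ne (hν : ∀ i t, ν {x | x i = t} = 0) :
    ∀ᵐ z ∂partialSample S ν y, ∀ τ ∈ S, ∀ σ, σ ≠ τ → ∀ i, z σ i ≠ z τ i := by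
  rw [ae_all_iff]; intro τ
  by_cases hτ : τ ∈ S
  swap
  · exact Eventually.of_forall fun z h => absurd h hτ
  suffices h : ∀ σ, σ ≠ τ → ∀ i, ∀ᵐ z ∂partialSample S ν y, z σ i ≠ z τ i by
    refine Eventually.mono ?_ fun z hz _ => hz
    rw [ae_all_iff]; intro σ
    by_cases hσ : σ = τ
    · exact Eventually.of_forall fun z h => absurd hσ h
    refine Eventually.mono ?_ fun z hz _ => hz
    rw [ae_all_iff]
    exact h σ hσ
  intro σ hσ i
  have hm : MeasurableSet {z : Fin n → Fin k → ℝ | z σ i = z τ i} :=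
    measurableSet_eq_fun (by fun_prop) (by fun_prop)
  have : {z : Fin n → Fin k → ℝ | ¬ z σ i ≠ z τ i} = {z | z σ i = z τ i} := by ext; simp
  rw [ae_iff, this, ← lintegral_indicator_one hm, lintegral_partialSample (S' := {τ})
    (Finset.singleton_subset_iff.2 hτ) (measurable_one.indicator hm)]
  rw [lintegral_congr (g := fun _ => 0) fun y' => ?_, lintegral_zero]
  rw [lintegral_indicator_one hm]
  refine measure_mono_null (t := {z | z σ ≠ y' σ} ∪ {z | z τ i = y' σ i}) ?_ ?_
  · intro z hz
    by_cases h : z σ = y' σ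
    · right; change z τ i = y' σ i; rw [← h]; exact hz.symm
    · left; exact h
  · refine measure_union_null ?_ ?_
    · have := ae_partialSample_eq (S := {τ}) (ν := ν) (y := y')
      exact ae_iff.1 (this.mono fun z hz => hz σ (by simpa using hσ))
    · have h2 := map_eval_partialSample (ν := ν) (y := y') (Finset.mem_singleton_self τ)
      have h3 := hν i (y' σ i)
      rw [← h2, Measure.map_apply (measurable_pi_apply τ)
        (measurableSet_eq_fun (by fun_prop) measurable_const)] at h3
      exact h3

/-- The members in `B` are below and the other members in `S` are above the member `τ`. -/
def rankEvent {k n : ℕ} (S : Finset (Fin n)) (i : Fin k) (τ : Fin n) (B : Finset (Fin n)) :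
    Set (Fin n → Fin k → ℝ) :=
  {z | (∀ σ ∈ B, z σ i < z τ i) ∧ ∀ σ ∈ S.erase τ \ B, z τ i < z σ i}

theorem measurableSet_rankEvent (S : Finset (Fin n)) (i : Fin k) (τ : Fin n)
    (B : Finset (Fin n)) : MeasurableSet (rankEvent S i τ B) := by
  have : rankEvent S i τ B = (⋂ σ ∈ B, {z : Fin n → Fin k → ℝ | z σ i < z τ i}) ∩
      ⋂ σ ∈ S.erase τ \ B, {z | z τ i < z σ i} := by
    ext z; simp [rankEvent]
  rw [this]
  exact (Finset.measurableSet_biInter _ fun σ _ => measurableSet_lt (by fun_prop) (by fun_prop)).inter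
    (Finset.measurableSet_biInter _ fun σ _ => measurableSet_lt (by fun_prop) (by fun_prop))

theorem rankEvent_eq_filter {i : Fin k} {τ : Fin n} {B : Finset (Fin n)} (hB : B ⊆ S.erase τ)
    {z : Fin n → Fin k → ℝ} (hz : z ∈ rankEvent S i τ B) :
    S.filter (fun σ => z σ i < z τ i) = B := by
  ext σ
  rw [Finset.mem_filter]
  constructor
  · rintro ⟨h1, h2⟩
    by_contra h
    have hne : σ ≠ τ := by rintro rfl; exact lt_irrefl _ h2
    exact lt_asymm h2 (hz.2 σ (Finset.mem_sdiff.2 ⟨Finset.mem_erase.2 ⟨hne, h1⟩, h⟩))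
  · exact fun h => ⟨Finset.mem_of_mem_erase (hB h), hz.1 σ h⟩

/-- With the member `τ` frozen, the others fall below or above it independently, with probabilities
`u` and `1 - u`, where `u` is the mass below `τ`; redrawing `τ` makes `u` uniform on the unit
interval. -/
theorem lintegral_rankEvent (i : Fin k) (hν : ∀ t, ν {x | x i = t} = 0) {τ : Fin n} (hτ : τ ∈ S)
    {B : Finset (Fin n)} (hB : B ⊆ S.erase τ) {φ : ℝ → ℝ≥0∞} (hφ : Measurable φ) :
    ∫⁻ z, (rankEvent S i τ B).indicator (fun z => φ (coordCdf ν i (z τ i : EReal))) z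
      ∂partialSample S ν y =
    ∫⁻ u in Set.Icc 0 1, φ u * ENNReal.ofReal (u ^ B.card * (1 - u) ^ ((S.erase τ).card - B.card)) := by
  have hmφ : Measurable fun z : Fin n → Fin k → ℝ => φ (coordCdf ν i (z τ i : EReal)) :=
    hφ.comp ((measurable_coordCdf i).comp (measurable_coe_real_ereal.comp (by fun_prop)))
  rw [lintegral_partialSample (Finset.erase_subset τ S)
    (hmφ.indicator (measurableSet_rankEvent S i τ B))]
  set w : ℝ → ℝ≥0∞ := fun u =>
    φ u * ENNReal.ofReal (u ^ B.card * (1 - u) ^ ((S.erase τ).card - B.card)) with hw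
  have hwm : Measurable w := by
    refine hφ.mul (Measurable.ennreal_ofReal ?_); fun_prop
  have inner : ∀ y' : Fin n → Fin k → ℝ,
      ∫⁻ z, (rankEvent S i τ B).indicator (fun z => φ (coordCdf ν i (z τ i : EReal))) z
        ∂partialSample (S.erase τ) ν y' = w (coordCdf ν i (y' τ i : EReal)) := by
    intro y'
    set t := y' τ i
    set s : Fin n → Set (Fin k → ℝ) := fun σ =>
      if σ ∈ B then {x | x i < t} else if σ ∈ S.erase τ then {x | t < x i} else Set.univ with hs
    have hsm : MeasurableSet (Set.univ.pi s) := by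
      refine MeasurableSet.univ_pi fun σ => ?_
      simp only [hs]
      split_ifs
      · exact measurableSet_lt (by fun_prop) measurable_const
      · exact measurableSet_lt measurable_const (by fun_prop)
      · exact MeasurableSet.univ
    have e : ∫⁻ z, (rankEvent S i τ B).indicator (fun z => φ (coordCdf ν i (z τ i : EReal))) z
        ∂partialSample (S.erase τ) ν y' = ∫⁻ z, (Set.univ.pi s).indicator
          (fun _ => φ (coordCdf ν i (t : EReal))) z ∂partialSample (S.erase τ) ν y' := by
      refine lintegral_congr_ae ?_
      filter_upwards [ae_partialSample_eq (S := S.erase τ) (ν := ν) (y := y')] with z hz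
      have hzτ : z τ = y' τ := hz τ (by simp)
      have hiff : z ∈ rankEvent S i τ B ↔ z ∈ Set.univ.pi s := by
        simp only [rankEvent, Set.mem_ofPred_eq, Set.mem_pi, Set.mem_univ, true_implies, hs, hzτ]
        constructor
        · rintro ⟨h1, h2⟩ σ
          split_ifs with hb hc
          · exact h1 σ hb
          · exact h2 σ (Finset.mem_sdiff.2 ⟨hc, hb⟩)
          · trivial
        · intro h
          refine ⟨fun σ hσ => ?_, fun σ hσ => ?_⟩
          · have := h σ; rw [if_pos hσ] at this; exact this
          · have := h σ
            rw [if_neg (Finset.mem_sdiff.1 hσ).2, if_pos (Finset.mem_sdiff.1 hσ).1] at this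
            exact this
      by_cases hz' : z ∈ rankEvent S i τ B
      · rw [Set.indicator_of_mem hz', Set.indicator_of_mem (hiff.1 hz'), hzτ]
      · rw [Set.indicator_of_notMem hz', Set.indicator_of_notMem (fun h => hz' (hiff.2 h))]
    rw [e, lintegral_indicator_const hsm, hw]
    congr 1
    rw [partialSample, Measure.pi_pi]
    have h1 : ∀ σ : Fin n, (if σ ∈ S.erase τ then ν else Measure.dirac (y' σ)) (s σ) =
        if σ ∈ S.erase τ then (if σ ∈ B then ν {x | x i < t} else ν {x | t < x i}) else 1 := by
      intro σ
      by_cases hσ : σ ∈ S.erase τ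
      · by_cases hb : σ ∈ B
        · simp only [hs, hσ, hb, if_true]
        · simp only [hs, hσ, hb, if_true, if_false]
      · have hb : σ ∉ B := fun h => hσ (hB h)
        simp only [hs, hσ, hb, if_false]
        simp
    rw [Finset.prod_congr rfl fun σ _ => h1 σ, Finset.prod_ite_mem, Finset.univ_inter,
      ← Finset.prod_sdiff hB,
      Finset.prod_congr (s₂ := S.erase τ \ B) (g := fun _ => ν {x | t < x i}) rfl
        (fun σ hσ => if_neg (Finset.mem_sdiff.1 hσ).2),
      Finset.prod_congr (s₂ := B) (g := fun _ => ν {x | x i < t}) rfl (fun σ hσ => if_pos hσ),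
      Finset.prod_const, Finset.prod_const, Finset.card_sdiff_of_subset hB, measure_coord_lt i hν,
      measure_coord_gt, ENNReal.ofReal_mul (pow_nonneg (coordCdf_nonneg i _) _),
      ENNReal.ofReal_pow (coordCdf_nonneg i _),
      ENNReal.ofReal_pow (sub_nonneg.2 (coordCdf_le_one i _)), mul_comm]
  simp only [inner]
  have hwm' : Measurable fun x : Fin k → ℝ => w (coordCdf ν i (x i : EReal)) :=
    hwm.comp ((measurable_coordCdf i).comp (measurable_coe_real_ereal.comp (by fun_prop)))
  have h2 := lintegral_map (μ := partialSample S ν y) hwm' (measurable_pi_apply τ)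
  have h3 : Measure.map (fun a : Fin n → Fin k → ℝ => a τ) (partialSample S ν y) = ν :=
    map_eval_partialSample hτ
  rw [h3] at h2
  rw [← h2, lintegral_coordCdf i hν hwm]

/-- Almost surely exactly one pair `(τ, B)` tells which member is the order statistic and which `r -
1` members lie below it. All pairs contribute the same integral, and the factor in front counts
them. -/
theorem lintegral_orderStat (i : Fin k) (hν : ∀ i t, ν {x | x i = t} = 0) {r : ℕ} (hr : 1 ≤ r)
    (hrS : r ≤ S.card) {φ : ℝ → ℝ≥0∞} (hφ : Measurable φ) :
    ∫⁻ z, φ (coordCdf ν i (orderStat S (fun τ => z τ i) r)) ∂partialSample S ν y =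
      (S.card * (S.card - 1).choose (r - 1) : ℕ) *
        ∫⁻ u in Set.Icc 0 1, φ u * ENNReal.ofReal (u ^ (r - 1) * (1 - u) ^ (S.card - r)) := by
  have hsum : ∀ᵐ z ∂partialSample S ν y,
      φ (coordCdf ν i (orderStat S (fun τ => z τ i) r)) =
        ∑ τ ∈ S, ∑ B ∈ (S.erase τ).powersetCard (r - 1),
          (rankEvent S i τ B).indicator (fun z => φ (coordCdf ν i (z τ i : EReal))) z := by
    filter_upwards [ae_partialSample_coord_ne (S := S) (y := y) hν] with z hz
    have hinj : Set.InjOn (fun τ => z τ i) S := fun σ hσ τ hτ h => by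
      by_contra hne
      exact hz τ hτ σ hne i h
    obtain ⟨τ, hτ, hcard⟩ := exists_card_filter_le_eq S (fun τ => z τ i) hinj hr hrS
    have hO := orderStat_eq_of_card hτ hcard
    have hle : ∀ {τ}, τ ∈ S → (S.filter (fun σ => z σ i ≤ z τ i)).card =
        (S.filter (fun σ => z σ i < z τ i)).card + 1 := by
      intro τ hτ
      rw [← Finset.card_insert_of_notMem (a := τ) (s := S.filter (fun σ => z σ i < z τ i)) (by simp)]
      congr 1
      ext σ
      simp only [Finset.mem_filter, Finset.mem_insert]
      constructor
      · rintro ⟨h1, h2⟩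
        by_cases h : σ = τ
        · exact Or.inl h
        · exact Or.inr ⟨h1, lt_of_le_of_ne h2 (hz τ hτ σ h i)⟩
      · rintro (rfl | ⟨h1, h2⟩)
        · exact ⟨hτ, le_rfl⟩
        · exact ⟨h1, h2.le⟩
    have hτB : S.filter (fun σ => z σ i < z τ i) ∈ (S.erase τ).powersetCard (r - 1) := by
      rw [Finset.mem_powersetCard]
      refine ⟨fun σ hσ => ?_, ?_⟩
      · rw [Finset.mem_filter] at hσ
        exact Finset.mem_erase.2 ⟨by rintro rfl; exact lt_irrefl _ hσ.2, hσ.1⟩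
      · have := hle hτ; omega
    rw [Finset.sum_eq_single_of_mem τ hτ, Finset.sum_eq_single_of_mem _ hτB]
    · rw [Set.indicator_of_mem, hO]
      refine ⟨fun σ hσ => (Finset.mem_filter.1 hσ).2, fun σ hσ => ?_⟩
      rw [Finset.mem_sdiff, Finset.mem_erase, Finset.mem_filter] at hσ
      have h1 := hz τ hτ σ hσ.1.1 i
      exact lt_of_le_of_ne (not_lt.1 fun h => hσ.2 ⟨hσ.1.2, h⟩) (Ne.symm h1)
    · intro B hB hne
      refine Set.indicator_of_notMem (fun h => hne ?_) _
      exact (rankEvent_eq_filter (Finset.mem_powersetCard.1 hB).1 h).symm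
    · intro σ hσ hne
      refine Finset.sum_eq_zero fun B hB => Set.indicator_of_notMem (fun h => hne ?_) _
      have h1 := rankEvent_eq_filter (Finset.mem_powersetCard.1 hB).1 h
      have h2 := hle hσ
      rw [h1, (Finset.mem_powersetCard.1 hB).2] at h2
      have h3 := orderStat_eq_of_card (v := fun τ => z τ i) (r := r) hσ (by omega)
      rw [h3] at hO
      exact hinj hσ hτ (EReal.coe_eq_coe_iff.1 hO)
  rw [lintegral_congr_ae hsum, lintegral_finsetSum' _ fun τ _ => ?_]
  · have : ∀ τ ∈ S, ∫⁻ z, ∑ B ∈ (S.erase τ).powersetCard (r - 1),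
          (rankEvent S i τ B).indicator (fun z => φ (coordCdf ν i (z τ i : EReal))) z
          ∂partialSample S ν y = (S.card - 1).choose (r - 1) *
        ∫⁻ u in Set.Icc 0 1, φ u * ENNReal.ofReal (u ^ (r - 1) * (1 - u) ^ (S.card - r)) := by
      intro τ hτ
      rw [lintegral_finsetSum' _ fun B _ => ?_]
      · rw [Finset.sum_congr rfl fun B hB => lintegral_rankEvent i (hν i) hτ
          (Finset.mem_powersetCard.1 hB).1 hφ]
        have hc := Finset.card_erase_of_mem hτ
        rw [Finset.sum_congr rfl (g := fun _ => ∫⁻ u in Set.Icc 0 1,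
          φ u * ENNReal.ofReal (u ^ (r - 1) * (1 - u) ^ (S.card - r))) fun B hB => by
            rw [(Finset.mem_powersetCard.1 hB).2, hc]
            have : S.card - 1 - (r - 1) = S.card - r := by omega
            rw [this], Finset.sum_const, Finset.card_powersetCard, hc, nsmul_eq_mul]
      · refine (Measurable.indicator ?_ (measurableSet_rankEvent S i τ B)).aemeasurable
        exact hφ.comp ((measurable_coordCdf i).comp (measurable_coe_real_ereal.comp (by fun_prop)))
    rw [Finset.sum_congr rfl this, Finset.sum_const, nsmul_eq_mul]
    push_cast
    rw [mul_assoc]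
  · refine Finset.aemeasurable_fun_sum _ fun B _ => ?_
    refine (Measurable.indicator ?_ (measurableSet_rankEvent S i τ B)).aemeasurable
    exact hφ.comp ((measurable_coordCdf i).comp (measurable_coe_real_ereal.comp (by fun_prop)))

/-- The law of the mass below an order statistic is a Beta distribution. -/
theorem exists_beta_law_orderStat (i : Fin k) (hν : ∀ i t, ν {x | x i = t} = 0) {p q : ℕ}
    (hpq : S.card = p + q + 1) :
    ∃ N : ℝ, 0 ≤ N ∧ N * (∫ u in (0 : ℝ)..1, u ^ p * (1 - u) ^ q) = 1 ∧
      ∀ ψ : ℝ → ℝ, Continuous ψ → (∀ u ∈ Set.Icc (0 : ℝ) 1, 0 ≤ ψ u) →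
        ∫⁻ z, ENNReal.ofReal (ψ (coordCdf ν i (orderStat S (fun τ => z τ i) (p + 1))))
          ∂partialSample S ν y =
        ENNReal.ofReal (N * ∫ u in (0 : ℝ)..1, ψ u * (u ^ p * (1 - u) ^ q)) := by
  have key : ∀ ψ : ℝ → ℝ, Continuous ψ → (∀ u ∈ Set.Icc (0 : ℝ) 1, 0 ≤ ψ u) →
        ∫⁻ z, ENNReal.ofReal (ψ (coordCdf ν i (orderStat S (fun τ => z τ i) (p + 1))))
          ∂partialSample S ν y =
        ENNReal.ofReal ((S.card * (S.card - 1).choose p : ℕ) *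
          ∫ u in (0 : ℝ)..1, ψ u * (u ^ p * (1 - u) ^ q)) := by
    intro ψ hψ hψ0
    have h := lintegral_orderStat (y := y) i hν (r := p + 1) (by omega) (by omega : p + 1 ≤ S.card)
      (φ := fun u => ENNReal.ofReal (ψ u)) (by fun_prop)
    rw [h, Nat.add_sub_cancel, show S.card - (p + 1) = q by omega,
      ENNReal.ofReal_mul (Nat.cast_nonneg _), ENNReal.ofReal_natCast,
      intervalIntegral.integral_of_le zero_le_one, ← integral_Icc_eq_integral_Ioc,
      ofReal_integral_eq_lintegral_ofReal]
    · congr 1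
      refine setLIntegral_congr_fun measurableSet_Icc fun u hu => ?_
      rw [ENNReal.ofReal_mul (hψ0 u hu)]
    · exact (Continuous.continuousOn (by fun_prop)).integrableOn_compact isCompact_Icc
    · filter_upwards [ae_restrict_mem measurableSet_Icc] with u hu
      exact mul_nonneg (hψ0 u hu) (mul_nonneg (pow_nonneg hu.1 _)
        (pow_nonneg (sub_nonneg.2 hu.2) _))
  -- The normalization of `N` follows from the case `ψ = 1`.
  refine ⟨_, Nat.cast_nonneg _, ?_, key⟩
  have h := key (fun _ => 1) continuous_const (fun _ _ => zero_le_one)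
  simp only [ENNReal.ofReal_one, lintegral_one, measure_univ, one_mul] at h
  exact (ENNReal.ofReal_eq_one.1 h.symm)

end OrderStat

/-! ### The expected deficit of one binary split in the presence of strays. -/

theorem sqrt_mul_sqrt_le_half_add {u v : ℝ} (hv : 0 ≤ v) (hu : 0 ≤ u) :
    √v * √u ≤ (v + u) / 2 := by
  have := sq_nonneg (√v - √u)
  have h1 := Real.sq_sqrt hv
  have h2 := Real.sq_sqrt hu
  have e : (√v - √u) ^ 2 = √v ^ 2 + √u ^ 2 - 2 * (√v * √u) := by ring
  linarith

/-- The coefficient of `(b - v) ^ 2` has to stay `1`, so for `u ≤ v` the square `(a - v) ^ 2` is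
traded for `(b - v) ^ 2` at the price `(b - a) ((v - a) + (v - b))`. Either the last factor is at
most `δ`, or `v - a ≥ δ / 2` and the fourth power dominates. -/
theorem sq_dist_le_of_mem_Icc {δ v a b u : ℝ} (hδ : 0 < δ) (hav : v - a ≤ 1) (hau : a ≤ u)
    (hub : u ≤ b) :
    (u - v) ^ 2 ≤ (b - v) ^ 2 + δ * (b - a) + 16 / δ ^ 3 * ((a - v) ^ 4 + (b - v) ^ 4) := by
  have hba : 0 ≤ δ * (b - a) := mul_nonneg hδ.le (by linarith)
  have h0 : 0 ≤ 16 / δ ^ 3 * ((a - v) ^ 4 + (b - v) ^ 4) := by positivity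
  rcases le_total u v with h | h
  swap
  · have := pow_le_pow_left₀ (by linarith : 0 ≤ u - v) (by linarith : u - v ≤ b - v) 2
    linarith
  have h1 : (u - v) ^ 2 ≤ (a - v) ^ 2 := by
    have := pow_le_pow_left₀ (by linarith : 0 ≤ v - u) (by linarith : v - u ≤ v - a) 2
    have e1 : (v - u) ^ 2 = (u - v) ^ 2 := by ring
    have e2 : (v - a) ^ 2 = (a - v) ^ 2 := by ring
    linarith
  have h2 : (a - v) ^ 2 - (b - v) ^ 2 = (b - a) * ((v - a) + (v - b)) := by ring
  rcases le_total ((v - a) + (v - b)) δ with h3 | h3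
  · have := mul_le_mul_of_nonneg_left h3 (by linarith : 0 ≤ b - a)
    linarith
  · have h4 : δ ≤ 2 * (v - a) := by linarith
    have h5 : δ ^ 3 ≤ 8 * (v - a) ^ 3 := by
      have := pow_le_pow_left₀ hδ.le h4 3
      have e : (2 * (v - a)) ^ 3 = 8 * (v - a) ^ 3 := by ring
      linarith
    have h6 : (a - v) ^ 2 ≤ 16 / δ ^ 3 * ((a - v) ^ 4 + (b - v) ^ 4) := by
      rw [div_mul_eq_mul_div, le_div_iff₀ (by positivity)]
      have h8 : (a - v) ^ 2 * δ ^ 3 ≤ (a - v) ^ 2 * (8 * (v - a) ^ 3) :=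
        mul_le_mul_of_nonneg_left h5 (sq_nonneg _)
      have h9 : (a - v) ^ 2 * (8 * (v - a) ^ 3) = 8 * (v - a) * (a - v) ^ 4 := by ring
      have h7 : 0 ≤ (b - v) ^ 4 := by positivity
      have h11 : 0 ≤ (a - v) ^ 4 := by positivity
      have h10 := mul_le_mul_of_nonneg_right (by linarith : 8 * (v - a) ≤ 16) h11
      linarith
    linarith [sq_nonneg (b - v)]

/-- The leading coefficient is kept exact, since it is later multiplied by a variance close to `v (1
- v) / N`. The fourth-order terms only need constants depending on `K` and `δ`, for which `1 / v`
and `1 / (1 - v)` are bounded by `K`. -/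
theorem binary_deficit_le_of_mem_Icc {K δ v a b u : ℝ} (hK : 0 < K) (hδ : 0 < δ)
    (hv : 1 / K ≤ v) (hv1 : v ≤ 1 - 1 / K) (ha : 0 ≤ a) (hau : a ≤ u) (hub : u ≤ b) (hb : b ≤ 1) :
    1 - √v * √u - √(1 - v) * √(1 - u) ≤
      3 / 16 / (v * (1 - v)) * ((b - v) ^ 2 + δ * (b - a)) +
        (3 * K ^ 2 / δ ^ 3 + 2 * K ^ 3) * ((a - v) ^ 4 + (b - v) ^ 4) := by
  have hK1 : 0 < 1 / K := by positivity
  have hv0 : 0 < v := by linarith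
  have hv2 : 0 < 1 - v := by linarith
  refine (binary_deficit_le (ha.trans hau) (hub.trans hb) hv0 (by linarith)).trans ?_
  have hKv : 1 / v ≤ K := by rw [div_le_iff₀ hv0]; rw [div_le_iff₀ hK] at hv; linarith
  have hKv2 : 1 / (1 - v) ≤ K := by
    rw [div_le_iff₀ hv2]; have : 1 / K ≤ 1 - v := by linarith
    rw [div_le_iff₀ hK] at this; linarith
  have e3 : 1 / v ^ 3 + 1 / (1 - v) ^ 3 ≤ 2 * K ^ 3 := by
    have h1 := pow_le_pow_left₀ (by positivity) hKv 3
    have h2 := pow_le_pow_left₀ (by positivity) hKv2 3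
    rw [div_pow, one_pow] at h1 h2
    linarith
  have e2 : 1 / (v * (1 - v)) ≤ K ^ 2 := by
    have := mul_le_mul hKv hKv2 (by positivity) hK.le
    rw [div_mul_div_comm, one_mul] at this
    linarith
  have hfour : (u - v) ^ 4 ≤ (a - v) ^ 4 + (b - v) ^ 4 := by
    have ha4 : 0 ≤ (a - v) ^ 4 := by positivity
    have hb4 : 0 ≤ (b - v) ^ 4 := by positivity
    rcases le_total u v with h | h
    · have := pow_le_pow_left₀ (by linarith : 0 ≤ v - u) (by linarith : v - u ≤ v - a) 4
      have e1 : (v - u) ^ 4 = (u - v) ^ 4 := by ring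
      have e2 : (v - a) ^ 4 = (a - v) ^ 4 := by ring
      linarith
    · have := pow_le_pow_left₀ (by linarith : 0 ≤ u - v) (by linarith : u - v ≤ b - v) 4
      linarith
  set s : ℝ := (a - v) ^ 4 + (b - v) ^ 4 with hs
  have hs0 : 0 ≤ s := by positivity
  have htwo : (u - v) ^ 2 ≤ (b - v) ^ 2 + δ * (b - a) + 16 / δ ^ 3 * s :=
    sq_dist_le_of_mem_Icc hδ (by linarith) hau hub
  set α := 3 / 16 / (v * (1 - v)) with hα
  have hα0 : 0 ≤ α := by positivity
  have hαK : α ≤ 3 / 16 * K ^ 2 := by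
    rw [hα, div_eq_mul_one_div]; exact mul_le_mul_of_nonneg_left e2 (by norm_num)
  have t1 : 3 / 16 * ((u - v) ^ 2 / (v * (1 - v))) = α * (u - v) ^ 2 := by
    rw [hα]; field_simp
  rw [t1]
  have t2 := mul_le_mul_of_nonneg_left htwo hα0
  have t3 : α * (16 / δ ^ 3 * s) ≤ 3 * K ^ 2 / δ ^ 3 * s := by
    have : 3 * K ^ 2 / δ ^ 3 * s = 3 / 16 * K ^ 2 * (16 / δ ^ 3 * s) := by ring
    rw [this]
    exact mul_le_mul_of_nonneg_right hαK (by positivity)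
  have t4 : (1 / v ^ 3 + 1 / (1 - v) ^ 3) * (u - v) ^ 4 ≤ 2 * K ^ 3 * s := by
    refine mul_le_mul e3 hfour (by positivity) (by positivity)
  nlinarith

section
variable {k n : ℕ} {ν : Measure (Fin k → ℝ)} [IsProbabilityMeasure ν]
  {S M : Finset (Fin n)} {y : Fin n → Fin k → ℝ}

theorem orderStat_superset_le {v : Fin n → ℝ} {r : ℕ} (h : S ⊆ M) :
    orderStat M v r ≤ orderStat S v r :=
  orderStat_anti fun _ ht => ht.trans (Finset.card_le_card (Finset.filter_subset_filter _ h))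

/-- At most `w` of the values counted in `M` are missing from `S`. With the preceding bound, an
order statistic of a region with strays is squeezed between two order statistics of its i.i.d.
members. -/
theorem orderStat_sub_le_superset {v : Fin n → ℝ} {r w : ℕ} (hw : (M \ S).card ≤ w) :
    orderStat S v (r - w) ≤ orderStat M v r := by
  refine orderStat_anti fun t ht => ?_
  have : M.filter (fun τ => (v τ : EReal) ≤ t) ⊆ S.filter (fun τ => (v τ : EReal) ≤ t) ∪ (M \ S) := by
    intro τ hτ
    rw [Finset.mem_filter] at hτ
    rw [Finset.mem_union, Finset.mem_filter, Finset.mem_sdiff]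
    by_cases h : τ ∈ S
    · exact Or.inl ⟨h, hτ.2⟩
    · exact Or.inr ⟨hτ.1, h⟩
  have := (Finset.card_le_card this).trans (Finset.card_union_le _ _)
  omega

theorem measurable_orderStat_const (i : Fin k) (r : ℕ) :
    Measurable fun z : Fin n → Fin k → ℝ => orderStat S (fun τ => z τ i) r := by
  refine measurable_of_Iic fun t => ?_
  rcases eq_or_ne t ⊤ with rfl | ht
  · simp
  have : (fun z : Fin n → Fin k → ℝ => orderStat S (fun τ => z τ i) r) ⁻¹' Set.Iic t =
      {z | r ≤ (Finset.univ.filter (fun τ => τ ∈ S ∧ (z τ i : EReal) ≤ t)).card} := by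
    ext z
    simp only [Set.mem_preimage, Set.mem_Iic, orderStat_le_iff ht, Set.mem_ofPred_eq]
    rw [← Finset.filter_filter, Finset.filter_mem_eq_inter, Finset.univ_inter]
  rw [this]
  refine measurableSet_le measurable_const (measurable_card_filter
    (fun τ (z : Fin n → Fin k → ℝ) => τ ∈ S ∧ (z τ i : EReal) ≤ t) fun τ => ?_)
  exact (MeasurableSet.const _).inter (measurableSet_coord_le i τ t)

/-- The members of the region `A` are those in `S` and at most `w` others. -/
def AlmostMembers (S : Finset (Fin n)) (A : Set (Fin k → ℝ)) (w : ℕ) (z : Fin n → Fin k → ℝ) :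
    Prop :=
  S ⊆ members z A ∧ (members z A \ S).card ≤ w

theorem ae_almostMembers {A : Set (Fin k → ℝ)} {w : ℕ} (hA : ∀ᵐ x ∂ν, x ∈ A)
    (hw : (members y A \ S).card ≤ w) :
    ∀ᵐ z ∂partialSample S ν y, AlmostMembers S A w z ∧
      (members z A).card = S.card + (members y A \ S).card := by
  filter_upwards [ae_partialSample_mem (S := S) (y := y) hA,
    ae_partialSample_eq (S := S) (ν := ν) (y := y)] with z h1 h2
  have hsub : S ⊆ members z A := fun τ hτ => mem_members.2 (h1 τ hτ)
  have heq : members z A \ S = members y A \ S := by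
    ext τ
    simp only [Finset.mem_sdiff, mem_members]
    refine and_congr_left fun h => ?_
    rw [h2 τ h]
  refine ⟨⟨hsub, heq ▸ hw⟩, ?_⟩
  rw [← heq, Finset.card_sdiff_of_subset hsub]
  have := Finset.card_le_card hsub
  omega

theorem le_ofReal_sub_of_add_le {X : ℝ≥0∞} {c d : ℝ} (hc : 0 ≤ c)
    (h : X + ENNReal.ofReal c ≤ ENNReal.ofReal d) : X ≤ ENNReal.ofReal (d - c) := by
  rw [ENNReal.ofReal_sub _ hc]
  exact ENNReal.le_sub_of_add_le_right ENNReal.ofReal_ne_top h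

/-- The numerical conditions on the rank `r` and the target fraction `v` of a binary split. -/
structure SplitRank (K : ℝ) (m r : ℕ) (v : ℝ) : Prop where
  lower : 1 / K ≤ v
  upper : v ≤ 1 - 1 / K
  abs_sub_le : |(r : ℝ) - v * m| ≤ 2

/-- The rank error `2`, at most `w` strays and the passage from `N` to the `N + 1` in the Beta mean
add up to at most `w + 3`. The condition on `N` keeps both `r` and `r - w` between `1` and `N`. -/
theorem SplitRank.bounds {K : ℝ} {m r : ℕ} {v : ℝ} (h : SplitRank K m r v) (hK : 0 < K) {w N : ℕ}
    (hN : N ≤ m) (hm : m ≤ N + w) (hlarge : K * (w + 3) ≤ N) :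
    w + 1 ≤ r ∧ r ≤ N ∧ |(r : ℝ) - v * (N + 1)| ≤ w + 3 ∧
      |((r - w : ℕ) : ℝ) - v * (N + 1)| ≤ w + 3 := by
  obtain ⟨h1, h2, h3⟩ := h
  have hK0 : 0 < 1 / K := by positivity
  rw [abs_le] at h3
  have hN' : (N : ℝ) ≤ m := by exact_mod_cast hN
  have hm' : (m : ℝ) ≤ N + w := by exact_mod_cast hm
  have hw0 : (0 : ℝ) ≤ w := Nat.cast_nonneg _
  have hN0 : (0 : ℝ) ≤ N := Nat.cast_nonneg _
  have hl : (w : ℝ) + 3 ≤ 1 / K * N := by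
    rw [one_div, inv_mul_eq_div, le_div_iff₀ hK]; linarith
  have a1 : 1 / K * N ≤ v * m := mul_le_mul h1 hN' hN0 (by linarith)
  have a2 : v * m ≤ v * (N + w) := mul_le_mul_of_nonneg_left hm' (by linarith)
  have a3 : 1 / K * N ≤ (1 - v) * N := mul_le_mul_of_nonneg_right (by linarith) hN0
  have a4 : v * w ≤ w := by nlinarith
  have a5 : v * N ≤ v * m := mul_le_mul_of_nonneg_left hN' (by linarith)
  have b1 : ((w + 1 : ℕ) : ℝ) ≤ r := by push_cast; linarith
  have b1' : w + 1 ≤ r := by exact_mod_cast b1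
  have b2 : (r : ℝ) ≤ N := by linarith
  refine ⟨b1', by exact_mod_cast b2, ?_, ?_⟩
  · rw [abs_le]; constructor <;> linarith
  · rw [Nat.cast_sub (by omega), abs_le]; constructor <;> linarith

theorem beta_params {r N : ℕ} (h1 : 1 ≤ r) (h2 : r ≤ N) : ∃ p q : ℕ, r = p + 1 ∧ N = p + q + 1 :=
  ⟨r - 1, N - r, by omega, by omega⟩

theorem beta_mean_dist {p q : ℕ} {D v : ℝ}
    (h : |((p + 1 : ℕ) : ℝ) - v * ((p + q + 1 : ℕ) + 1)| ≤ D) :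
    |((p : ℝ) + 1) / (p + q + 2) - v| ≤ D / (p + q + 2) := by
  have hm : (0 : ℝ) < p + q + 2 := by positivity
  have : ((p : ℝ) + 1) / (p + q + 2) - v = (((p + 1 : ℕ) : ℝ) - v * ((p + q + 1 : ℕ) + 1)) / (p + q + 2) := by
    push_cast; field_simp; ring
  rw [this, abs_div, abs_of_pos hm]
  gcongr

variable {A : Set (Fin k → ℝ)} {w r : ℕ} {K v : ℝ}

/-- Controls the weight with which the lower child enters the deficit. AM-GM replaces `√v * √u` by
the mean of `v` and `u`, and the mass `u` is at most the mass below the order statistic of equal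
rank in `S`. -/
theorem lintegral_sqrt_mass_lower_le (i : Fin k) (hν : ∀ i t, ν {x | x i = t} = 0)
    (hA : ∀ᵐ x ∂ν, x ∈ A) (hw : (members y A \ S).card ≤ w) (hK : 0 < K)
    (hr : SplitRank K (S.card + (members y A \ S).card) r v) (hlarge : K * (w + 3) ≤ S.card) :
    ∫⁻ z, ENNReal.ofReal (√v * √(coordCdf ν i (orderStat (members z A) (fun τ => z τ i) r)))
      ∂partialSample S ν y ≤ ENNReal.ofReal (v + (w + 3) / S.card) := by
  obtain ⟨hr1, hr2, hr3, -⟩ := hr.bounds hK (by omega) (by omega) hlarge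
  obtain ⟨p, q, rfl, hpq⟩ := beta_params (by omega) hr2
  obtain ⟨N, hN0, hN1, hlaw⟩ := exists_beta_law_orderStat (ν := ν) (y := y) i hν hpq
  have hv0 : 0 ≤ v := le_trans (by positivity) hr.lower
  have hmean := beta_mean hN1
  have hd := beta_mean_dist (v := v) (hpq ▸ hr3)
  have hS : (S.card : ℝ) = p + q + 1 := by rw [hpq]; push_cast; ring
  calc _ ≤ ∫⁻ z, ENNReal.ofReal ((v + coordCdf ν i (orderStat S (fun τ => z τ i) (p + 1))) / 2)
        ∂partialSample S ν y := by
        refine lintegral_mono_ae ?_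
        filter_upwards [ae_almostMembers hA hw] with z hz
        refine ENNReal.ofReal_le_ofReal ?_
        have h1 := coordCdf_mono (ν := ν) i (orderStat_superset_le (v := fun τ => z τ i) (r := p + 1) hz.1.1)
        set u := coordCdf ν i (orderStat (members z A) (fun τ => z τ i) (p + 1))
        have hu : 0 ≤ u := coordCdf_nonneg _ _
        linarith [sqrt_mul_sqrt_le_half_add hv0 hu]
    _ = ENNReal.ofReal (N * ∫ u in (0 : ℝ)..1, (v + u) / 2 * (u ^ p * (1 - u) ^ q)) :=
        hlaw (fun u => (v + u) / 2) (by fun_prop) fun u hu => by linarith [hu.1]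
    _ ≤ _ := by
      refine ENNReal.ofReal_le_ofReal ?_
      have e : ∀ u : ℝ, (v + u) / 2 * (u ^ p * (1 - u) ^ q) =
          v / 2 * (u ^ p * (1 - u) ^ q) + 1 / 2 * (u * (u ^ p * (1 - u) ^ q)) := fun u => by ring
      simp only [e]
      rw [intervalIntegral.integral_add (Continuous.intervalIntegrable (by fun_prop) _ _)
        (Continuous.intervalIntegrable (by fun_prop) _ _), intervalIntegral.integral_const_mul,
        intervalIntegral.integral_const_mul]
      have hd' := (abs_le.1 hd).2
      have hD : ((w : ℝ) + 3) / (p + q + 2) ≤ (w + 3) / S.card := by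
        rw [hS]; gcongr; linarith
      have hD0 : 0 ≤ ((w : ℝ) + 3) / S.card := by positivity
      calc _ = v / 2 * (N * ∫ u in (0 : ℝ)..1, u ^ p * (1 - u) ^ q) + 1 / 2 *
            (N * ∫ u in (0 : ℝ)..1, u * (u ^ p * (1 - u) ^ q)) := by ring
        _ ≤ _ := by rw [hN1, hmean]; linarith

/-- The mirror image for the upper child; the comparison is now with the order statistic of rank `r
- w` in `S`, from below. -/
theorem lintegral_sqrt_mass_upper_le (i : Fin k) (hν : ∀ i t, ν {x | x i = t} = 0)
    (hA : ∀ᵐ x ∂ν, x ∈ A) (hw : (members y A \ S).card ≤ w) (hK : 0 < K)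
    (hr : SplitRank K (S.card + (members y A \ S).card) r v) (hlarge : K * (w + 3) ≤ S.card) :
    ∫⁻ z, ENNReal.ofReal
      (√(1 - v) * √(1 - coordCdf ν i (orderStat (members z A) (fun τ => z τ i) r)))
      ∂partialSample S ν y ≤ ENNReal.ofReal (1 - v + (w + 3) / S.card) := by
  obtain ⟨hr1, hr2, -, hr3⟩ := hr.bounds hK (by omega) (by omega) hlarge
  obtain ⟨p, q, hp, hpq⟩ := beta_params (r := r - w) (N := S.card) (by omega) (by omega)
  rw [hp] at hr3
  obtain ⟨N, hN0, hN1, hlaw⟩ := exists_beta_law_orderStat (ν := ν) (y := y) i hν hpq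
  have hv1 : 0 ≤ 1 - v := by have := hr.upper; have : 0 < 1 / K := by positivity
                             linarith
  have hmean := beta_mean hN1
  have hd := beta_mean_dist (v := v) (hpq ▸ hr3)
  have hS : (S.card : ℝ) = p + q + 1 := by rw [hpq]; push_cast; ring
  calc _ ≤ ∫⁻ z, ENNReal.ofReal
          ((1 - v + (1 - coordCdf ν i (orderStat S (fun τ => z τ i) (p + 1)))) / 2)
        ∂partialSample S ν y := by
        refine lintegral_mono_ae ?_
        filter_upwards [ae_almostMembers hA hw] with z hz
        refine ENNReal.ofReal_le_ofReal ?_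
        have h1 := coordCdf_mono (ν := ν) i
          (orderStat_sub_le_superset (v := fun τ => z τ i) (r := r) hz.1.2)
        rw [hp] at h1
        set u := coordCdf ν i (orderStat (members z A) (fun τ => z τ i) r)
        have hu : 0 ≤ 1 - u := sub_nonneg.2 (coordCdf_le_one _ _)
        linarith [sqrt_mul_sqrt_le_half_add hv1 hu]
    _ = ENNReal.ofReal (N * ∫ u in (0 : ℝ)..1, (1 - v + (1 - u)) / 2 * (u ^ p * (1 - u) ^ q)) :=
        hlaw (fun u => (1 - v + (1 - u)) / 2) (by fun_prop) fun u hu => by linarith [hu.2]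
    _ ≤ _ := by
      refine ENNReal.ofReal_le_ofReal ?_
      have e : ∀ u : ℝ, (1 - v + (1 - u)) / 2 * (u ^ p * (1 - u) ^ q) =
          (2 - v) / 2 * (u ^ p * (1 - u) ^ q) - 1 / 2 * (u * (u ^ p * (1 - u) ^ q)) :=
        fun u => by ring
      simp only [e]
      rw [intervalIntegral.integral_sub (Continuous.intervalIntegrable (by fun_prop) _ _)
        (Continuous.intervalIntegrable (by fun_prop) _ _), intervalIntegral.integral_const_mul,
        intervalIntegral.integral_const_mul]
      have hd' := (abs_le.1 hd).1
      have hD : ((w : ℝ) + 3) / (p + q + 2) ≤ (w + 3) / S.card := by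
        rw [hS]; gcongr; linarith
      have hD0 : 0 ≤ ((w : ℝ) + 3) / S.card := by positivity
      calc _ = (2 - v) / 2 * (N * ∫ u in (0 : ℝ)..1, u ^ p * (1 - u) ^ q) - 1 / 2 *
            (N * ∫ u in (0 : ℝ)..1, u * (u ^ p * (1 - u) ^ q)) := by ring
        _ ≤ _ := by rw [hN1, hmean]; linarith

/-- By the normalization of `α` the variance term contributes exactly `3/16` over `m`. The terms
with `α * δ` combine to `α * δ * (μ - μ')`, which is the stray term, and all others carry a further
factor `1 / m`. -/
theorem binary_deficit_numeric {α Q D δ v μ μ' m : ℝ} {w : ℕ}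
    (hα : α * (v * (1 - v)) = 3 / 16)
    (hα0 : 0 ≤ α) (hQ : 0 ≤ Q) (hm : 1 ≤ m) (hμ : |μ - v| ≤ D / m) (hμ' : |μ' - v| ≤ D / m)
    (hv0 : 0 ≤ v) (hv1 : v ≤ 1) (hμ0 : 0 ≤ μ) (hμ1 : μ ≤ 1) (hd : μ - μ' = w / m) :
    (α * (μ * (1 - μ) / m + (μ - v) ^ 2) + α * δ * μ + Q * (8 * (1 / m ^ 2 + (μ - v) ^ 4))) +
      (α * δ * (1 - μ') + Q * (8 * (1 / m ^ 2 + (μ' - v) ^ 4))) - α * δ ≤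
    (3 / 16 + α * δ * w + (α * (D + D ^ 2) + 16 * Q * (1 + D ^ 4)) / m) / m := by
  have hm0 : 0 < m := by linarith
  have s1 : (μ - v) ^ 2 ≤ D ^ 2 / m ^ 2 := by
    rw [← div_pow, ← sq_abs]; exact pow_le_pow_left₀ (abs_nonneg _) hμ 2
  have q1 : (μ - v) ^ 4 ≤ D ^ 4 / m ^ 2 := by
    have h1 : (μ - v) ^ 4 ≤ (D / m) ^ 4 := by
      rw [← Even.pow_abs (by decide : Even 4)]; exact pow_le_pow_left₀ (abs_nonneg _) hμ 4
    refine h1.trans ?_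
    rw [div_pow]
    gcongr
    · norm_num
  have q2 : (μ' - v) ^ 4 ≤ D ^ 4 / m ^ 2 := by
    have h1 : (μ' - v) ^ 4 ≤ (D / m) ^ 4 := by
      rw [← Even.pow_abs (by decide : Even 4)]; exact pow_le_pow_left₀ (abs_nonneg _) hμ' 4
    refine h1.trans ?_
    rw [div_pow]
    gcongr
    · norm_num
  have m1 : μ * (1 - μ) ≤ v * (1 - v) + D / m := by
    have e : μ * (1 - μ) - v * (1 - v) = (μ - v) * (1 - μ - v) := by ring
    have : (μ - v) * (1 - μ - v) ≤ |μ - v| * 1 := by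
      refine (le_abs_self _).trans ?_
      rw [abs_mul]
      exact mul_le_mul_of_nonneg_left (abs_le.2 ⟨by linarith, by linarith⟩) (abs_nonneg _)
    linarith
  have m2 : μ * (1 - μ) / m ≤ (v * (1 - v) + D / m) / m := by gcongr
  have f1 : α * (μ * (1 - μ) / m + (μ - v) ^ 2) ≤
      α * ((v * (1 - v) + D / m) / m + D ^ 2 / m ^ 2) :=
    mul_le_mul_of_nonneg_left (add_le_add m2 s1) hα0
  have f2 : Q * (8 * (1 / m ^ 2 + (μ - v) ^ 4)) ≤ Q * (8 * (1 / m ^ 2 + D ^ 4 / m ^ 2)) := by gcongr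
  have f3 : Q * (8 * (1 / m ^ 2 + (μ' - v) ^ 4)) ≤ Q * (8 * (1 / m ^ 2 + D ^ 4 / m ^ 2)) := by gcongr
  have f4 : α * ((v * (1 - v) + D / m) / m + D ^ 2 / m ^ 2) =
      (3 / 16 + α * (D + D ^ 2) / m) / m := by
    rw [← hα]; field_simp; ring
  have f5 : (3 / 16 + α * δ * w + (α * (D + D ^ 2) + 16 * Q * (1 + D ^ 4)) / m) / m =
      (3 / 16 + α * (D + D ^ 2) / m) / m + α * δ * (w / m) +
        2 * (Q * (8 * (1 / m ^ 2 + D ^ 4 / m ^ 2))) := by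
    field_simp; ring
  rw [f5, ← hd, ← f4]
  linarith

/-- The choice of `δ` makes the stray term at most `ε / 2`, and the size of `N` does the same for
the remaining error. -/
theorem binary_deficit_numeric_le {α Q D K ε δ N : ℝ} {w : ℕ} (hαK : α ≤ K ^ 2)
    (hK : 0 < K) (hε : 0 < ε) (hD : 0 < D) (hδ : δ = ε / (2 * K ^ 2 * (w + 1)))
    (hN : 1 ≤ N) (h : 2 * (K ^ 2 * (D + D ^ 2) + 16 * Q * (1 + D ^ 4)) / ε ≤ N) :
    (3 / 16 + α * δ * w + (α * (D + D ^ 2) + 16 * Q * (1 + D ^ 4)) / (N + 1)) / (N + 1) ≤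
      (3 / 16 + ε) / N := by
  have hδ0 : 0 < δ := by rw [hδ]; positivity
  have g1 : α * δ * w ≤ ε / 2 := by
    have h1 : α * δ * w ≤ K ^ 2 * δ * (w + 1) :=
      mul_le_mul (mul_le_mul_of_nonneg_right hαK hδ0.le) (by linarith) (Nat.cast_nonneg _)
        (by positivity)
    refine h1.trans (le_of_eq ?_)
    rw [hδ]; field_simp
  have g2 : (α * (D + D ^ 2) + 16 * Q * (1 + D ^ 4)) / (N + 1) ≤ ε / 2 := by
    rw [div_le_iff₀ hε] at h
    rw [div_le_iff₀ (by linarith)]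
    have h2 : α * (D + D ^ 2) ≤ K ^ 2 * (D + D ^ 2) :=
      mul_le_mul_of_nonneg_right hαK (by positivity)
    have h3 : ε / 2 * (N + 1) = (N * ε) / 2 + ε / 2 := by ring
    linarith
  have hN0 : 0 < N := by linarith
  calc _ ≤ (3 / 16 + ε) / (N + 1) := div_le_div_of_nonneg_right (by linarith) (by linarith)
    _ ≤ _ := by gcongr; linarith

set_option maxHeartbeats 1000000 in
-- The threshold `n₀` depends only on `w`, `K` and `ε`, so it serves every node of a scheme,
-- whatever the conditional law and the frozen members are.
theorem exists_lintegral_binary_deficit_le (w : ℕ) {K ε : ℝ} (hK : 0 < K) (hε : 0 < ε) :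
    ∃ n₀ : ℕ, ∀ {k n : ℕ} {ν : Measure (Fin k → ℝ)} [IsProbabilityMeasure ν] {S : Finset (Fin n)}
      {y : Fin n → Fin k → ℝ} {A : Set (Fin k → ℝ)} {r : ℕ} {v : ℝ} (i : Fin k),
      (∀ i t, ν {x | x i = t} = 0) → (∀ᵐ x ∂ν, x ∈ A) → (members y A \ S).card ≤ w →
      SplitRank K (S.card + (members y A \ S).card) r v → n₀ ≤ S.card →
      ∫⁻ z, ENNReal.ofReal
        (1 - √v * √(coordCdf ν i (orderStat (members z A) (fun τ => z τ i) r)) -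
          √(1 - v) * √(1 - coordCdf ν i (orderStat (members z A) (fun τ => z τ i) r)))
        ∂partialSample S ν y ≤ ENNReal.ofReal ((3 / 16 + ε) / S.card) := by
  set δ : ℝ := ε / (2 * K ^ 2 * (w + 1)) with hδ
  have hδ0 : 0 < δ := by positivity
  set Q : ℝ := 3 * K ^ 2 / δ ^ 3 + 2 * K ^ 3 with hQ
  have hQ0 : 0 < Q := by positivity
  set D : ℝ := w + 3 with hD
  have hD0 : 0 < D := by positivity
  obtain ⟨n₀, hn₀⟩ := exists_nat_ge
    (max (K * (w + 3)) (2 * (K ^ 2 * (D + D ^ 2) + 16 * Q * (1 + D ^ 4)) / ε))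
  refine ⟨max n₀ 1, ?_⟩
  intro k n ν _ S y A r v i hν hA hw hr hlarge
  have hSn : (n₀ : ℝ) ≤ S.card := by exact_mod_cast (le_max_left _ _).trans hlarge
  have hS1 : (1 : ℝ) ≤ S.card := by exact_mod_cast (le_max_right _ _).trans hlarge
  have hn := hn₀.trans hSn
  obtain ⟨hr1, hr2, hr3, hr4⟩ := hr.bounds hK (by omega) (by omega) ((le_max_left _ _).trans hn)
  obtain ⟨p, q, hp, hpq⟩ := beta_params (r := r) (N := S.card) (by omega) (by omega)
  obtain ⟨p', q', hp', hpq'⟩ := beta_params (r := r - w) (N := S.card) (by omega) (by omega)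
  obtain ⟨N, hN0, hN1, hlaw⟩ := exists_beta_law_orderStat (ν := ν) (y := y) i hν hpq
  obtain ⟨N', hN0', hN1', hlaw'⟩ := exists_beta_law_orderStat (ν := ν) (y := y) i hν hpq'
  rw [hp'] at hr4
  rw [hp] at hr3
  have hd := beta_mean_dist (v := v) (hpq ▸ hr3)
  have hd' := beta_mean_dist (v := v) (hpq' ▸ hr4)
  have hmeq : (p' : ℝ) + q' + 2 = p + q + 2 := by
    have : p' + q' = p + q := by omega
    exact_mod_cast congrArg (· + 2) this
  have hmeqS : (p : ℝ) + q + 2 = S.card + 1 := by rw [hpq]; push_cast; ring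
  have hK1 : 0 < 1 / K := by positivity
  have hv0 : 0 < v := hK1.trans_le hr.lower
  have hv1 : 0 < 1 - v := by linarith [hr.upper]
  set α := 3 / 16 / (v * (1 - v)) with hα
  have hα0 : 0 ≤ α := by positivity
  have hαv : α * (v * (1 - v)) = 3 / 16 := by rw [hα]; field_simp
  have hαK : α ≤ K ^ 2 := by
    have hKv : 1 / v ≤ K := by
      rw [div_le_iff₀ hv0]; have := hr.lower; rw [div_le_iff₀ hK] at this; linarith
    have hKv2 : 1 / (1 - v) ≤ K := by
      rw [div_le_iff₀ hv1]; have : 1 / K ≤ 1 - v := by linarith [hr.upper]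
      rw [div_le_iff₀ hK] at this; linarith
    have h2 := mul_le_mul hKv hKv2 (by positivity) hK.le
    rw [div_mul_div_comm, one_mul] at h2
    rw [hα, div_eq_mul_one_div]
    nlinarith
  -- Only the separate laws of the two squeezing masses `a ≤ b` are available, and integrands must
  -- be nonnegative. Hence `δ * (b - a)` is written as `δ * b + δ * (1 - a) - δ`: `ψ` collects the
  -- terms in `b`, `ψ'` those in `a`, and the constant `α * δ` is subtracted after integration.
  set ψ : ℝ → ℝ := fun u => α * (u - v) ^ 2 + α * δ * u + Q * (u - v) ^ 4 with hψ
  set ψ' : ℝ → ℝ := fun u => α * δ * (1 - u) + Q * (u - v) ^ 4 with hψ'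
  have hψ0 : ∀ u ∈ Set.Icc (0 : ℝ) 1, 0 ≤ ψ u := fun u hu => by
    have := hu.1; simp only [hψ]; positivity
  have hψ0' : ∀ u ∈ Set.Icc (0 : ℝ) 1, 0 ≤ ψ' u := fun u hu => by
    have : 0 ≤ 1 - u := sub_nonneg.2 hu.2
    simp only [hψ']; positivity
  have hψc : Continuous ψ := by fun_prop
  have hψc' : Continuous ψ' := by fun_prop
  have I1 : N * ∫ u in (0 : ℝ)..1, ψ u * (u ^ p * (1 - u) ^ q) ≤
      α * ((p + 1) / (p + q + 2) * (1 - (p + 1) / (p + q + 2)) / (p + q + 2) +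
        ((p + 1) / (p + q + 2) - v) ^ 2) + α * δ * ((p + 1) / (p + q + 2)) +
        Q * (8 * (1 / ((p : ℝ) + q + 2) ^ 2 + ((p + 1) / (p + q + 2) - v) ^ 4)) := by
    have e : ∀ u : ℝ, ψ u * (u ^ p * (1 - u) ^ q) = α * ((u - v) ^ 2 * (u ^ p * (1 - u) ^ q)) +
        α * δ * (u * (u ^ p * (1 - u) ^ q)) + Q * ((u - v) ^ 4 * (u ^ p * (1 - u) ^ q)) :=
      fun u => by simp only [hψ]; ring
    simp only [e]
    rw [intervalIntegral.integral_add (Continuous.intervalIntegrable (by fun_prop) _ _)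
      (Continuous.intervalIntegrable (by fun_prop) _ _), intervalIntegral.integral_add
      (Continuous.intervalIntegrable (by fun_prop) _ _)
      (Continuous.intervalIntegrable (by fun_prop) _ _), intervalIntegral.integral_const_mul,
      intervalIntegral.integral_const_mul, intervalIntegral.integral_const_mul]
    have h1 := mul_le_mul_of_nonneg_left (beta_sq_dist_le hN1 hN0 v) hα0
    have h2 := mul_le_mul_of_nonneg_left (beta_fourth_dist_le hN1 hN0 v) hQ0.le
    have h3 := congrArg (α * δ * ·) (beta_mean hN1)
    linarith
  have I2 : N' * ∫ u in (0 : ℝ)..1, ψ' u * (u ^ p' * (1 - u) ^ q') ≤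
      α * δ * (1 - (p' + 1) / (p + q + 2)) +
        Q * (8 * (1 / ((p : ℝ) + q + 2) ^ 2 + ((p' + 1) / (p + q + 2) - v) ^ 4)) := by
    have e : ∀ u : ℝ, ψ' u * (u ^ p' * (1 - u) ^ q') = α * δ * (u ^ p' * (1 - u) ^ q') -
        α * δ * (u * (u ^ p' * (1 - u) ^ q')) + Q * ((u - v) ^ 4 * (u ^ p' * (1 - u) ^ q')) :=
      fun u => by simp only [hψ']; ring
    simp only [e]
    rw [intervalIntegral.integral_add (Continuous.intervalIntegrable (by fun_prop) _ _)
      (Continuous.intervalIntegrable (by fun_prop) _ _), intervalIntegral.integral_sub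
      (Continuous.intervalIntegrable (by fun_prop) _ _)
      (Continuous.intervalIntegrable (by fun_prop) _ _), intervalIntegral.integral_const_mul,
      intervalIntegral.integral_const_mul, intervalIntegral.integral_const_mul]
    have h1 := congrArg (α * δ * ·) hN1'
    have h2 := mul_le_mul_of_nonneg_left (beta_fourth_dist_le hN1' hN0' v) hQ0.le
    have h3 := congrArg (α * δ * ·) (beta_mean hN1')
    rw [hmeq] at h2 h3
    linarith
  have hmean_sub : ((p : ℝ) + 1) / (p + q + 2) - (p' + 1) / (p + q + 2) = w / (p + q + 2) := by
    rw [← sub_div]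
    congr 1
    have : p = p' + w := by omega
    rw [this]; push_cast; ring
  have hnum := binary_deficit_numeric (δ := δ) (D := D) (Q := Q) (m := (p : ℝ) + q + 2)
    (μ := ((p : ℝ) + 1) / (p + q + 2)) (μ' := ((p' : ℝ) + 1) / (p + q + 2)) (w := w) hαv hα0 hQ0.le
    (by linarith [(Nat.cast_nonneg p : (0 : ℝ) ≤ p), (Nat.cast_nonneg q : (0 : ℝ) ≤ q)]) hd
    (hmeq ▸ hd') hv0.le (by linarith) (by positivity)
    (by rw [div_le_one (by positivity)]; linarith [(Nat.cast_nonneg q : (0 : ℝ) ≤ q)])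
    hmean_sub
  have hmeas : Measurable fun u : ℝ => ENNReal.ofReal (ψ u) := by fun_prop
  have main : (∫⁻ z, ENNReal.ofReal
        (1 - √v * √(coordCdf ν i (orderStat (members z A) (fun τ => z τ i) r)) -
          √(1 - v) * √(1 - coordCdf ν i (orderStat (members z A) (fun τ => z τ i) r)))
        ∂partialSample S ν y) + ENNReal.ofReal (α * δ) ≤
      ENNReal.ofReal (N * (∫ u in (0 : ℝ)..1, ψ u * (u ^ p * (1 - u) ^ q)) +
        N' * ∫ u in (0 : ℝ)..1, ψ' u * (u ^ p' * (1 - u) ^ q')) := by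
    have c1 : ENNReal.ofReal (α * δ) = ∫⁻ z, ENNReal.ofReal (α * δ) ∂partialSample S ν y := by simp
    have hint0 : ∀ (φ : ℝ → ℝ) (N : ℝ) (p q : ℕ), Continuous φ → 0 ≤ N →
        (∀ u ∈ Set.Icc (0 : ℝ) 1, 0 ≤ φ u) →
        0 ≤ N * ∫ u in (0 : ℝ)..1, φ u * (u ^ p * (1 - u) ^ q) := by
      intro φ N p q hφ hN h
      have := beta_mono (p := p) (q := q) hN (φ := fun _ => 0) (ψ := φ) continuous_const hφ h
      simpa using this
    rw [c1, ← lintegral_add_right _ measurable_const, ENNReal.ofReal_add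
      (hint0 _ _ _ _ hψc hN0 hψ0) (hint0 _ _ _ _ hψc' hN0' hψ0'), ← hlaw ψ hψc hψ0,
      ← hlaw' ψ' hψc' hψ0', ← hp, ← hp']
    rw [← lintegral_add_left]
    swap
    · exact hmeas.comp ((measurable_coordCdf i).comp (measurable_orderStat_const i r))
    refine lintegral_mono_ae ?_
    filter_upwards [ae_almostMembers hA hw] with z hz
    have b1 := coordCdf_mono (ν := ν) i (orderStat_superset_le (v := fun τ => z τ i) (r := r) hz.1.1)
    have b2 := coordCdf_mono (ν := ν) i
      (orderStat_sub_le_superset (v := fun τ => z τ i) (r := r) hz.1.2)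
    set u := coordCdf ν i (orderStat (members z A) (fun τ => z τ i) r)
    set b := coordCdf ν i (orderStat S (fun τ => z τ i) r)
    set a := coordCdf ν i (orderStat S (fun τ => z τ i) (r - w))
    have ha0 : 0 ≤ a := coordCdf_nonneg _ _
    have hb1 : b ≤ 1 := coordCdf_le_one _ _
    have hdef := binary_deficit_le_of_mem_Icc hK hδ0 hr.lower hr.upper ha0 b2 b1 hb1
    have hf0 : 0 ≤ 1 - √v * √u - √(1 - v) * √(1 - u) := by
      have hu : 0 ≤ u := coordCdf_nonneg _ _
      have hu1 : 0 ≤ 1 - u := sub_nonneg.2 (coordCdf_le_one _ _)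
      linarith [sqrt_mul_sqrt_le_half_add hv0.le hu, sqrt_mul_sqrt_le_half_add hv1.le hu1]
    rw [← ENNReal.ofReal_add hf0 (by positivity),
      ← ENNReal.ofReal_add (hψ0 b ⟨ha0.trans (b2.trans b1), hb1⟩) (hψ0' a ⟨ha0, (b2.trans b1).trans hb1⟩)]
    refine ENNReal.ofReal_le_ofReal ?_
    simp only [hψ, hψ']
    linarith
  refine (le_ofReal_sub_of_add_le (by positivity) main).trans (ENNReal.ofReal_le_ofReal ?_)
  refine (sub_le_sub_right (add_le_add I1 I2) _).trans (hnum.trans ?_)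
  rw [hmeqS]
  have hlast := (le_max_right _ _).trans hn
  exact binary_deficit_numeric_le hαK hK hε hD0 hδ hS1 hlast

end

/-! ### Schemes of successive binary splits and their deficit. -/

/-- A scheme of successive binary splits: at a node the current region is cut along coordinate `i`
at the order statistic of rank `r`, and the fraction aimed at below the cut is `v`. -/
inductive CutTree (k : ℕ) : Type
  | leaf : CutTree k
  | node (i : Fin k) (r : ℕ) (v : ℝ) (L R : CutTree k) : CutTree k

namespace CutTree
variable {k n : ℕ}

/-- The number of final regions. -/
def leaves : CutTree k → ℕ
  | leaf => 1
  | node _ _ _ L R => L.leaves + R.leaves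

/-- All ranks are appropriate when the initial region has `m` members. -/
def Good (K : ℝ) : CutTree k → ℕ → Prop
  | leaf, _ => True
  | node _ r v L R, m => SplitRank K m r v ∧ L.Good K r ∧ R.Good K (m - r)

/-- The affinity `∑ √(u v)` between the masses `u` of the final regions built from the sample `x`
and the fractions aimed at. -/
noncomputable def affinity (ν : Measure (Fin k → ℝ)) (x : Fin n → Fin k → ℝ) :
    CutTree k → Set (Fin k → ℝ) → ℝ
  | leaf, A => √(ν.real A)
  | node i r v L R, A =>
    √v * L.affinity ν x (lowerPart A i (orderStat (members x A) (fun τ => x τ i) r)) +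
      √(1 - v) * R.affinity ν x (upperPart A i (orderStat (members x A) (fun τ => x τ i) r))

/-- The amount by which the affinity falls short of its greatest possible value. -/
noncomputable def deficit (ν : Measure (Fin k → ℝ)) (x : Fin n → Fin k → ℝ) (T : CutTree k)
    (A : Set (Fin k → ℝ)) : ℝ :=
  √(ν.real A) - T.affinity ν x A

end CutTree

section
variable {k n : ℕ}

theorem measurableSet_coord_le_ereal (i : Fin k) (c : EReal) :
    MeasurableSet {y : Fin k → ℝ | (y i : EReal) ≤ c} :=
  measurableSet_le (measurable_coe_real_ereal.comp (by fun_prop)) measurable_const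

theorem measurableSet_lowerPart {A : Set (Fin k → ℝ)} (hA : MeasurableSet A) (i : Fin k)
    (c : EReal) : MeasurableSet (lowerPart A i c) :=
  hA.inter (measurableSet_coord_le_ereal i c)

theorem measurableSet_upperPart {A : Set (Fin k → ℝ)} (hA : MeasurableSet A) (i : Fin k)
    (c : EReal) : MeasurableSet (upperPart A i c) := by
  refine hA.inter ?_
  have : {y : Fin k → ℝ | c < (y i : EReal)} = {y | (y i : EReal) ≤ c}ᶜ := by ext; simp
  rw [this]
  exact (measurableSet_coord_le_ereal i c).compl

theorem measureReal_lowerPart_add_upperPart (ν : Measure (Fin k → ℝ)) [IsFiniteMeasure ν]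
    (A : Set (Fin k → ℝ)) (i : Fin k) (c : EReal) :
    ν.real (lowerPart A i c) + ν.real (upperPart A i c) = ν.real A := by
  have : upperPart A i c = A \ {y | (y i : EReal) ≤ c} := by
    ext; simp [upperPart]
  rw [this]
  exact measureReal_inter_add_sdiff (measurableSet_coord_le_ereal i c)

namespace CutTree

theorem one_le_leaves (T : CutTree k) : 1 ≤ T.leaves := by
  induction T with
  | leaf => exact le_rfl
  | node i r v L R ihL ihR => simp only [leaves]; omega

theorem measurable_affinity (ν : Measure (Fin k → ℝ)) [IsFiniteMeasure ν] (T : CutTree k)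
    {A : (Fin n → Fin k → ℝ) → Set (Fin k → ℝ)} (hA : MeasurableGraph A) :
    Measurable fun x => T.affinity ν x (A x) := by
  induction T generalizing A with
  | leaf => exact (hA.measurable_real ν).sqrt
  | node i r v L R ihL ihR =>
    have hc := hA.measurable_orderStat i (r := fun _ => r) measurable_const
    exact ((ihL (hA.lowerPart i hc)).const_mul _).add ((ihR (hA.upperPart i hc)).const_mul _)

theorem measurable_deficit (ν : Measure (Fin k → ℝ)) [IsFiniteMeasure ν] (T : CutTree k)
    {A : (Fin n → Fin k → ℝ) → Set (Fin k → ℝ)} (hA : MeasurableGraph A) :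
    Measurable fun x => T.deficit ν x (A x) :=
  (hA.measurable_real ν).sqrt.sub (T.measurable_affinity ν hA)

theorem sqrt_mul_cond_real {ν : Measure (Fin k → ℝ)} [IsFiniteMeasure ν] {A B : Set (Fin k → ℝ)}
    (hB : MeasurableSet B) (hνB : ν B ≠ 0) (hAB : A ⊆ B) :
    √(ν.real B) * √((ν[|B]).real A) = √(ν.real A) := by
  rw [← Real.sqrt_mul measureReal_nonneg, measureReal_def (μ := ν[|B]), cond_apply hB,
    ENNReal.toReal_mul, ENNReal.toReal_inv, Set.inter_eq_right.2 hAB, ← measureReal_def,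
    ← measureReal_def, mul_inv_cancel_left₀]
  exact (measureReal_ne_zero_iff (measure_ne_top _ _)).2 hνB

/-- The cuts depend on the sample and not on the measure, so conditioning on `B` rescales all leaf
masses by one common factor. -/
theorem sqrt_mul_affinity_cond {ν : Measure (Fin k → ℝ)} [IsFiniteMeasure ν]
    (x : Fin n → Fin k → ℝ) {A B : Set (Fin k → ℝ)} (hB : MeasurableSet B) (hνB : ν B ≠ 0)
    (hAB : A ⊆ B) (T : CutTree k) :
    √(ν.real B) * T.affinity (ν[|B]) x A = T.affinity ν x A := by
  induction T generalizing A with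
  | leaf => exact sqrt_mul_cond_real hB hνB hAB
  | node i r v L R ihL ihR =>
    simp only [affinity]
    have hl : ∀ c, lowerPart A i c ⊆ B := fun c => Set.inter_subset_left.trans hAB
    have hu : ∀ c, upperPart A i c ⊆ B := fun c => Set.inter_subset_left.trans hAB
    rw [← ihL (hl _), ← ihR (hu _)]
    ring

theorem sqrt_mul_deficit_cond {ν : Measure (Fin k → ℝ)} [IsFiniteMeasure ν]
    (x : Fin n → Fin k → ℝ) {A : Set (Fin k → ℝ)} (hA : MeasurableSet A) (hνA : ν A ≠ 0)
    (T : CutTree k) :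
    √(ν.real A) * T.deficit (ν[|A]) x A = T.deficit ν x A := by
  rw [deficit, mul_sub, sqrt_mul_cond_real hA hνA subset_rfl,
    sqrt_mul_affinity_cond x hA hνA subset_rfl, deficit]

end CutTree

/-! ### The sample inside one part of a split region. -/

variable {ν : Measure (Fin k → ℝ)} [IsProbabilityMeasure ν] {S : Finset (Fin n)}
  {y : Fin n → Fin k → ℝ}

theorem ae_partialSample_injective (hν : ∀ i t, ν {x | x i = t} = 0)
    (hy : ∀ τ ∉ S, ∀ σ ∉ S, σ ≠ τ → ∀ i, y σ i ≠ y τ i) :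
    ∀ᵐ z ∂partialSample S ν y, ∀ τ σ, σ ≠ τ → ∀ i, z σ i ≠ z τ i := by
  filter_upwards [ae_partialSample_coord_ne (S := S) (y := y) hν,
    ae_partialSample_eq (S := S) (ν := ν) (y := y)] with z h1 h2 τ σ hne i
  by_cases hτ : τ ∈ S
  · exact h1 τ hτ σ hne i
  by_cases hσ : σ ∈ S
  · exact (h1 σ hσ τ hne.symm i).symm
  · rw [h2 τ hτ, h2 σ hσ]; exact hy τ hτ σ hσ hne i

/-- The part of the sample-dependent splitting event that does not involve the members in `B`. -/
def splitCondition (S : Finset (Fin n)) (A : Set (Fin k → ℝ))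
    (L : (Fin k → ℝ) → Set (Fin k → ℝ)) (s : ℕ) (τ : Fin n) (B : Finset (Fin n)) :
    Set (Fin n → Fin k → ℝ) :=
  {z | z τ ∈ A ∧ (members z (L (z τ)) \ B).card + B.card = s ∧
    ∀ σ ∈ S, σ ∉ B → σ ≠ τ → z σ ∉ L (z τ)}

theorem measurableSet_splitCondition {A : Set (Fin k → ℝ)} (hA : MeasurableSet A)
    {L : (Fin k → ℝ) → Set (Fin k → ℝ)} (hL : MeasurableGraph L) (s : ℕ) (τ : Fin n)
    (B : Finset (Fin n)) : MeasurableSet (splitCondition S A L s τ B) := by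
  classical
  have hm : ∀ σ : Fin n, MeasurableSet {z : Fin n → Fin k → ℝ | z σ ∈ L (z τ)} := fun σ =>
    hL.preimage (f := fun z : Fin n → Fin k → ℝ => (z τ, z σ)) (by fun_prop)
  have h1 : MeasurableSet {z : Fin n → Fin k → ℝ | z τ ∈ A} := hA.preimage (measurable_pi_apply τ)
  have h2 : Measurable fun z : Fin n → Fin k → ℝ => (members z (L (z τ)) \ B).card := by
    have : ∀ z : Fin n → Fin k → ℝ, members z (L (z τ)) \ B =
        Finset.univ.filter (fun σ => z σ ∈ L (z τ) ∧ σ ∉ B) := by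
      intro z; ext σ; simp [mem_members]
    simp only [this]
    exact measurable_card_filter (fun σ (z : Fin n → Fin k → ℝ) => z σ ∈ L (z τ) ∧ σ ∉ B)
      fun σ => (hm σ).inter (MeasurableSet.const _)
  have h3 : MeasurableSet {z : Fin n → Fin k → ℝ | ∀ σ ∈ S, σ ∉ B → σ ≠ τ → z σ ∉ L (z τ)} := by
    have : {z : Fin n → Fin k → ℝ | ∀ σ ∈ S, σ ∉ B → σ ≠ τ → z σ ∉ L (z τ)} =
        ⋂ σ ∈ S.filter (fun σ => σ ∉ B ∧ σ ≠ τ), {z | z σ ∈ L (z τ)}ᶜ := by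
      ext z; simp
    rw [this]
    exact Finset.measurableSet_biInter _ fun σ _ => (hm σ).compl
  exact h1.inter (((measurableSet_singleton s).preimage (h2.add_const B.card)).inter h3)

/-- The count in the condition leaves out `B` and the cut member is not in `B`, so the members in
`B` can be redrawn without affecting the condition. -/
theorem splitCondition_congr {A : Set (Fin k → ℝ)} {L : (Fin k → ℝ) → Set (Fin k → ℝ)} {s : ℕ}
    {τ : Fin n} {B : Finset (Fin n)} (hτ : τ ∉ B) {z z' : Fin n → Fin k → ℝ}
    (h : ∀ σ ∉ B, z σ = z' σ) (hz : z ∈ splitCondition S A L s τ B) :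
    z' ∈ splitCondition S A L s τ B := by
  obtain ⟨h1, h2, h3⟩ := hz
  have hτz := h τ hτ
  rw [hτz] at h1 h2 h3
  refine ⟨h1, ?_, fun σ hσ hσB hστ => h σ hσB ▸ h3 σ hσ hσB hστ⟩
  rw [← h2]
  congr 2
  ext σ
  simp only [Finset.mem_sdiff, mem_members]
  exact and_congr_left fun hσ => by rw [h σ hσ]

/-- The deficit of a scheme applied to one of the two parts of a region, the other region being cut
off at a member of the sample: given the event which members are in the part, those members that
are neither stray nor on the cut are independent with the conditional law. -/
theorem lintegral_deficit_part_le (hν : ∀ i t, ν {x | x i = t} = 0) {A : Set (Fin k → ℝ)}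
    (hAm : MeasurableSet A) (hA : ∀ᵐ x ∂ν, x ∈ A) {w s : ℕ} (hw : (members y A \ S).card ≤ w)
    (hs : w + 1 < s) (hy : ∀ τ ∉ S, ∀ σ ∉ S, σ ≠ τ → ∀ i, y σ i ≠ y τ i)
    {L : (Fin k → ℝ) → Set (Fin k → ℝ)} (hL : MeasurableGraph L) (hLA : ∀ x, L x ⊆ A)
    {part : (Fin n → Fin k → ℝ) → Set (Fin k → ℝ)}
    (hpart : ∀ᵐ z ∂partialSample S ν y,
      ∃ τ, z τ ∈ A ∧ (members z (L (z τ))).card = s ∧ part z = L (z τ))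
    (huniq : ∀ᵐ z ∂partialSample S ν y, ∀ τ τ', z τ ∈ A → z τ' ∈ A →
      (members z (L (z τ))).card = s → (members z (L (z τ'))).card = s → τ = τ')
    (T : CutTree k) {C : ℝ≥0∞} (hC : C ≠ ⊤)
    (hT : ∀ (B : Finset (Fin n)) (y' : Fin n → Fin k → ℝ) (A' : Set (Fin k → ℝ)) (ν' : Measure (Fin k → ℝ)),
      IsProbabilityMeasure ν' → MeasurableSet A' →
      (∀ i t, ν' {x | x i = t} = 0) → (∀ᵐ x ∂ν', x ∈ A') → (members y' A' \ B).card ≤ w + 1 →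
      (∀ τ ∉ B, ∀ σ ∉ B, σ ≠ τ → ∀ i, y' σ i ≠ y' τ i) →
      B.card + (members y' A' \ B).card = s →
      ∫⁻ z, ENNReal.ofReal (T.deficit ν' z A') ∂partialSample B ν' y' ≤ C) :
    ∫⁻ z, ENNReal.ofReal (T.deficit ν z (part z)) ∂partialSample S ν y ≤
      C * ∫⁻ z, ENNReal.ofReal √(ν.real (part z)) ∂partialSample S ν y := by
  classical
  -- The events are indexed by the cut member `τ` and the set `B` of all other i.i.d. members in the
  -- part; up to a null set they partition the sample space.
  set E : Fin n × Finset (Fin n) → Set (Fin n → Fin k → ℝ) := fun q =>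
    splitCondition S A L s q.1 q.2 ∩ {z | ∀ σ ∈ q.2, z σ ∈ L (z q.1)} with hE
  set Q : Finset (Fin n × Finset (Fin n)) :=
    (Finset.univ ×ˢ S.powerset).filter (fun q => q.1 ∉ q.2) with hQ
  have hLτ : ∀ τ : Fin n, MeasurableGraph fun z : Fin n → Fin k → ℝ => L (z τ) := fun τ =>
    hL.preimage (f := fun q : (Fin n → Fin k → ℝ) × (Fin k → ℝ) => (q.1 τ, q.2)) (by fun_prop)
  have hLm : ∀ x, MeasurableSet (L x) := fun x =>
    hL.preimage (f := fun x' : Fin k → ℝ => (x, x')) (by fun_prop)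
  have hEm : ∀ q, MeasurableSet (E q) := fun q => by
    refine (measurableSet_splitCondition hAm hL s q.1 q.2).inter ?_
    have : {z : Fin n → Fin k → ℝ | ∀ σ ∈ q.2, z σ ∈ L (z q.1)} =
        ⋂ σ ∈ q.2, {z | z σ ∈ L (z q.1)} := by ext z; simp
    rw [this]
    exact Finset.measurableSet_biInter _ fun σ _ =>
      hL.preimage (f := fun z : Fin n → Fin k → ℝ => (z q.1, z σ)) (by fun_prop)
  have hdecomp : ∀ g : (Fin n → Fin k → ℝ) → Set (Fin k → ℝ) → ℝ≥0∞,
      ∀ᵐ z ∂partialSample S ν y, g z (part z) =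
        ∑ q ∈ Q, (E q).indicator (fun z => g z (L (z q.1))) z := by
    intro g
    filter_upwards [hpart, huniq, ae_partialSample_mem (S := S) (y := y) hA] with z ⟨τ, h1, h2, h3⟩ h4 h5
    set B : Finset (Fin n) := S.filter (fun σ => σ ≠ τ ∧ z σ ∈ L (z τ)) with hB
    have hBmem : ∀ σ, σ ∈ B ↔ σ ∈ S ∧ σ ≠ τ ∧ z σ ∈ L (z τ) := fun σ => by
      rw [hB, Finset.mem_filter]
    have hmemQ : (τ, B) ∈ Q := by
      rw [hQ, Finset.mem_filter, Finset.mem_product, Finset.mem_powerset]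
      exact ⟨⟨Finset.mem_univ _, Finset.filter_subset _ _⟩, fun h => ((hBmem τ).1 h).2.1 rfl⟩
    have hcardB : ∀ {B' : Finset (Fin n)} {τ' : Fin n}, (∀ σ ∈ B', z σ ∈ L (z τ')) →
        (members z (L (z τ')) \ B').card + B'.card = (members z (L (z τ'))).card := by
      intro B' τ' h
      exact Finset.card_sdiff_add_card_eq_card fun σ hσ => mem_members.2 (h σ hσ)
    rw [Finset.sum_eq_single_of_mem (τ, B) hmemQ]
    · rw [Set.indicator_of_mem, h3]
      have hBL : ∀ σ ∈ B, z σ ∈ L (z τ) := fun σ hσ => ((hBmem σ).1 hσ).2.2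
      refine ⟨⟨h1, (hcardB hBL).trans h2, fun σ hσ hσB hστ hσL => ?_⟩, hBL⟩
      exact hσB ((hBmem σ).2 ⟨hσ, hστ, hσL⟩)
    · rintro ⟨τ', B'⟩ hq hne
      refine Set.indicator_of_notMem (fun hz => hne ?_) _
      obtain ⟨⟨g1, g2, g3⟩, g4⟩ := hz
      rw [hQ, Finset.mem_filter, Finset.mem_product, Finset.mem_powerset] at hq
      have hτ : τ' = τ := h4 τ' τ g1 h1 ((hcardB g4).symm.trans g2) h2
      subst hτ
      refine Prod.ext rfl (Finset.ext fun σ => ?_)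
      rw [hBmem]
      refine ⟨fun h => ⟨hq.1.2 h, fun he => hq.2 (he ▸ h), g4 σ h⟩, fun h => ?_⟩
      by_contra hc
      exact g3 σ h.1 hc h.2.1 h.2.2
  have hfm : ∀ τ : Fin n, Measurable fun z : Fin n → Fin k → ℝ =>
      ENNReal.ofReal (T.deficit ν z (L (z τ))) := fun τ =>
    (T.measurable_deficit ν (hLτ τ)).ennreal_ofReal
  have hgm : Measurable fun x : Fin k → ℝ => ENNReal.ofReal √(ν.real (L x)) :=
    (hL.measurable_real ν).sqrt.ennreal_ofReal
  have hgm' : ∀ τ : Fin n, Measurable fun z : Fin n → Fin k → ℝ =>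
      ENNReal.ofReal √(ν.real (L (z τ))) := fun τ => hgm.comp (measurable_pi_apply τ)
  rw [lintegral_congr_ae (hdecomp fun z A' => ENNReal.ofReal (T.deficit ν z A')),
    lintegral_congr_ae (hdecomp fun z A' => ENNReal.ofReal √(ν.real A')),
    lintegral_finsetSum _ fun q _ => (hfm q.1).indicator (hEm q),
    lintegral_finsetSum _ fun q _ => (hgm' q.1).indicator (hEm q),
    Finset.mul_sum]
  refine Finset.sum_le_sum fun q hq => ?_
  obtain ⟨τ, B⟩ := q
  rw [hQ, Finset.mem_filter, Finset.mem_product, Finset.mem_powerset] at hq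
  obtain ⟨⟨-, hBS⟩, hτB⟩ := hq
  simp only at hBS hτB ⊢
  -- The strays of the part are among those inherited from `A` and the member on the cut.
  have hstray : ∀ᵐ y' ∂partialSample S ν y, y' ∈ splitCondition S A L s τ B →
      (members y' (L (y' τ)) \ B).card ≤ w + 1 := by
    filter_upwards [ae_almostMembers hA hw] with y' hy' ⟨h1, h2, h3⟩
    have : members y' (L (y' τ)) \ B ⊆ insert τ (members y' A \ S) := by
      intro σ hσ
      rw [Finset.mem_sdiff, mem_members] at hσ
      rw [Finset.mem_insert, Finset.mem_sdiff, mem_members]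
      by_cases hστ : σ = τ
      · exact Or.inl hστ
      · refine Or.inr ⟨hLA _ hσ.1, fun hσS => h3 σ hσS hσ.2 hστ hσ.1⟩
    refine (Finset.card_le_card this).trans ((Finset.card_insert_le _ _).trans ?_)
    exact Nat.add_le_add_right hy'.1.2 1
  -- With `B` empty the part would have at most `w + 1` members, against `w + 1 < s`.
  rcases B.eq_empty_or_nonempty with rfl | hB
  · rw [lintegral_congr_ae (g := fun _ => 0)]
    · simp
    · filter_upwards [hstray] with y' hy'
      refine Set.indicator_of_notMem (fun h => ?_) _
      have h1 := hy' h.1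
      have h2 := h.1.2.1
      simp only [Finset.card_empty, add_zero] at h2
      omega
  refine lintegral_indicator_partialSample_le (g := fun x => ENNReal.ofReal √(ν.real (L x)))
    hBS hτB hB (measurableSet_splitCondition hAm hL s τ B)
    (fun z z' h hz => splitCondition_congr hτB h hz) hL (hfm τ) hgm hC ?_
  filter_upwards [hstray, ae_partialSample_injective hν hy] with y' h1 h2 hyG hνL
  have hprob : IsProbabilityMeasure (ν[|L (y' τ)]) := cond_isProbabilityMeasure hνL
  have hac : ν[|L (y' τ)] ≪ ν := cond_absolutelyContinuous
  -- Since `τ ∉ B`, the part stays constant while `B` is redrawn, and by homogeneity the root of its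
  -- mass factors out of the deficit.
  rw [lintegral_congr_ae (g := fun z => ENNReal.ofReal √(ν.real (L (y' τ))) *
    ENNReal.ofReal (T.deficit (ν[|L (y' τ)]) z (L (y' τ))))]
  · rw [lintegral_const_mul' _ _ ENNReal.ofReal_ne_top, mul_comm]
    refine mul_le_mul_left ?_ _
    refine hT B y' (L (y' τ)) _ hprob (hLm _) (fun i t => hac (hν i t)) ?_ (h1 hyG)
      (fun τ _ σ _ hne i => h2 τ σ hne i) ?_
    · exact ae_cond_mem (hLm _)
    · rw [add_comm]; exact hyG.2.1
  · filter_upwards [ae_partialSample_eq (S := B) (ν := ν[|L (y' τ)]) (y := y')] with z hz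
    rw [hz τ hτB, ← ENNReal.ofReal_mul (Real.sqrt_nonneg _), CutTree.sqrt_mul_deficit_cond z (hLm _) hνL]

end

/-! ### Induction over the scheme of splits. -/

/-- A child aiming at the fraction `v` has expected weight at most `v + D / N` and at least `v * N -
D` i.i.d. members. The quotient is at most `(1 + ε) / N` as soon as `(2 + ε) * D ≤ ε * v * N`. -/
theorem child_numeric {K ε D v N b : ℝ} (hK : 0 < K) (hε : 0 < ε) (hD : 0 < D) (hv : 1 / K ≤ v)
    (hN : K * ((2 + ε) * D / ε) ≤ N) (hb : v * N - D ≤ b) :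
    0 < v * N - D ∧ (v + D / N) / b ≤ (1 + ε) / N := by
  have h0 : 0 < K * ((2 + ε) * D / ε) := by positivity
  have hN0 : 0 < N := h0.trans_le hN
  have h1 : (2 + ε) * D / ε ≤ v * N := by
    have : (2 + ε) * D / ε = 1 / K * (K * ((2 + ε) * D / ε)) := by field_simp
    rw [this]
    exact mul_le_mul hv hN h0.le (le_trans (by positivity) hv)
  rw [div_le_iff₀ hε] at h1
  have h2 : 0 < v * N - D := by
    by_contra hc
    have : v * N * ε ≤ D * ε := mul_le_mul_of_nonneg_right (by linarith) hε.le
    linarith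
  refine ⟨h2, ?_⟩
  have hb0 : 0 < b := h2.trans_le hb
  rw [div_le_div_iff₀ hb0 hN0]
  have e : (v + D / N) * N = v * N + D := by field_simp
  rw [e]
  have : (1 + ε) * (v * N - D) ≤ (1 + ε) * b := mul_le_mul_of_nonneg_left hb (by linarith)
  linarith

section
variable {k n : ℕ}

theorem members_lowerPart (z : Fin n → Fin k → ℝ) (A : Set (Fin k → ℝ)) (i : Fin k) (t : ℝ) :
    members z (lowerPart A i (t : EReal)) = (members z A).filter (fun σ => z σ i ≤ t) := by
  ext σ
  simp [mem_members, lowerPart]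

theorem card_members_lowerPart_add_upperPart (z : Fin n → Fin k → ℝ) (A : Set (Fin k → ℝ))
    (i : Fin k) (c : EReal) :
    (members z (lowerPart A i c)).card + (members z (upperPart A i c)).card =
      (members z A).card := by
  classical
  have h1 : members z (lowerPart A i c) = (members z A).filter (fun σ => (z σ i : EReal) ≤ c) := by
    ext σ; simp [mem_members, lowerPart]
  have h2 : members z (upperPart A i c) = (members z A).filter (fun σ => ¬ (z σ i : EReal) ≤ c) := by
    ext σ; simp [mem_members, upperPart]
  rw [h1, h2, Finset.card_filter_add_card_filter_not]

theorem orderStat_eq_of_card_lowerPart {z : Fin n → Fin k → ℝ} {A : Set (Fin k → ℝ)} {i : Fin k}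
    {τ : Fin n} {r : ℕ} (hτ : z τ ∈ A) (h : (members z (lowerPart A i (z τ i : EReal))).card = r) :
    orderStat (members z A) (fun σ => z σ i) r = (z τ i : EReal) := by
  rw [members_lowerPart] at h
  exact orderStat_eq_of_card (mem_members.2 hτ) h

theorem exists_card_members_lowerPart {z : Fin n → Fin k → ℝ} {A : Set (Fin k → ℝ)} (i : Fin k)
    (hz : ∀ τ σ, σ ≠ τ → ∀ i, z σ i ≠ z τ i) {r : ℕ} (hr : 1 ≤ r) (hrA : r ≤ (members z A).card) :
    ∃ τ, z τ ∈ A ∧ (members z (lowerPart A i (z τ i : EReal))).card = r := by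
  obtain ⟨τ, hτ, h⟩ := exists_card_filter_le_eq (members z A) (fun σ => z σ i)
    (fun σ _ τ _ h => by by_contra hne; exact hz τ σ hne i h) hr hrA
  exact ⟨τ, mem_members.1 hτ, by rw [members_lowerPart]; exact h⟩

theorem eq_of_card_members_lowerPart {z : Fin n → Fin k → ℝ} {A : Set (Fin k → ℝ)} {i : Fin k}
    (hz : ∀ τ σ, σ ≠ τ → ∀ i, z σ i ≠ z τ i) {r : ℕ} {τ τ' : Fin n} (hτ : z τ ∈ A) (hτ' : z τ' ∈ A)
    (h : (members z (lowerPart A i (z τ i : EReal))).card = r)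
    (h' : (members z (lowerPart A i (z τ' i : EReal))).card = r) : τ = τ' := by
  by_contra hne
  have h1 := orderStat_eq_of_card_lowerPart hτ h
  rw [orderStat_eq_of_card_lowerPart hτ' h'] at h1
  exact hz τ' τ hne i (EReal.coe_eq_coe_iff.1 h1).symm

variable {ν : Measure (Fin k → ℝ)} [IsProbabilityMeasure ν] {S : Finset (Fin n)}
  {y : Fin n → Fin k → ℝ}

theorem lintegral_deficit_lowerPart_le (i : Fin k) (hν : ∀ i t, ν {x | x i = t} = 0)
    {A : Set (Fin k → ℝ)} (hAm : MeasurableSet A) (hA : ∀ᵐ x ∂ν, x ∈ A) {w r : ℕ}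
    (hw : (members y A \ S).card ≤ w) (hr : w + 1 < r)
    (hrm : r ≤ S.card + (members y A \ S).card)
    (hy : ∀ τ ∉ S, ∀ σ ∉ S, σ ≠ τ → ∀ i, y σ i ≠ y τ i) (T : CutTree k) {C : ℝ≥0∞} (hC : C ≠ ⊤)
    (hT : ∀ (B : Finset (Fin n)) (y' : Fin n → Fin k → ℝ) (A' : Set (Fin k → ℝ)) (ν' : Measure (Fin k → ℝ)),
      IsProbabilityMeasure ν' → MeasurableSet A' →
      (∀ i t, ν' {x | x i = t} = 0) → (∀ᵐ x ∂ν', x ∈ A') → (members y' A' \ B).card ≤ w + 1 →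
      (∀ τ ∉ B, ∀ σ ∉ B, σ ≠ τ → ∀ i, y' σ i ≠ y' τ i) →
      B.card + (members y' A' \ B).card = r →
      ∫⁻ z, ENNReal.ofReal (T.deficit ν' z A') ∂partialSample B ν' y' ≤ C) :
    ∫⁻ z, ENNReal.ofReal (T.deficit ν z
        (lowerPart A i (orderStat (members z A) (fun τ => z τ i) r))) ∂partialSample S ν y ≤
      C * ∫⁻ z, ENNReal.ofReal √(ν.real (lowerPart A i (orderStat (members z A) (fun τ => z τ i) r)))
        ∂partialSample S ν y := by
  refine lintegral_deficit_part_le hν hAm hA hw hr hy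
    (L := fun x => lowerPart A i (x i : EReal))
    ((MeasurableGraph.const hAm).lowerPart i (measurable_coe_real_ereal.comp (by fun_prop)))
    (fun x => Set.inter_subset_left) ?_ ?_ T hC hT
  · filter_upwards [ae_almostMembers hA hw, ae_partialSample_injective hν hy] with z h1 h2
    obtain ⟨τ, hτ, h⟩ := exists_card_members_lowerPart (A := A) i h2 (r := r) (by omega)
      (by rw [h1.2]; exact hrm)
    exact ⟨τ, hτ, h, by rw [orderStat_eq_of_card_lowerPart hτ h]⟩
  · filter_upwards [ae_partialSample_injective hν hy] with z h2 τ τ' hτ hτ' h h'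
    exact eq_of_card_members_lowerPart h2 hτ hτ' h h'

theorem lintegral_deficit_upperPart_le (i : Fin k) (hν : ∀ i t, ν {x | x i = t} = 0)
    {A : Set (Fin k → ℝ)} (hAm : MeasurableSet A) (hA : ∀ᵐ x ∂ν, x ∈ A) {w r : ℕ}
    (hw : (members y A \ S).card ≤ w) (hr : 1 ≤ r)
    (hrm : w + 1 < S.card + (members y A \ S).card - r)
    (hy : ∀ τ ∉ S, ∀ σ ∉ S, σ ≠ τ → ∀ i, y σ i ≠ y τ i) (T : CutTree k) {C : ℝ≥0∞} (hC : C ≠ ⊤)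
    (hT : ∀ (B : Finset (Fin n)) (y' : Fin n → Fin k → ℝ) (A' : Set (Fin k → ℝ)) (ν' : Measure (Fin k → ℝ)),
      IsProbabilityMeasure ν' → MeasurableSet A' →
      (∀ i t, ν' {x | x i = t} = 0) → (∀ᵐ x ∂ν', x ∈ A') → (members y' A' \ B).card ≤ w + 1 →
      (∀ τ ∉ B, ∀ σ ∉ B, σ ≠ τ → ∀ i, y' σ i ≠ y' τ i) →
      B.card + (members y' A' \ B).card = S.card + (members y A \ S).card - r →
      ∫⁻ z, ENNReal.ofReal (T.deficit ν' z A') ∂partialSample B ν' y' ≤ C) :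
    ∫⁻ z, ENNReal.ofReal (T.deficit ν z
        (upperPart A i (orderStat (members z A) (fun τ => z τ i) r))) ∂partialSample S ν y ≤
      C * ∫⁻ z, ENNReal.ofReal √(ν.real (upperPart A i (orderStat (members z A) (fun τ => z τ i) r)))
        ∂partialSample S ν y := by
  refine lintegral_deficit_part_le hν hAm hA hw hrm hy
    (L := fun x => upperPart A i (x i : EReal))
    ((MeasurableGraph.const hAm).upperPart i (measurable_coe_real_ereal.comp (by fun_prop)))
    (fun x => Set.inter_subset_left) ?_ ?_ T hC hT
  · filter_upwards [ae_almostMembers hA hw, ae_partialSample_injective hν hy] with z h1 h2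
    obtain ⟨τ, hτ, h⟩ := exists_card_members_lowerPart (A := A) i h2 (r := r) hr
      (by rw [h1.2]; omega)
    have h3 := card_members_lowerPart_add_upperPart z A i (z τ i : EReal)
    refine ⟨τ, hτ, by omega, by rw [orderStat_eq_of_card_lowerPart hτ h]⟩
  · filter_upwards [ae_almostMembers hA hw, ae_partialSample_injective hν hy]
      with z h1 h2 τ τ' hτ hτ' h h'
    have h3 := card_members_lowerPart_add_upperPart z A i (z τ i : EReal)
    have h4 := card_members_lowerPart_add_upperPart z A i (z τ' i : EReal)
    refine eq_of_card_members_lowerPart (r := r) (i := i) h2 hτ hτ' ?_ ?_ <;> omega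

end

/-- A bound for the expected deficit that is linear in the number of regions. -/
theorem exists_lintegral_deficit_le (d : ℕ) {K : ℝ} (hK : 0 < K) {θ : ℝ} (hθ : 3 / 4 < θ) (w : ℕ) :
    ∃ n₀ : ℕ, ∀ {k n : ℕ} (T : CutTree k) (S : Finset (Fin n)) (y : Fin n → Fin k → ℝ)
      (A : Set (Fin k → ℝ)) (ν : Measure (Fin k → ℝ)), IsProbabilityMeasure ν → T.leaves ≤ d →
      MeasurableSet A → (∀ i t, ν {x | x i = t} = 0) → (∀ᵐ x ∂ν, x ∈ A) →
      (members y A \ S).card ≤ w → (∀ τ ∉ S, ∀ σ ∉ S, σ ≠ τ → ∀ i, y σ i ≠ y τ i) →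
      T.Good K (S.card + (members y A \ S).card) → n₀ ≤ S.card →
      ∫⁻ z, ENNReal.ofReal (T.deficit ν z A) ∂partialSample S ν y ≤
        ENNReal.ofReal (θ / 4 * ((T.leaves : ℝ) - 1) / S.card) := by
  induction d generalizing θ w with
  | zero =>
    refine ⟨0, fun T S y A ν _ hT => ?_⟩
    have := T.one_le_leaves
    omega
  | succ d ih =>
    -- The children are held to a smaller constant `θ'`, still above `3/4 = 4 * 3/16`. The choice of
    -- `ε` lets one binary split cost at most `θ / 4`, while the loss of a factor `1 + ε` in the
    -- children stays within `θ`.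
    set θ' : ℝ := (θ + 3 / 4) / 2 with hθ'
    set ε : ℝ := (θ - 3 / 4) / (4 * θ + 4) with hε
    have hε0 : 0 < ε := div_pos (by linarith) (by linarith)
    have hεmul : ε * (4 * θ + 4) = θ - 3 / 4 := by rw [hε]; field_simp
    have hε1 : 3 / 16 + ε ≤ θ / 4 := by nlinarith
    have hε2 : θ' * (1 + ε) ≤ θ := by rw [hθ']; nlinarith
    -- One more stray is allowed in the children, namely the member on the cut.
    obtain ⟨n₁, hn₁⟩ := ih (θ := θ') (by rw [hθ']; linarith) (w + 1)
    obtain ⟨n₂, hn₂⟩ := exists_lintegral_binary_deficit_le w hK hε0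
    set D : ℝ := w + 3 with hD
    have hD0 : 0 < D := by positivity
    obtain ⟨n₃, hn₃⟩ := exists_nat_ge (max (K * ((2 + ε) * D / ε)) (K * (D + n₁ + 1)))
    refine ⟨max (max n₂ n₃) 1, ?_⟩
    intro k n T S y A ν hprob hT hAm hν hA hw hy hgood hlarge
    have hS2 : n₂ ≤ S.card := (le_max_left _ _).trans ((le_max_left _ _).trans hlarge)
    have hS3 : (n₃ : ℝ) ≤ S.card := by
      exact_mod_cast (le_max_right _ _).trans ((le_max_left _ _).trans hlarge)
    have hS1 : (1 : ℝ) ≤ S.card := by exact_mod_cast (le_max_right _ _).trans hlarge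
    have hN1 := (le_max_left _ _).trans (hn₃.trans hS3)
    have hN2 := (le_max_right _ _).trans (hn₃.trans hS3)
    cases T with
    | leaf =>
      simp [CutTree.deficit, CutTree.affinity]
    | node i r v L R =>
      obtain ⟨hr, hL, hR⟩ := hgood
      have hlv := L.one_le_leaves
      have hrv := R.one_le_leaves
      simp only [CutTree.leaves] at hT ⊢
      have hK0 : 0 < 1 / K := by positivity
      have hv0 : 0 < v := hK0.trans_le hr.lower
      have hv1 : 1 / K ≤ 1 - v := by linarith [hr.upper]
      have hKD : K * (w + 3) ≤ S.card := by
        refine le_trans (mul_le_mul_of_nonneg_left ?_ hK.le) hN2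
        have : (0 : ℝ) ≤ n₁ := Nat.cast_nonneg _
        linarith
      set m := S.card + (members y A \ S).card with hm
      obtain ⟨hr1, hr2, -, -⟩ := hr.bounds hK (w := w) (N := S.card) (by omega) (by omega) hKD
      have habs := abs_le.1 hr.abs_sub_le
      have hmS : (S.card : ℝ) ≤ m := by exact_mod_cast (by omega : S.card ≤ m)
      have hscale : ∀ {v : ℝ}, 1 / K ≤ v → D + n₁ + 1 ≤ v * S.card := by
        intro v hv
        have : D + n₁ + 1 = 1 / K * (K * (D + n₁ + 1)) := by field_simp
        rw [this]
        exact mul_le_mul hv hN2 (by positivity) (le_trans hK0.le hv)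
      have hn₁0 : (0 : ℝ) ≤ n₁ := Nat.cast_nonneg _
      have hrlow : v * S.card - 2 ≤ r := by
        have := mul_le_mul_of_nonneg_left hmS hv0.le
        linarith
      have hslow : (1 - v) * S.card - 2 ≤ ((m - r : ℕ) : ℝ) := by
        rw [Nat.cast_sub (by omega)]
        have := mul_le_mul_of_nonneg_left hmS (hK0.le.trans hv1)
        linarith
      have hchild : ∀ (T : CutTree k) (v : ℝ) (s : ℕ), 1 / K ≤ v → v * S.card - 2 ≤ s →
          T.leaves ≤ d → T.Good K s → ∀ (B : Finset (Fin n)) (y' : Fin n → Fin k → ℝ)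
          (A' : Set (Fin k → ℝ)) (ν' : Measure (Fin k → ℝ)),
          IsProbabilityMeasure ν' → MeasurableSet A' →
          (∀ i t, ν' {x | x i = t} = 0) → (∀ᵐ x ∂ν', x ∈ A') → (members y' A' \ B).card ≤ w + 1 →
          (∀ τ ∉ B, ∀ σ ∉ B, σ ≠ τ → ∀ i, y' σ i ≠ y' τ i) →
          B.card + (members y' A' \ B).card = s →
          ∫⁻ z, ENNReal.ofReal (T.deficit ν' z A') ∂partialSample B ν' y' ≤
            ENNReal.ofReal (θ' / 4 * ((T.leaves : ℝ) - 1) / (v * S.card - D)) := by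
        intro T v s hv hs hTd hTg B y' A' ν' hp' hAm' hν' hA' hw' hy' hBs
        -- The rank error `2` and at most `w + 1` strays account for `D = w + 3`.
        have hB : v * S.card - D ≤ B.card := by
          have h1 : (s : ℝ) = B.card + (members y' A' \ B).card := by exact_mod_cast hBs.symm
          have h2 : (((members y' A' \ B).card : ℕ) : ℝ) ≤ w + 1 := by exact_mod_cast hw'
          rw [hD]; linarith
        have h1 := hscale hv
        have hB1 : n₁ ≤ B.card := by
          have : (n₁ : ℝ) ≤ B.card := by linarith
          exact_mod_cast this
        refine (hn₁ T B y' A' ν' hp' hTd hAm' hν' hA' hw' hy' (by rw [hBs]; exact hTg) hB1).trans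
          (ENNReal.ofReal_le_ofReal ?_)
        have hpos := (child_numeric hK hε0 hD0 hv hN1 hB).1
        have hlt : (1 : ℝ) ≤ T.leaves := by exact_mod_cast T.one_le_leaves
        have hθ'0 : 0 < θ' := by rw [hθ']; linarith
        exact div_le_div_of_nonneg_left (mul_nonneg (by positivity) (by linarith)) hpos hB
      have hrw : w + 1 < r := by
        have h1 := hscale hr.lower
        have : ((w + 1 : ℕ) : ℝ) < r := by push_cast; linarith
        exact_mod_cast this
      have hsw : w + 1 < m - r := by
        have h1 := hscale hv1
        have : ((w + 1 : ℕ) : ℝ) < ((m - r : ℕ) : ℝ) := by push_cast; linarith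
        exact_mod_cast this
      set c : (Fin n → Fin k → ℝ) → EReal :=
        fun z => orderStat (members z A) (fun τ => z τ i) r with hc
      have hcm : Measurable c := (MeasurableGraph.const hAm).measurable_orderStat i measurable_const
      have hνA : ν.real A = 1 := by rw [measureReal_def, prob_compl_eq_zero_iff hAm |>.1 hA]; simp
      have hU : ∀ z, ν.real (lowerPart A i (c z)) = coordCdf ν i (c z) := fun z => by
        rw [coordCdf]
        refine measureReal_congr ?_
        filter_upwards [hA] with x hx
        exact propext (and_iff_right hx)
      have hU' : ∀ z, ν.real (upperPart A i (c z)) = 1 - coordCdf ν i (c z) := fun z => by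
        have := measureReal_lowerPart_add_upperPart ν A i (c z)
        rw [hνA, hU] at this
        linarith
      have I1 := hn₂ i hν hA hw hr hS2
      have I2 := lintegral_deficit_lowerPart_le i hν hAm hA hw hrw (by omega) hy L
        ENNReal.ofReal_ne_top (hchild L v r hr.lower hrlow (by omega) hL)
      have I3 := lintegral_deficit_upperPart_le i hν hAm hA hw (by omega) hsw hy R
        ENNReal.ofReal_ne_top (hchild R (1 - v) (m - r) hv1 hslow (by omega) hR)
      have J2 := lintegral_sqrt_mass_lower_le i hν hA hw hK hr hKD
      have J3 := lintegral_sqrt_mass_upper_le i hν hA hw hK hr hKD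
      change _ ≤ _ * ∫⁻ z, ENNReal.ofReal √(ν.real (lowerPart A i (c z))) ∂partialSample S ν y at I2
      change _ ≤ _ * ∫⁻ z, ENNReal.ofReal √(ν.real (upperPart A i (c z))) ∂partialSample S ν y at I3
      simp only [hU] at I2
      simp only [hU'] at I3
      have hgL : Measurable fun z : Fin n → Fin k → ℝ => L.deficit ν z (lowerPart A i (c z)) :=
        L.measurable_deficit ν ((MeasurableGraph.const hAm).lowerPart i hcm)
      have hgU : Measurable fun z => coordCdf ν i (c z) := (measurable_coordCdf i).comp hcm
      have hθ'0 : 0 < θ' := by rw [hθ']; linarith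
      have combine : ∀ (T : CutTree k) (v : ℝ) (X : (Fin n → Fin k → ℝ) → ℝ) (V : (Fin n → Fin k → ℝ) → ℝ), 1 / K ≤ v →
          ∫⁻ z, ENNReal.ofReal (X z) ∂partialSample S ν y ≤
            ENNReal.ofReal (θ' / 4 * ((T.leaves : ℝ) - 1) / (v * S.card - D)) *
              ∫⁻ z, ENNReal.ofReal √(V z) ∂partialSample S ν y →
          ∫⁻ z, ENNReal.ofReal (√v * √(V z)) ∂partialSample S ν y ≤
            ENNReal.ofReal (v + D / S.card) →
          ∫⁻ z, ENNReal.ofReal (√v * X z) ∂partialSample S ν y ≤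
            ENNReal.ofReal (θ / 4 * ((T.leaves : ℝ) - 1) / S.card) := by
        intro T v X V hv h1 h2
        obtain ⟨hpos, hnum⟩ := child_numeric hK hε0 hD0 hv hN1 (le_refl (v * S.card - D))
        have hlt : (0 : ℝ) ≤ (T.leaves : ℝ) - 1 := by
          rw [sub_nonneg]; exact_mod_cast T.one_le_leaves
        simp only [ENNReal.ofReal_mul (Real.sqrt_nonneg _)] at h2 ⊢
        rw [lintegral_const_mul' _ _ ENNReal.ofReal_ne_top] at h2 ⊢
        refine (mul_le_mul_right h1 _).trans ?_
        rw [mul_left_comm]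
        refine (mul_le_mul_right h2 _).trans ?_
        rw [← ENNReal.ofReal_mul (div_nonneg (mul_nonneg (by positivity) hlt) hpos.le)]
        refine ENNReal.ofReal_le_ofReal ?_
        calc θ' / 4 * ((T.leaves : ℝ) - 1) / (v * S.card - D) * (v + D / S.card)
            = θ' / 4 * ((T.leaves : ℝ) - 1) * ((v + D / S.card) / (v * S.card - D)) := by ring
          _ ≤ θ' / 4 * ((T.leaves : ℝ) - 1) * ((1 + ε) / S.card) :=
            mul_le_mul_of_nonneg_left hnum (mul_nonneg (by positivity) hlt)
          _ = (θ' * (1 + ε)) * (((T.leaves : ℝ) - 1) / 4 / S.card) := by ring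
          _ ≤ θ * (((T.leaves : ℝ) - 1) / 4 / S.card) :=
            mul_le_mul_of_nonneg_right hε2 (by positivity)
          _ = _ := by ring
      have M2 := combine L v _ _ hr.lower I2 J2
      have M3 := combine R (1 - v) _ _ hv1 I3 J3
      calc ∫⁻ z, ENNReal.ofReal ((CutTree.node i r v L R).deficit ν z A) ∂partialSample S ν y
          ≤ ∫⁻ z, (ENNReal.ofReal (1 - √v * √(coordCdf ν i (c z)) -
                √(1 - v) * √(1 - coordCdf ν i (c z))) +
              ENNReal.ofReal (√v * L.deficit ν z (lowerPart A i (c z)))) +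
              ENNReal.ofReal (√(1 - v) * R.deficit ν z (upperPart A i (c z)))
              ∂partialSample S ν y := by
            -- As real numbers the two sides agree: the deficit of a node is its binary deficit plus
            -- the weighted deficits of its children.
            refine lintegral_mono fun z => ?_
            refine le_trans ?_ ((ENNReal.ofReal_add_le).trans
              (add_le_add_left ENNReal.ofReal_add_le _))
            refine ENNReal.ofReal_le_ofReal (le_of_eq ?_)
            simp only [CutTree.deficit, CutTree.affinity]
            rw [show orderStat (members z A) (fun τ => z τ i) r = c z from rfl, hU, hU', hνA,
              Real.sqrt_one]
            ring
        _ ≤ ENNReal.ofReal ((3 / 16 + ε) / S.card) +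
              ENNReal.ofReal (θ / 4 * ((L.leaves : ℝ) - 1) / S.card) +
              ENNReal.ofReal (θ / 4 * ((R.leaves : ℝ) - 1) / S.card) := by
            rw [lintegral_add_left (by fun_prop), lintegral_add_left (by fun_prop)]
            exact add_le_add (add_le_add I1 M2) M3
        -- The binary split pays for the one unit by which the leaves minus one of the node exceed
        -- the corresponding sum over its children.
        _ ≤ _ := by
            have hl1 : (0 : ℝ) ≤ (L.leaves : ℝ) - 1 := by rw [sub_nonneg]; exact_mod_cast hlv
            have hr1 : (0 : ℝ) ≤ (R.leaves : ℝ) - 1 := by rw [sub_nonneg]; exact_mod_cast hrv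
            have hθ0 : 0 < θ := by linarith
            rw [← ENNReal.ofReal_add (by positivity) (by positivity),
              ← ENNReal.ofReal_add (by positivity) (by positivity)]
            refine ENNReal.ofReal_le_ofReal ?_
            rw [← add_div, ← add_div]
            refine div_le_div_of_nonneg_right ?_ (by positivity)
            push_cast
            linarith

/-! ### The moving-region method as a scheme of binary splits. -/

theorem card_filter_le_orderStat {n : ℕ} {S : Finset (Fin n)} {v : Fin n → ℝ}
    (hv : Set.InjOn v S) {r : ℕ} (hr : r ≤ S.card) :
    (S.filter (fun τ => (v τ : EReal) ≤ orderStat S v r)).card = r := by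
  rcases Nat.eq_zero_or_pos r with rfl | hr0
  · have h : orderStat S v 0 ≤ ⊥ := (orderStat_le_iff bot_ne_top).2 (Nat.zero_le _)
    rw [le_bot_iff.1 h]
    simp
  · obtain ⟨τ, hτ, h⟩ := exists_card_filter_le_eq S v hv hr0 hr
    rw [orderStat_eq_of_card hτ h]
    simpa using h

theorem sum_binIndex_succ {l : ℕ} {p : List ℕ → ℕ} (f : BinIndex (l + 1) p → ℝ) :
    ∑ J, f J = ∑ j : Fin (p [] + 1), ∑ J : BinIndex l (fun t => p ((j : ℕ) :: t)), f ⟨j, J⟩ :=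
  Fintype.sum_sigma f

theorem card_binIndex_succ {l : ℕ} {p : List ℕ → ℕ} :
    Fintype.card (BinIndex (l + 1) p) =
      ∑ j : Fin (p [] + 1), Fintype.card (BinIndex l (fun t => p ((j : ℕ) :: t))) :=
  Fintype.card_sigma

theorem card_binIndex_pos (l : ℕ) (p : List ℕ → ℕ) : 0 < Fintype.card (BinIndex l p) := by
  induction l generalizing p with
  | zero => exact Nat.one_pos
  | succ l ih =>
    rw [card_binIndex_succ]
    exact Finset.sum_pos (fun j _ => ih _) ⟨0, Finset.mem_univ _⟩

theorem sum_binIndex_zero {p : List ℕ → ℕ} (f : BinIndex 0 p → ℝ) : ∑ J, f J = f () :=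
  Fintype.sum_unique (ι := Unit) f

/-- The box without its lower faces. -/
def halfOpenBox {k : ℕ} (a b : Fin k → EReal) : Set (Fin k → ℝ) :=
  {y | ∀ i, a i < (y i : EReal) ∧ (y i : EReal) ≤ b i}

/-- No two members of the sample share a coordinate. -/
def DistinctCoords {k n : ℕ} (x : Fin n → Fin k → ℝ) : Prop :=
  ∀ τ σ, σ ≠ τ → ∀ i, x σ i ≠ x τ i

section
variable {k n : ℕ} {a b : Fin k → EReal} {x : Fin n → Fin k → ℝ} {A : Set (Fin k → ℝ)} {i : Fin k}

theorem members_lowerPart_ereal (x : Fin n → Fin k → ℝ) (A : Set (Fin k → ℝ)) (i : Fin k)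
    (c : EReal) :
    members x (lowerPart A i c) = (members x A).filter (fun σ => (x σ i : EReal) ≤ c) := by
  ext σ
  simp [mem_members, lowerPart]

/-- Once the lower faces are removed, the end points of the box obey the same rank formula as the
order statistics in between. -/
theorem card_members_lowerPart_cut (hA : A ⊆ halfOpenBox a b) (hx : DistinctCoords x) {q s : ℕ}
    (hs : s ≤ q + 1) :
    (members x (lowerPart A i (cut a b x A i q s))).card = (members x A).card * s / (q + 1) := by
  unfold cut
  split_ifs with h0 h1
  · rw [h0, mul_zero, Nat.zero_div, Finset.card_eq_zero, Finset.eq_empty_iff_forall_notMem]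
    intro τ hτ
    rw [mem_members] at hτ
    exact absurd (hA hτ.1 i).1 (not_lt.2 hτ.2)
  · rw [h1, Nat.mul_div_cancel _ (Nat.succ_pos q)]
    congr 1
    ext τ
    rw [mem_members, mem_members]
    exact ⟨fun h => h.1, fun h => ⟨h, (hA h i).2⟩⟩
  · rw [members_lowerPart_ereal]
    refine card_filter_le_orderStat (fun σ _ τ _ h => ?_) ?_
    · by_contra hne
      exact hx τ σ hne i h
    · exact Nat.div_le_of_le_mul (by rw [mul_comm]; exact Nat.mul_le_mul_right _ hs)

/-- At levels from `c` on, counts in `A` and in the upper part differ by the fixed number of members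
below the cut, so thresholds are raised to `max s c`. The two order statistics themselves may
differ: for `r = 0` the one in the upper part is `⊥`. -/
theorem orderStat_upperPart_lt_iff {c : EReal} {r : ℕ} {t : EReal} (hct : c < t) :
    orderStat (members x (upperPart A i c)) (fun τ => x τ i) r < t ↔
      orderStat (members x A) (fun τ => x τ i) ((members x (lowerPart A i c)).card + r) < t := by
  classical
  have hsplit : ∀ s, c ≤ s → ((members x A).filter (fun τ => (x τ i : EReal) ≤ s)).card =
      (members x (lowerPart A i c)).card +
        ((members x (upperPart A i c)).filter (fun τ => (x τ i : EReal) ≤ s)).card := by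
    intro s hs
    rw [← Finset.card_union_of_disjoint]
    · congr 1
      ext τ
      simp only [Finset.mem_filter, Finset.mem_union, mem_members, lowerPart, upperPart,
        Set.mem_inter_iff, Set.mem_ofPred_eq]
      constructor
      · rintro ⟨h1, h2⟩
        rcases le_or_gt (x τ i : EReal) c with h | h
        · exact Or.inl ⟨h1, h⟩
        · exact Or.inr ⟨⟨h1, h⟩, h2⟩
      · rintro (⟨h1, h2⟩ | ⟨⟨h1, -⟩, h2⟩)
        · exact ⟨h1, h2.trans hs⟩
        · exact ⟨h1, h2⟩
    · rw [Finset.disjoint_left]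
      intro τ h1 h2
      rw [mem_members] at h1
      rw [Finset.mem_filter, mem_members] at h2
      exact not_le.2 (show c < (x τ i : EReal) from h2.1.2) h1.2
  have hmono : ∀ (M : Finset (Fin n)) {s t : EReal}, s ≤ t →
      (M.filter (fun τ => (x τ i : EReal) ≤ s)).card ≤
      (M.filter (fun τ => (x τ i : EReal) ≤ t)).card := fun M _ _ hst =>
    Finset.card_le_card (Finset.monotone_filter_right _ fun _ _ h => h.trans hst)
  rw [orderStat_lt_iff, orderStat_lt_iff]
  constructor
  · rintro ⟨s, hs, h⟩
    refine ⟨max s c, max_lt hs hct, ?_⟩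
    rw [hsplit _ (le_max_right _ _)]
    exact Nat.add_le_add_left (h.trans (hmono _ (le_max_left _ _))) _
  · rintro ⟨s, hs, h⟩
    refine ⟨max s c, max_lt hs hct, ?_⟩
    have := h.trans (hmono _ (le_max_left s c))
    rw [hsplit _ (le_max_right _ _)] at this
    omega

/-- When `s` of the `s + e + 2` slabs have been peeled off, the next one should take the fraction `1
/ (e + 2)` of what is left. Rounding down moves each of the two cumulative ranks by less than one.
-/
theorem splitRank_peel {K : ℝ} {m s e : ℕ} (hK : (s : ℝ) + e + 2 ≤ K) :
    SplitRank K (m - m * s / (s + e + 1 + 1))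
      (m * (s + 1) / (s + e + 1 + 1) - m * s / (s + e + 1 + 1)) (1 / ((e : ℝ) + 2)) := by
  have hs0 : (0 : ℝ) ≤ s := Nat.cast_nonneg _
  have he0 : (0 : ℝ) ≤ e := Nat.cast_nonneg _
  refine ⟨one_div_le_one_div_of_le (by positivity) (by linarith), ?_, ?_⟩
  · have h1 : 1 / K ≤ 1 / 2 := one_div_le_one_div_of_le (by norm_num) (by linarith)
    have h2 : 1 / ((e : ℝ) + 2) ≤ 1 / 2 := one_div_le_one_div_of_le (by norm_num) (by linarith)
    linarith
  · set ρ := m * s / (s + e + 1 + 1) with hρ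
    set ρ' := m * (s + 1) / (s + e + 1 + 1) with hρ'
    have hle : ρ ≤ ρ' := Nat.div_le_div_right (Nat.mul_le_mul_left _ (Nat.le_succ s))
    have hlem : ρ ≤ m := Nat.div_le_of_le_mul (by rw [mul_comm]; exact Nat.mul_le_mul_right _ (by omega))
    rw [Nat.cast_sub hle, Nat.cast_sub hlem]
    have a1 : (ρ : ℝ) * (s + e + 2) ≤ m * s := by
      have := Nat.div_mul_le_self (m * s) (s + e + 1 + 1)
      have h : (((m * s / (s + e + 1 + 1)) * (s + e + 1 + 1) : ℕ) : ℝ) ≤ ((m * s : ℕ) : ℝ) := by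
        exact_mod_cast this
      rw [← hρ] at h
      push_cast at h
      linarith
    have a2 : (m : ℝ) * s ≤ (ρ + 1) * (s + e + 2) := by
      have := Nat.lt_div_mul_add (a := m * s) (b := s + e + 1 + 1) (by omega)
      have h : ((m * s : ℕ) : ℝ) ≤
          (((m * s / (s + e + 1 + 1)) * (s + e + 1 + 1) + (s + e + 1 + 1) : ℕ) : ℝ) := by
        exact_mod_cast this.le
      rw [← hρ] at h
      push_cast at h
      linarith
    have b1 : (ρ' : ℝ) * (s + e + 2) ≤ m * (s + 1) := by
      have := Nat.div_mul_le_self (m * (s + 1)) (s + e + 1 + 1)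
      have h : (((m * (s + 1) / (s + e + 1 + 1)) * (s + e + 1 + 1) : ℕ) : ℝ) ≤
          ((m * (s + 1) : ℕ) : ℝ) := by
        exact_mod_cast this
      rw [← hρ'] at h
      push_cast at h
      linarith
    have b2 : (m : ℝ) * (s + 1) ≤ (ρ' + 1) * (s + e + 2) := by
      have := Nat.lt_div_mul_add (a := m * (s + 1)) (b := s + e + 1 + 1) (by omega)
      have h : ((m * (s + 1) : ℕ) : ℝ) ≤
          (((m * (s + 1) / (s + e + 1 + 1)) * (s + e + 1 + 1) + (s + e + 1 + 1) : ℕ) : ℝ) := by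
        exact_mod_cast this.le
      rw [← hρ'] at h
      push_cast at h
      linarith
    have hQ : (0 : ℝ) < s + e + 2 := by positivity
    have he2 : (0 : ℝ) < (e : ℝ) + 2 := by positivity
    -- For the unrounded ranks the numerator vanishes, because `(e + 2) (s + 1) - (e + 1) s = s + e
    -- + 2`.
    have key : (ρ' : ℝ) - ρ - 1 / ((e : ℝ) + 2) * (m - ρ) =
        ((e + 2) * ((ρ' : ℝ) * (s + e + 2)) - (e + 1) * (ρ * (s + e + 2)) - m * (s + e + 2)) /
          ((e + 2) * (s + e + 2)) := by
      field_simp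
      ring
    rw [key, abs_le]
    have c1 := mul_le_mul_of_nonneg_left a1 (by positivity : (0 : ℝ) ≤ e + 1)
    have c2 := mul_le_mul_of_nonneg_left a2 (by positivity : (0 : ℝ) ≤ e + 1)
    have d1 := mul_le_mul_of_nonneg_left b1 he2.le
    have d2 := mul_le_mul_of_nonneg_left b2 he2.le
    constructor
    · rw [le_div_iff₀ (by positivity)]
      nlinarith
    · rw [div_le_iff₀ (by positivity)]
      nlinarith

theorem Ioc_cut_eq_lowerPart_upperPart (hA : A ⊆ halfOpenBox a b) (hx : DistinctCoords x)
    {q s : ℕ} (hs : s + 1 ≤ q) :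
    lowerPart (upperPart A i (cut a b x A i q s)) i
      (orderStat (members x (upperPart A i (cut a b x A i q s))) (fun τ => x τ i)
        ((members x A).card * (s + 1) / (q + 1) - (members x A).card * s / (q + 1))) =
      A ∩ {y | (y i : EReal) ∈ Set.Ioc (cut a b x A i q s) (cut a b x A i q (s + 1))} ∧
    upperPart (upperPart A i (cut a b x A i q s)) i
      (orderStat (members x (upperPart A i (cut a b x A i q s))) (fun τ => x τ i)
        ((members x A).card * (s + 1) / (q + 1) - (members x A).card * s / (q + 1))) =
      upperPart A i (cut a b x A i q (s + 1)) := by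
  have hle : (members x A).card * s / (q + 1) ≤ (members x A).card * (s + 1) / (q + 1) :=
    Nat.div_le_div_right (Nat.mul_le_mul_left _ (Nat.le_succ s))
  have hcard := card_members_lowerPart_cut (i := i) hA hx (q := q) (s := s) (by omega)
  have hcut : cut a b x A i q (s + 1) = orderStat (members x A) (fun τ => x τ i)
      ((members x A).card * (s + 1) / (q + 1)) := by
    unfold cut
    rw [if_neg (by omega), if_neg (by omega)]
  have key : ∀ y : Fin k → ℝ, cut a b x A i q s < (y i : EReal) →
      (orderStat (members x (upperPart A i (cut a b x A i q s))) (fun τ => x τ i)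
        ((members x A).card * (s + 1) / (q + 1) - (members x A).card * s / (q + 1)) < (y i : EReal) ↔
      cut a b x A i q (s + 1) < (y i : EReal)) := by
    intro y hy
    rw [orderStat_upperPart_lt_iff hy, hcard, Nat.add_sub_cancel' hle, hcut]
  constructor
  · ext y
    simp only [lowerPart, upperPart, Set.mem_inter_iff, Set.mem_ofPred_eq, Set.mem_Ioc, and_assoc]
    refine and_congr_right fun _ => and_congr_right fun h => ?_
    rw [← not_lt, ← not_lt]
    exact not_congr (key y h)
  · ext y
    simp only [upperPart, Set.mem_inter_iff, Set.mem_ofPred_eq, and_assoc]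
    refine and_congr_right fun hyA => ⟨fun h => (key y h.1).1 h.2, fun h => ?_⟩
    have hy : cut a b x A i q s < (y i : EReal) := by
      rcases Nat.eq_zero_or_pos s with rfl | hs0
      · simpa [cut] using (hA hyA i).1
      · refine lt_of_le_of_lt ?_ h
        rw [hcut, cut, if_neg (by omega), if_neg (by omega)]
        exact orderStat_anti fun t ht => hle.trans ht
    exact ⟨hy, (key y hy).2 h⟩

/-- The cut points themselves need not increase, since an order statistic of rank `0` is `⊥` and may
lie below `a i`. This does no harm for points of the half-open box, none of which lies at or below
`a i`. -/
theorem le_cut_succ (hA : A ⊆ halfOpenBox a b) {q s : ℕ} (hs : s ≤ q) {y : Fin k → ℝ} (hyA : y ∈ A)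
    (hy : (y i : EReal) ≤ cut a b x A i q s) : (y i : EReal) ≤ cut a b x A i q (s + 1) := by
  rcases Nat.eq_zero_or_pos s with rfl | hs0
  · have : (y i : EReal) ≤ a i := by simpa [cut] using hy
    exact absurd (hA hyA i).1 (not_lt.2 this)
  by_cases hsq : s = q
  · subst hsq
    simpa [cut] using (hA hyA i).2
  · refine hy.trans ?_
    rw [cut, cut, if_neg (by omega), if_neg (by omega), if_neg (by omega), if_neg (by omega)]
    exact orderStat_anti fun t ht =>
      (Nat.div_le_div_right (Nat.mul_le_mul_left _ (Nat.le_succ s))).trans ht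

theorem card_members_Ioc_cut (hA : A ⊆ halfOpenBox a b) (hx : DistinctCoords x) {q s : ℕ}
    (hs : s ≤ q) :
    (members x (A ∩ {y | (y i : EReal) ∈
        Set.Ioc (cut a b x A i q s) (cut a b x A i q (s + 1))})).card =
      (members x A).card * (s + 1) / (q + 1) - (members x A).card * s / (q + 1) := by
  have h1 := card_members_lowerPart_cut (i := i) hA hx (q := q) (s := s) (by omega)
  have h2 := card_members_lowerPart_cut (i := i) hA hx (q := q) (s := s + 1) (by omega)
  rw [← h1, ← h2, ← Finset.card_sdiff_of_subset]
  · congr 1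
    ext τ
    simp only [Finset.mem_sdiff, mem_members, lowerPart, Set.mem_inter_iff, Set.mem_ofPred_eq,
      Set.mem_Ioc, not_and, not_le]
    tauto
  · intro τ hτ
    rw [mem_members] at hτ ⊢
    exact ⟨hτ.1, le_cut_succ hA hs hτ.1 hτ.2⟩

end

/-- Splitting a region into `q + 1` regions by cutting off one region after the other. -/
theorem exists_cutTree_peel {k : ℕ} (a b : Fin k → EReal) (i : Fin k) (q m : ℕ) {K : ℝ}
    (hK : (q : ℝ) + 1 ≤ K) (T : Fin (q + 1) → CutTree k)
    (hT : ∀ j : Fin (q + 1), (T j).Good K (m * ((j : ℕ) + 1) / (q + 1) - m * (j : ℕ) / (q + 1)))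
    (s e : ℕ) (hse : s + e = q) :
    ∃ T' : CutTree k, T'.Good K (m - m * s / (q + 1)) ∧
      T'.leaves = ∑ j ∈ Finset.univ.filter (fun j : Fin (q + 1) => s ≤ (j : ℕ)), (T j).leaves ∧
      ∀ {n : ℕ} (x : Fin n → Fin k → ℝ) (A : Set (Fin k → ℝ)) (ν : Measure (Fin k → ℝ)),
        A ⊆ halfOpenBox a b → DistinctCoords x → (members x A).card = m →
        T'.affinity ν x (upperPart A i (cut a b x A i q s)) =
          √(1 / ((e : ℝ) + 1)) *
            ∑ j ∈ Finset.univ.filter (fun j : Fin (q + 1) => s ≤ (j : ℕ)),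
              (T j).affinity ν x (A ∩ {y | (y i : EReal) ∈
                Set.Ioc (cut a b x A i q j) (cut a b x A i q (j + 1))}) := by
  -- The slabs `s, …, q` remain and there are `e + 1` of them; the last one needs no cut.
  induction e generalizing s with
  | zero =>
    obtain rfl : s = q := by omega
    have hfilter : Finset.univ.filter (fun j : Fin (s + 1) => s ≤ (j : ℕ)) = {Fin.last s} := by
      ext j
      simp only [Finset.mem_filter, Finset.mem_univ, true_and, Finset.mem_singleton, Fin.ext_iff,
        Fin.val_last]
      have := j.2
      omega
    refine ⟨T (Fin.last s), ?_, ?_, ?_⟩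
    · have h := hT (Fin.last s)
      rwa [Fin.val_last, Nat.mul_div_cancel _ (Nat.succ_pos s)] at h
    · rw [hfilter, Finset.sum_singleton]
    · intro n x A ν hA hx hm
      rw [hfilter, Finset.sum_singleton]
      simp only [Nat.cast_zero, zero_add, div_one, Real.sqrt_one, one_mul, Fin.val_last]
      congr 1
      ext y
      simp only [upperPart, Set.mem_inter_iff, Set.mem_ofPred_eq, Set.mem_Ioc]
      refine and_congr_right fun hyA => ?_
      have : (y i : EReal) ≤ cut a b x A i s (s + 1) := by
        unfold cut
        rw [if_neg (by omega), if_pos rfl]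
        exact (hA hyA i).2
      exact ⟨fun h => ⟨h, this⟩, fun h => h.1⟩
  | succ e ih =>
    obtain ⟨T', hgood, hleaves, haff⟩ := ih (s + 1) (by omega)
    have hsq : s < q + 1 := by omega
    set j₀ : Fin (q + 1) := ⟨s, hsq⟩ with hj₀
    have hnot : j₀ ∉ Finset.univ.filter (fun j : Fin (q + 1) => s + 1 ≤ (j : ℕ)) := by
      simp [hj₀]
    have hfilter : Finset.univ.filter (fun j : Fin (q + 1) => s ≤ (j : ℕ)) =
        insert j₀ (Finset.univ.filter (fun j : Fin (q + 1) => s + 1 ≤ (j : ℕ))) := by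
      ext j
      simp only [Finset.mem_filter, Finset.mem_univ, true_and, Finset.mem_insert, Fin.ext_iff, hj₀]
      omega
    have hle : m * s / (q + 1) ≤ m * (s + 1) / (q + 1) :=
      Nat.div_le_div_right (Nat.mul_le_mul_left _ (Nat.le_succ s))
    refine ⟨.node i (m * (s + 1) / (q + 1) - m * s / (q + 1)) (1 / ((e : ℝ) + 2)) (T j₀) T',
      ⟨?_, hT j₀, ?_⟩, ?_, ?_⟩
    · have h := splitRank_peel (K := K) (m := m) (s := s) (e := e) (by
        have : (q : ℝ) = s + (e + 1) := by exact_mod_cast hse.symm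
        linarith)
      rwa [show s + e + 1 + 1 = q + 1 by omega] at h
    · rw [show m - m * s / (q + 1) - (m * (s + 1) / (q + 1) - m * s / (q + 1)) =
        m - m * (s + 1) / (q + 1) by omega]
      exact hgood
    · rw [hfilter, Finset.sum_insert hnot, ← hleaves]; rfl
    · intro n x A ν hA hx hm
      obtain ⟨h1, h2⟩ := Ioc_cut_eq_lowerPart_upperPart (i := i) hA hx (q := q) (s := s) (by omega)
      rw [hm] at h1 h2
      simp only [CutTree.affinity]
      rw [h1, h2, haff x A ν hA hx hm, hfilter, Finset.sum_insert hnot, mul_add, ← mul_assoc]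
      -- The fraction `1 - 1 / (e + 2)` left after peeling is shared equally by `e + 1` slabs, so
      -- each is again assigned `1 / (e + 2)`.
      have e1 : √(1 - 1 / ((e : ℝ) + 2)) * √(1 / ((e : ℝ) + 1)) = √(1 / (((e + 1 : ℕ) : ℝ) + 1)) := by
        rw [← Real.sqrt_mul' _ (by positivity)]
        congr 1
        push_cast
        field_simp
        ring
      have e2 : √(1 / ((e : ℝ) + 2)) = √(1 / (((e + 1 : ℕ) : ℝ) + 1)) := by
        congr 2
        push_cast
        ring
      rw [e1, e2]

/-- The moving-region method is a scheme of successive binary splits. -/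
theorem exists_cutTree {k : ℕ} (a b : Fin k → EReal) {K : ℝ} (l i : ℕ) (h : i + l ≤ k)
    (p : List ℕ → ℕ) (hK : (Fintype.card (BinIndex l p) : ℝ) ≤ K) (m : ℕ) :
    ∃ T : CutTree k, T.Good K m ∧ T.leaves = Fintype.card (BinIndex l p) ∧
      ∀ {n : ℕ} (x : Fin n → Fin k → ℝ) (A : Set (Fin k → ℝ)) (ν : Measure (Fin k → ℝ)),
        A ⊆ halfOpenBox a b → DistinctCoords x → (members x A).card = m →
        T.affinity ν x A = ∑ J, √(nominal l p J) * √(ν.real (regionFrom a b x l i h p A J)) := by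
  induction l generalizing i p m with
  | zero =>
    refine ⟨.leaf, trivial, ?_, ?_⟩
    · rfl
    · intro n x A ν _ _ _
      rw [sum_binIndex_zero]
      simp [CutTree.affinity, nominal, regionFrom]
  | succ l ih =>
    set q := p [] with hq
    rw [card_binIndex_succ] at hK
    have hcard : ∀ j : Fin (q + 1), Fintype.card (BinIndex l (fun t => p ((j : ℕ) :: t))) ≤
        ∑ j : Fin (q + 1), Fintype.card (BinIndex l (fun t => p ((j : ℕ) :: t))) := fun j =>
      Finset.single_le_sum (f := fun j : Fin (q + 1) =>
        Fintype.card (BinIndex l (fun t => p ((j : ℕ) :: t)))) (fun _ _ => Nat.zero_le _)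
        (Finset.mem_univ j)
    have hq1 : (q : ℝ) + 1 ≤ K := by
      refine le_trans ?_ hK
      have : q + 1 ≤ ∑ j : Fin (q + 1), Fintype.card (BinIndex l (fun t => p ((j : ℕ) :: t))) := by
        calc q + 1 = ∑ _j : Fin (q + 1), 1 := by simp
          _ ≤ _ := Finset.sum_le_sum fun j _ => card_binIndex_pos l _
      exact_mod_cast this
    -- The number of members of each slab is determined by `m`, so the ranks of all later splits are
    -- too; one deterministic scheme serves every sample with distinct coordinates.
    choose T hTgood hTleaves hTaff using fun j : Fin (q + 1) =>
      ih (i + 1) (by omega) (fun t => p ((j : ℕ) :: t))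
        ((Nat.cast_le.2 (hcard j)).trans hK)
        (m * ((j : ℕ) + 1) / (q + 1) - m * (j : ℕ) / (q + 1))
    obtain ⟨T', hgood, hleaves, haff⟩ :=
      exists_cutTree_peel a b ⟨i, by omega⟩ q m hq1 T hTgood 0 q (by omega)
    have hfilter : Finset.univ.filter (fun j : Fin (q + 1) => 0 ≤ (j : ℕ)) = Finset.univ :=
      Finset.filter_true_of_mem fun _ _ => Nat.zero_le _
    refine ⟨T', ?_, ?_, ?_⟩
    · simpa using hgood
    · rw [hleaves, hfilter, card_binIndex_succ]
      exact Finset.sum_congr rfl fun j _ => hTleaves j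
    · intro n x A ν hA hx hm
      have hfull : upperPart A ⟨i, by omega⟩ (cut a b x A ⟨i, by omega⟩ q 0) = A :=
        Set.inter_eq_left.2 fun y hy => by simpa [cut] using (hA hy ⟨i, by omega⟩).1
      have h1 := haff x A ν hA hx hm
      rw [hfull, hfilter] at h1
      rw [h1, sum_binIndex_succ, Finset.mul_sum]
      refine Finset.sum_congr rfl fun j _ => ?_
      have hmj : (members x (A ∩ {y | (y ⟨i, by omega⟩ : EReal) ∈
          Set.Ioc (cut a b x A ⟨i, by omega⟩ q j) (cut a b x A ⟨i, by omega⟩ q (j + 1))})).card =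
          m * ((j : ℕ) + 1) / (q + 1) - m * (j : ℕ) / (q + 1) := by
        rw [card_members_Ioc_cut hA hx (by have := j.2; omega), hm]
      rw [hTaff j x _ ν (Set.inter_subset_left.trans hA) hx hmj, Finset.mul_sum]
      refine Finset.sum_congr rfl fun J _ => ?_
      rw [← mul_assoc, ← Real.sqrt_mul (by positivity)]
      rfl

/-! ### Bin masses, nominal weights and the lower faces of the box. -/

section
variable {k n : ℕ} {a b : Fin k → EReal}

/-- The cuts only see the members, so a set containing the whole sample passes through the
construction. With the half-open box as `B` this removes the lower faces from the bins. -/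
theorem regionFrom_inter {x : Fin n → Fin k → ℝ} {B : Set (Fin k → ℝ)} (hB : ∀ τ, x τ ∈ B)
    (l i : ℕ) (h : i + l ≤ k) (p : List ℕ → ℕ) (A : Set (Fin k → ℝ)) (J : BinIndex l p) :
    regionFrom a b x l i h p (A ∩ B) J = regionFrom a b x l i h p A J ∩ B := by
  induction l generalizing i p A with
  | zero => rfl
  | succ l ih =>
    obtain ⟨j, J⟩ := J
    have hm : members x (A ∩ B) = members x A := by
      ext τ
      simp [mem_members, hB τ]
    have hc : ∀ (i : Fin k) (q s : ℕ), cut a b x (A ∩ B) i q s = cut a b x A i q s := by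
      intro i q s
      simp only [cut, hm]
    simp only [regionFrom]
    rw [hc, hc, ← ih, Set.inter_right_comm]

theorem measurableSet_cutBand {A : Set (Fin k → ℝ)} (hA : MeasurableSet A) (i : Fin k)
    (c d : EReal) : MeasurableSet (A ∩ {y | (y i : EReal) ∈ Set.Ioc c d}) := by
  have h := measurableSet_lowerPart (measurableSet_upperPart hA i c) i d
  have e : A ∩ {y | (y i : EReal) ∈ Set.Ioc c d} = lowerPart (upperPart A i c) i d := by
    ext y
    simp only [lowerPart, upperPart, Set.mem_inter_iff, Set.mem_ofPred_eq, Set.mem_Ioc, and_assoc]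
  rw [e]; exact h

/-- Only an upper bound on the total mass is needed, so disjointness of the slabs suffices. -/
theorem sum_measure_regionFrom_le (μ : Measure (Fin k → ℝ)) [IsFiniteMeasure μ]
    {x : Fin n → Fin k → ℝ} (l i : ℕ) (h : i + l ≤ k) (p : List ℕ → ℕ) {A : Set (Fin k → ℝ)}
    (hA : A ⊆ halfOpenBox a b) (hAm : MeasurableSet A) :
    ∑ J, μ.real (regionFrom a b x l i h p A J) ≤ μ.real A := by
  induction l generalizing i p A with
  | zero => rw [sum_binIndex_zero]; exact le_rfl
  | succ l ih =>
    rw [sum_binIndex_succ]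
    set i' : Fin k := ⟨i, by omega⟩
    set R : Fin (p [] + 1) → Set (Fin k → ℝ) := fun j => A ∩ {y | (y i' : EReal) ∈
      Set.Ioc (cut a b x A i' (p []) j) (cut a b x A i' (p []) (j + 1))} with hR
    have hRm : ∀ j, MeasurableSet (R j) := fun j => measurableSet_cutBand hAm i' _ _
    have hle : ∀ (y : Fin k → ℝ) (s e : ℕ), y ∈ A → s + e ≤ p [] + 1 →
        (y i' : EReal) ≤ cut a b x A i' (p []) s → (y i' : EReal) ≤ cut a b x A i' (p []) (s + e) := by
      intro y s e hy hse hys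
      induction e with
      | zero => exact hys
      | succ e ihe =>
        have h1 : s + e ≤ p [] := by rw [← add_assoc] at hse; exact Nat.le_of_succ_le_succ hse
        exact le_cut_succ (s := s + e) hA h1 hy (ihe (h1.trans (Nat.le_succ _)))
    have hdisj : ∀ j j' : Fin (p [] + 1), (j : ℕ) < j' → Disjoint (R j) (R j') := by
      intro j j' hjj
      rw [Set.disjoint_left]
      rintro y ⟨hyA, hy⟩ ⟨-, hy'⟩
      have hj' := j'.2
      have := hle y (j + 1) (j' - (j + 1)) hyA (by omega) hy.2
      rw [Nat.add_sub_cancel' (by omega)] at this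
      exact absurd hy'.1 (not_lt.2 this)
    calc ∑ j, ∑ J, μ.real (regionFrom a b x (l + 1) i h p A ⟨j, J⟩)
        ≤ ∑ j, μ.real (R j) := by
          refine Finset.sum_le_sum fun j _ => ?_
          exact ih (i + 1) (by omega) (fun t => p ((j : ℕ) :: t)) (A := R j)
            (Set.inter_subset_left.trans hA) (hRm j)
      _ = μ.real (⋃ j, R j) := by
          rw [measureReal_iUnion_fintype _ hRm]
          intro j j' hne
          rcases lt_or_gt_of_ne (Fin.val_ne_of_ne hne) with h | h
          · exact hdisj j j' h
          · exact (hdisj j' j h).symm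
      _ ≤ μ.real A := measureReal_mono (Set.iUnion_subset fun j => Set.inter_subset_left)

theorem nominal_nonneg (l : ℕ) (p : List ℕ → ℕ) (J : BinIndex l p) : 0 ≤ nominal l p J := by
  induction l generalizing p with
  | zero => exact zero_le_one
  | succ l ih =>
    obtain ⟨j, J⟩ := J
    exact mul_nonneg (by positivity) (ih _ J)

theorem sum_nominal (l : ℕ) (p : List ℕ → ℕ) : ∑ J, nominal l p J = 1 := by
  induction l generalizing p with
  | zero => rw [sum_binIndex_zero]; rfl
  | succ l ih =>
    rw [sum_binIndex_succ]
    have : ∀ j : Fin (p [] + 1), ∑ J : BinIndex l (fun t => p ((j : ℕ) :: t)),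
        nominal (l + 1) p ⟨j, J⟩ = 1 / ((p [] : ℝ) + 1) := by
      intro j
      simp only [nominal]
      rw [← Finset.mul_sum, ih, mul_one]
    rw [Finset.sum_congr rfl fun j _ => this j, Finset.sum_const, Finset.card_univ,
      Fintype.card_fin, nsmul_eq_mul]
    push_cast
    field_simp

theorem nominal_le_one (l : ℕ) (p : List ℕ → ℕ) (J : BinIndex l p) : nominal l p J ≤ 1 := by
  rw [← sum_nominal l p]
  exact Finset.single_le_sum (fun J _ => nominal_nonneg l p J) (Finset.mem_univ J)

theorem measurableSet_halfOpenBox (a b : Fin k → EReal) : MeasurableSet (halfOpenBox a b) := by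
  unfold halfOpenBox
  simp only [Set.ofPred_forall]
  refine MeasurableSet.iInter fun i => ?_
  exact (measurableSet_lt measurable_const (measurable_coe_real_ereal.comp (by fun_prop))).inter
    (measurableSet_le (measurable_coe_real_ereal.comp (by fun_prop)) measurable_const)

theorem IsContinuousOnBox.ae_mem_halfOpenBox {μ : Measure (Fin k → ℝ)}
    (hμ : IsContinuousOnBox a b μ) : ∀ᵐ y ∂μ, y ∈ halfOpenBox a b := by
  -- For an infinite `a i` the default value `0` of `toReal` merely excludes one more null
  -- hyperplane.
  have h : ∀ᵐ y ∂μ, ∀ i, (a i).toReal ≠ y i := by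
    rw [ae_all_iff]
    intro i
    rw [ae_iff]
    have := hμ.marginal_no_atoms i (a i).toReal
    convert this using 3
    simp [eq_comm]
  filter_upwards [hμ.ae_mem_box, h] with y hy hy' i
  refine ⟨lt_of_le_of_ne (hy i).1 fun he => hy' i ?_, (hy i).2⟩
  rw [he, EReal.toReal_coe]

theorem halfOpenBox_subset_box : halfOpenBox a b ⊆ box a b := fun _ hy i => ⟨(hy i).1.le, (hy i).2⟩

theorem discretized_eq {μ : Measure (Fin k → ℝ)} (hμ : IsContinuousOnBox a b μ)
    {x : Fin n → Fin k → ℝ} (hx : ∀ τ, x τ ∈ halfOpenBox a b) {l : ℕ} (hl : l ≤ k)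
    (p : List ℕ → ℕ) (J : BinIndex l p) :
    discretized a b x hl p μ J =
      μ.real (regionFrom a b x l 0 (by omega) p (halfOpenBox a b) J) := by
  have h := regionFrom_inter (a := a) (b := b) hx l 0 (by omega) p (box a b) J
  rw [Set.inter_eq_right.2 halfOpenBox_subset_box] at h
  rw [h, discretized, region]
  refine measureReal_congr ?_
  filter_upwards [hμ.ae_mem_halfOpenBox] with y hy
  exact propext (and_iff_left hy).symm

theorem sum_discretized_le_one {μ : Measure (Fin k → ℝ)} [IsProbabilityMeasure μ]
    (hμ : IsContinuousOnBox a b μ)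
    {x : Fin n → Fin k → ℝ} (hx : ∀ τ, x τ ∈ halfOpenBox a b) {l : ℕ} (hl : l ≤ k)
    (p : List ℕ → ℕ) : ∑ J, discretized a b x hl p μ J ≤ 1 := by
  simp only [discretized_eq hμ hx]
  exact (sum_measure_regionFrom_le μ l 0 (by omega) p subset_rfl
    (measurableSet_halfOpenBox a b)).trans measureReal_le_one

end

/-! ### The Hellinger distance -/

section Hellinger
variable {ι : Type*} [Fintype ι] {u v w : ι → ℝ}

theorem hellinger_nonneg (u v : ι → ℝ) : 0 ≤ hellinger u v :=
  mul_nonneg zero_le_two (Finset.sum_nonneg fun _ _ => sq_nonneg _)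

theorem hellinger_le_card (hu : ∀ J, u J ≤ 1) (hv : ∀ J, v J ≤ 1) :
    hellinger u v ≤ 2 * Fintype.card ι := by
  unfold hellinger
  refine mul_le_mul_of_nonneg_left ?_ zero_le_two
  calc ∑ J, (√(u J) - √(v J)) ^ 2 ≤ ∑ _J : ι, (1 : ℝ) := by
        refine Finset.sum_le_sum fun J _ => ?_
        have h1 := Real.sqrt_le_one.2 (hu J)
        have h2 := Real.sqrt_le_one.2 (hv J)
        have h3 := Real.sqrt_nonneg (u J)
        have h4 := Real.sqrt_nonneg (v J)
        rw [sq_le_one_iff_abs_le_one, abs_le]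
        constructor <;> linarith
    _ = Fintype.card ι := by simp

theorem hellinger_eq (hu : ∀ J, 0 ≤ u J) (hv : ∀ J, 0 ≤ v J) :
    hellinger u v = 2 * ∑ J, u J + 2 * ∑ J, v J - 4 * ∑ J, √(u J) * √(v J) := by
  unfold hellinger
  rw [Finset.mul_sum, Finset.mul_sum, Finset.mul_sum, Finset.mul_sum, ← Finset.sum_add_distrib,
    ← Finset.sum_sub_distrib]
  refine Finset.sum_congr rfl fun J _ => ?_
  have h1 := Real.sq_sqrt (hu J)
  have h2 := Real.sq_sqrt (hv J)
  linear_combination 2 * h1 + 2 * h2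

/-- Since `∑ v ≤ ∑ w`, the increase is at most `4 ∑ √u (√w - √v)`, and completing the square bounds
each term by `t / 2 * u + 8 / t * (√v - √w) ^ 2`. The parameter `t` stays free so that it can be
optimized after taking expectations. -/
theorem hellinger_triangle (hu : ∀ J, 0 ≤ u J) (hv : ∀ J, 0 ≤ v J) (hw : ∀ J, 0 ≤ w J)
    (hu1 : ∑ J, u J ≤ 1) (hvw : ∑ J, v J ≤ ∑ J, w J) {t : ℝ} (ht : 0 < t) :
    hellinger u v ≤ hellinger u w + (4 / t * hellinger v w + t / 2) := by
  have key : ∑ J, 4 * (√(u J) * (√(w J) - √(v J))) ≤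
      ∑ J, (t / 2 * u J + 8 / t * (√(v J) - √(w J)) ^ 2) := by
    refine Finset.sum_le_sum fun J _ => ?_
    have h1 := Real.sq_sqrt (hu J)
    set x := √(u J)
    rw [← h1]
    have h2 : 0 ≤ (t * x - 4 * (√(w J) - √(v J))) ^ 2 / (2 * t) := by positivity
    have h3 : (t * x - 4 * (√(w J) - √(v J))) ^ 2 / (2 * t) =
        t / 2 * x ^ 2 + 8 / t * (√(v J) - √(w J)) ^ 2 - 4 * (x * (√(w J) - √(v J))) := by
      field_simp
      ring
    linarith
  rw [hellinger_eq hu hv, hellinger_eq hu hw, hellinger]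
  rw [← Finset.mul_sum, Finset.sum_add_distrib, ← Finset.mul_sum, ← Finset.mul_sum] at key
  simp only [mul_sub, Finset.sum_sub_distrib] at key
  have h4 : t / 2 * ∑ J, u J ≤ t / 2 := by
    have := mul_le_mul_of_nonneg_left hu1 (by positivity : 0 ≤ t / 2)
    linarith
  have h5 : 4 / t * (2 * ∑ J, (√(v J) - √(w J)) ^ 2) = 8 / t * ∑ J, (√(v J) - √(w J)) ^ 2 := by
    ring
  rw [h5]
  linarith

end Hellinger

/-! ### Expectations -/

section Expectation
variable {k : ℕ} {a b : Fin k → EReal} {l : ℕ}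

theorem measurable_discretized {n : ℕ} (a b : Fin k → EReal) (hl : l ≤ k) (p : List ℕ → ℕ)
    (μ : Measure (Fin k → ℝ)) [IsFiniteMeasure μ] (J : BinIndex l p) :
    Measurable fun x : Fin n → Fin k → ℝ => discretized a b x hl p μ J :=
  (measurableGraph_region a b hl p J).measurable_real μ

theorem measurable_proportion {n m : ℕ} (a b : Fin k → EReal) (hl : l ≤ k) (p : List ℕ → ℕ)
    (J : BinIndex l p) :
    Measurable fun q : (Fin m → Fin k → ℝ) × (Fin n → Fin k → ℝ) =>
      proportion a b q.2 hl p q.1 J := by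
  classical
  have h : Measurable fun q : (Fin m → Fin k → ℝ) × (Fin n → Fin k → ℝ) =>
      (members q.1 (region a b q.2 hl p J)).card := by
    unfold members
    exact measurable_card_filter
      (fun τ (q : (Fin m → Fin k → ℝ) × (Fin n → Fin k → ℝ)) => q.1 τ ∈ region a b q.2 hl p J)
      fun τ => (measurableGraph_region a b hl p J).measurableSet_mem τ
  exact ((measurable_from_nat (f := fun m : ℕ => (m : ℝ))).comp h).div_const _

theorem proportion_le_one {n m : ℕ} (x : Fin n → Fin k → ℝ) (hl : l ≤ k) (p : List ℕ → ℕ)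
    (z : Fin m → Fin k → ℝ) (J : BinIndex l p) : proportion a b x hl p z J ≤ 1 := by
  refine div_le_one_of_le₀ ?_ (Nat.cast_nonneg _)
  have := Finset.card_le_univ (members z (region a b x hl p J))
  rw [Fintype.card_fin] at this
  exact_mod_cast this

theorem proportion_nonneg {n m : ℕ} (x : Fin n → Fin k → ℝ) (hl : l ≤ k) (p : List ℕ → ℕ)
    (z : Fin m → Fin k → ℝ) (J : BinIndex l p) : 0 ≤ proportion a b x hl p z J := by
  unfold proportion; positivity

theorem measurable_hellinger {α ι : Type*} [MeasurableSpace α] [Fintype ι] {u v : α → ι → ℝ}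
    (hu : ∀ J, Measurable fun x => u x J) (hv : ∀ J, Measurable fun x => v x J) :
    Measurable fun x => hellinger (u x) (v x) := by
  unfold hellinger
  exact (Finset.measurable_sum _ fun J _ =>
    (((hu J).sqrt.sub (hv J).sqrt).pow_const 2)).const_mul 2

theorem integrable_of_nonneg_of_le {α : Type*} [MeasurableSpace α] {μ : Measure α}
    [IsFiniteMeasure μ] {f : α → ℝ} (hf : AEStronglyMeasurable f μ) {C : ℝ} (h0 : ∀ x, 0 ≤ f x)
    (hC : ∀ x, f x ≤ C) : Integrable f μ :=
  Integrable.of_bound hf C (Eventually.of_forall fun x => by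
    rw [Real.norm_eq_abs, abs_of_nonneg (h0 x)]; exact hC x)

theorem integral_proportion {n m : ℕ} (hm : 0 < m) (μ : Measure (Fin k → ℝ))
    [IsProbabilityMeasure μ] (x : Fin n → Fin k → ℝ) (hl : l ≤ k) (p : List ℕ → ℕ)
    (J : BinIndex l p) :
    ∫ z : Fin m → Fin k → ℝ, proportion a b x hl p z J ∂Measure.pi (fun _ => μ) =
      discretized a b x hl p μ J := by
  classical
  have hR : MeasurableSet (region a b x hl p J) :=
    (measurableGraph_region a b hl p J).preimage
      (f := fun y : Fin k → ℝ => ((x, y) : (Fin n → Fin k → ℝ) × (Fin k → ℝ))) (by fun_prop)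
  have hterm : ∀ τ : Fin m, ∫ z : Fin m → Fin k → ℝ,
      (region a b x hl p J).indicator (fun _ => (1 : ℝ)) (z τ) ∂Measure.pi (fun _ => μ) =
      μ.real (region a b x hl p J) := by
    intro τ
    have hmap := (measurePreserving_eval (fun _ : Fin m => μ) τ).map_eq
    have h := integral_map (μ := Measure.pi fun _ : Fin m => μ) (φ := Function.eval τ)
      (f := (region a b x hl p J).indicator (fun _ => (1 : ℝ)))
      (measurable_pi_apply τ).aemeasurable
      ((measurable_const.indicator hR).aestronglyMeasurable)
    rw [hmap, integral_indicator_const _ hR, smul_eq_mul, mul_one] at h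
    exact h.symm
  have hsum : ∀ z : Fin m → Fin k → ℝ, proportion a b x hl p z J =
      (∑ τ, (region a b x hl p J).indicator (fun _ => (1 : ℝ)) (z τ)) / m := by
    intro z
    unfold proportion members
    congr 1
    rw [Finset.card_filter]
    push_cast
    refine Finset.sum_congr rfl fun τ _ => ?_
    rw [Set.indicator_apply]
  simp only [hsum]
  rw [integral_div, integral_finsetSum]
  · rw [Finset.sum_congr rfl fun τ _ => hterm τ, Finset.sum_const, Finset.card_univ,
      Fintype.card_fin, nsmul_eq_mul, discretized]
    field_simp
  · intro τ _
    refine integrable_of_nonneg_of_le (C := 1) ?_ (fun z => ?_) (fun z => ?_)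
    · exact ((measurable_const.indicator hR).comp (measurable_pi_apply τ)).aestronglyMeasurable
    · exact Set.indicator_nonneg (fun _ _ => zero_le_one) _
    · exact Set.indicator_le' (fun _ _ => le_rfl) (fun _ _ => zero_le_one) _

/-- By Jensen's inequality, the proportions are on average at least as far from the nominal weights
as the probabilities. -/
theorem hellinger_discretized_le_integral {n m : ℕ} (hm : 0 < m) (μ : Measure (Fin k → ℝ))
    [IsProbabilityMeasure μ] (x : Fin n → Fin k → ℝ) (hl : l ≤ k) (p : List ℕ → ℕ) :
    hellinger (discretized a b x hl p μ) (nominal l p) ≤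
      ∫ z : Fin m → Fin k → ℝ, hellinger (proportion a b x hl p z) (nominal l p)
        ∂Measure.pi (fun _ => μ) := by
  set P : Measure (Fin m → Fin k → ℝ) := Measure.pi fun _ => μ
  have hmeas : ∀ J, Measurable fun z : Fin m → Fin k → ℝ => proportion a b x hl p z J := fun J =>
    (measurable_proportion a b hl p J).comp (f := fun z => (z, x)) (by fun_prop)
  have hint : ∀ J, Integrable (fun z => proportion a b x hl p z J) P := fun J =>
    integrable_of_nonneg_of_le (C := 1) (hmeas J).aestronglyMeasurable
      (fun z => proportion_nonneg x hl p z J) (fun z => proportion_le_one x hl p z J)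
  have hints : ∀ J, Integrable (fun z => √(proportion a b x hl p z J)) P := fun J =>
    integrable_of_nonneg_of_le (C := 1) (hmeas J).sqrt.aestronglyMeasurable
      (fun z => Real.sqrt_nonneg _) (fun z => Real.sqrt_le_one.2 (proportion_le_one x hl p z J))
  have hjensen : ∀ J, ∫ z, √(proportion a b x hl p z J) ∂P ≤ √(discretized a b x hl p μ J) := by
    intro J
    rw [← integral_proportion (a := a) (b := b) hm μ x hl p J]
    exact Real.strictConcaveOn_sqrt.concaveOn.le_map_integral Real.continuous_sqrt.continuousOn
      isClosed_Ici (Eventually.of_forall fun z => proportion_nonneg x hl p z J) (hint J) (hints J)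
  have hd0 : ∀ J, 0 ≤ discretized a b x hl p μ J := fun J => measureReal_nonneg
  rw [hellinger_eq hd0 (nominal_nonneg l p)]
  simp only [fun z => hellinger_eq (proportion_nonneg (a := a) (b := b) x hl p z)
    (nominal_nonneg l p)]
  have i1 : Integrable (fun z => ∑ J, proportion a b x hl p z J) P :=
    integrable_finsetSum _ fun J _ => hint J
  have i2 : Integrable (fun z => ∑ J, √(proportion a b x hl p z J) * √(nominal l p J)) P :=
    integrable_finsetSum _ fun J _ => (hints J).mul_const _
  have i3 : Integrable (fun z => 2 * ∑ J, proportion a b x hl p z J + 2 * ∑ J, nominal l p J) P :=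
    (i1.const_mul 2).add (integrable_const _)
  have i4 : Integrable (fun z => 4 * ∑ J, √(proportion a b x hl p z J) * √(nominal l p J)) P :=
    i2.const_mul 4
  have i5 : Integrable (fun _ : Fin m → Fin k → ℝ => 2 * ∑ J, nominal l p J) P :=
    integrable_const _
  have e1 : ∫ z, (2 * ∑ J, proportion a b x hl p z J + 2 * ∑ J, nominal l p J) ∂P =
      2 * ∑ J, ∫ z, proportion a b x hl p z J ∂P + 2 * ∑ J, nominal l p J := by
    rw [integral_add (i1.const_mul 2) i5, integral_const_mul, integral_finsetSum _ fun J _ => hint J,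
      integral_const, probReal_univ, one_smul]
  have e2 : ∫ z, 4 * ∑ J, √(proportion a b x hl p z J) * √(nominal l p J) ∂P =
      4 * ∑ J, ∫ z, √(proportion a b x hl p z J) * √(nominal l p J) ∂P := by
    rw [integral_const_mul, integral_finsetSum _ fun J _ => (hints J).mul_const _]
  rw [integral_sub i3 i4, e1, e2]
  have h1 : ∑ J, ∫ z, proportion a b x hl p z J ∂P = ∑ J, discretized a b x hl p μ J :=
    Finset.sum_congr rfl fun J _ => integral_proportion hm μ x hl p J
  have h2 : ∑ J, ∫ z, √(proportion a b x hl p z J) * √(nominal l p J) ∂P ≤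
      ∑ J, √(discretized a b x hl p μ J) * √(nominal l p J) := by
    refine Finset.sum_le_sum fun J _ => ?_
    rw [integral_mul_const]
    exact mul_le_mul_of_nonneg_right (hjensen J) (Real.sqrt_nonneg _)
  rw [h1]
  linarith

/-- The expected distance of the bin probabilities from the nominal weights. -/
theorem exists_integral_hellinger_nominal_le (a b : Fin k → EReal) (μ : Measure (Fin k → ℝ))
    [IsProbabilityMeasure μ] (hμ : IsContinuousOnBox a b μ) (hl : l ≤ k) (p : List ℕ → ℕ) :
    ∃ n₀ : ℕ, ∀ n, n₀ ≤ n →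
      ∫ x : Fin n → Fin k → ℝ, hellinger (discretized a b x hl p μ) (nominal l p)
        ∂Measure.pi (fun _ => μ) ≤ ((Fintype.card (BinIndex l p) : ℝ) - 1) / n := by
  have hK : (0 : ℝ) < Fintype.card (BinIndex l p) := by exact_mod_cast card_binIndex_pos l p
  -- The value `θ = 1` is admissible because it exceeds `3/4`. Initially all individuals are i.i.d.
  -- and there are no strays.
  obtain ⟨n₀, hn₀⟩ := exists_lintegral_deficit_le (Fintype.card (BinIndex l p)) hK
    (θ := 1) (by norm_num) 0
  refine ⟨n₀, fun n hn => ?_⟩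
  obtain ⟨T, hgood, hleaves, haff⟩ := exists_cutTree a b l 0 (by omega) p le_rfl n
  have hA := hμ.ae_mem_halfOpenBox
  have hcard1 : (1 : ℝ) ≤ Fintype.card (BinIndex l p) := by exact_mod_cast card_binIndex_pos l p
  have hempty : ∀ y : Fin n → Fin k → ℝ, members y (halfOpenBox a b) \ Finset.univ = ∅ := fun y =>
    Finset.sdiff_eq_empty_iff_subset.2 (Finset.subset_univ _)
  have hbound := hn₀ T (Finset.univ : Finset (Fin n)) (fun _ _ => 0) (halfOpenBox a b) μ inferInstance
    hleaves.le (measurableSet_halfOpenBox a b) hμ.marginal_no_atoms hA (by rw [hempty]; simp)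
    (fun τ hτ => absurd (Finset.mem_univ τ) hτ) (by rw [hempty]; simpa using hgood) (by simpa using hn)
  have hpi : partialSample (Finset.univ : Finset (Fin n)) μ (fun _ _ => 0) =
      Measure.pi fun _ => μ := by
    unfold partialSample
    simp
  have hae1 := ae_partialSample_injective (S := (Finset.univ : Finset (Fin n))) (ν := μ)
    (y := fun _ _ => 0) hμ.marginal_no_atoms (fun τ hτ => absurd (Finset.mem_univ τ) hτ)
  have hae2 := ae_partialSample_mem (S := (Finset.univ : Finset (Fin n))) (ν := μ)
    (y := fun _ _ => 0) hA
  rw [hpi] at hbound hae1 hae2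
  rw [hleaves, Finset.card_univ, Fintype.card_fin] at hbound
  have hle : ∫⁻ x : Fin n → Fin k → ℝ,
      ENNReal.ofReal (hellinger (discretized a b x hl p μ) (nominal l p)) ∂Measure.pi (fun _ => μ) ≤
      ENNReal.ofReal (((Fintype.card (BinIndex l p) : ℝ) - 1) / n) := by
    -- The masses sum to at most `1` and the nominal weights to `1`, so the distance is at most `4`
    -- minus four times the affinity.
    calc _ ≤ ∫⁻ x : Fin n → Fin k → ℝ, ENNReal.ofReal 4 *
          ENNReal.ofReal (T.deficit μ x (halfOpenBox a b)) ∂Measure.pi (fun _ => μ) := by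
          refine lintegral_mono_ae ?_
          filter_upwards [hae1, hae2] with x h1 h2
          have hx : ∀ τ, x τ ∈ halfOpenBox a b := fun τ => h2 τ (Finset.mem_univ τ)
          have hm : (members x (halfOpenBox a b)).card = n := by
            have : members x (halfOpenBox a b) = Finset.univ := by
              ext τ; simp [mem_members, hx τ]
            rw [this, Finset.card_univ, Fintype.card_fin]
          rw [← ENNReal.ofReal_mul (by norm_num)]
          refine ENNReal.ofReal_le_ofReal ?_
          have hμ1 : μ.real (halfOpenBox a b) = 1 := by
            rw [measureReal_def, prob_compl_eq_zero_iff (measurableSet_halfOpenBox a b) |>.1 hA]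
            simp
          have hd0 : ∀ J, 0 ≤ discretized a b x hl p μ J := fun J => measureReal_nonneg
          rw [hellinger_eq hd0 (nominal_nonneg l p), sum_nominal,
            CutTree.deficit, hμ1, Real.sqrt_one, haff x _ μ subset_rfl h1 hm]
          have hs := sum_discretized_le_one (a := a) (b := b) hμ hx hl p
          have he : ∑ J, √(discretized a b x hl p μ J) * √(nominal l p J) =
              ∑ J, √(nominal l p J) *
                √(μ.real (regionFrom a b x l 0 (by omega) p (halfOpenBox a b) J)) :=
            Finset.sum_congr rfl fun J _ => by rw [discretized_eq hμ hx, mul_comm]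
          rw [he]
          linarith
      _ ≤ ENNReal.ofReal 4 *
          ENNReal.ofReal (1 / 4 * ((Fintype.card (BinIndex l p) : ℝ) - 1) / n) := by
          rw [lintegral_const_mul' _ _ ENNReal.ofReal_ne_top]
          exact mul_le_mul_right hbound _
      _ = _ := by
          rw [← ENNReal.ofReal_mul (by norm_num)]
          congr 1
          ring
  have hmeas : Measurable fun x : Fin n → Fin k → ℝ =>
      hellinger (discretized a b x hl p μ) (nominal l p) :=
    measurable_hellinger (v := fun _ => nominal l p)
      (fun J => measurable_discretized a b hl p μ J) fun J => measurable_const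
  rw [integral_eq_lintegral_of_nonneg_ae (Eventually.of_forall fun x => hellinger_nonneg _ _)
    hmeas.aestronglyMeasurable]
  refine ENNReal.toReal_le_of_le_ofReal (div_nonneg (by linarith) (Nat.cast_nonneg _)) hle

end Expectation

/-! ### Passage to the product law of the two samples. -/

section
variable {k : ℕ} {a b : Fin k → EReal} {l : ℕ}

theorem aemeasurable_two_samples {n m : ℕ} {Ω : Type*} [MeasurableSpace Ω] {P : Measure Ω}
    {μ₁ μ₂ : Measure (Fin k → ℝ)} {X₁ : Fin m → Ω → Fin k → ℝ} {X₂ : Fin n → Ω → Fin k → ℝ}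
    (h₁ : ∀ τ, HasLaw (X₁ τ) μ₁ P) (h₂ : ∀ τ, HasLaw (X₂ τ) μ₂ P) :
    AEMeasurable (fun ω => ((fun τ => X₁ τ ω, fun τ => X₂ τ ω) :
      (Fin m → Fin k → ℝ) × (Fin n → Fin k → ℝ))) P :=
  (aemeasurable_pi_lambda _ fun τ => (h₁ τ).aemeasurable).prodMk
    (aemeasurable_pi_lambda _ fun τ => (h₂ τ).aemeasurable)

theorem map_two_samples {n m : ℕ} {Ω : Type*} [MeasurableSpace Ω] {P : Measure Ω}
    {μ₁ μ₂ : Measure (Fin k → ℝ)} [IsProbabilityMeasure μ₁] [IsProbabilityMeasure μ₂]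
    {X₁ : Fin m → Ω → Fin k → ℝ} {X₂ : Fin n → Ω → Fin k → ℝ}
    (h₁ : ∀ τ, HasLaw (X₁ τ) μ₁ P) (h₂ : ∀ τ, HasLaw (X₂ τ) μ₂ P)
    (hX : iIndepFun (Sum.elim X₁ X₂) P) :
    P.map (fun ω => ((fun τ => X₁ τ ω, fun τ => X₂ τ ω) :
      (Fin m → Fin k → ℝ) × (Fin n → Fin k → ℝ))) =
      (Measure.pi fun _ => μ₁).prod (Measure.pi fun _ => μ₂) := by
  have hae : ∀ i, AEMeasurable (Sum.elim X₁ X₂ i) P := by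
    rintro (i | i)
    · exact (h₁ i).aemeasurable
    · exact (h₂ i).aemeasurable
  have hmap := hX.map_fun_eq_pi_map hae
  let ν : Fin m ⊕ Fin n → Measure (Fin k → ℝ) := Sum.elim (fun _ => μ₁) fun _ => μ₂
  have hν : (fun i => P.map (Sum.elim X₁ X₂ i)) = ν := by
    funext i
    rcases i with i | i
    · exact (h₁ i).map_eq
    · exact (h₂ i).map_eq
  rw [hν] at hmap
  have : ∀ i, SigmaFinite (ν i) := by
    rintro (i | i)
    · exact inferInstanceAs (SigmaFinite μ₁)
    · exact inferInstanceAs (SigmaFinite μ₂)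
  have hp := (measurePreserving_sumPiEquivProdPi ν).map_eq
  rw [← hmap, AEMeasurable.map_map_of_aemeasurable
    (MeasurableEquiv.measurable _).aemeasurable (aemeasurable_pi_lambda _ hae)] at hp
  exact hp

theorem measurable_hellinger_proportion {n m : ℕ} (a b : Fin k → EReal) (hl : l ≤ k)
    (p : List ℕ → ℕ) :
    Measurable fun q : (Fin m → Fin k → ℝ) × (Fin n → Fin k → ℝ) =>
      hellinger (proportion a b q.2 hl p q.1) (nominal l p) :=
  measurable_hellinger (v := fun _ => nominal l p)
    (u := fun q : (Fin m → Fin k → ℝ) × (Fin n → Fin k → ℝ) => proportion a b q.2 hl p q.1)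
    (fun J => measurable_proportion a b hl p J) fun _ => measurable_const

theorem measurable_hellinger_discretized_nominal {n : ℕ} (a b : Fin k → EReal) (hl : l ≤ k)
    (p : List ℕ → ℕ) (μ : Measure (Fin k → ℝ)) [IsFiniteMeasure μ] :
    Measurable fun x : Fin n → Fin k → ℝ =>
      hellinger (discretized a b x hl p μ) (nominal l p) :=
  measurable_hellinger (v := fun _ => nominal l p)
    (fun J => measurable_discretized a b hl p μ J) fun _ => measurable_const

theorem measurable_hellinger_discretized {n : ℕ} (a b : Fin k → EReal) (hl : l ≤ k)
    (p : List ℕ → ℕ) (μ₁ μ₂ : Measure (Fin k → ℝ)) [IsFiniteMeasure μ₁] [IsFiniteMeasure μ₂] :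
    Measurable fun x : Fin n → Fin k → ℝ =>
      hellinger (discretized a b x hl p μ₁) (discretized a b x hl p μ₂) :=
  measurable_hellinger
    (fun J => measurable_discretized a b hl p μ₁ J) fun J => measurable_discretized a b hl p μ₂ J

/-- The minimum over `t` of `(4 / t) c + t / 2` is `√(8 c)`, also for `c = 0`, where it is an
infimum. -/
theorem le_add_sqrt_of_forall_pos {x y c : ℝ} (hc : 0 ≤ c)
    (h : ∀ t : ℝ, 0 < t → x ≤ y + (4 / t * c + t / 2)) : x ≤ y + √(8 * c) := by
  rcases hc.eq_or_lt with rfl | hc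
  · rw [mul_zero, Real.sqrt_zero, add_zero]
    refine le_of_forall_pos_le_add fun ε hε => ?_
    have := h (2 * ε) (by linarith)
    linarith
  · have hs : 0 < √(8 * c) := Real.sqrt_pos.2 (by linarith)
    have h1 := Real.sq_sqrt (by linarith : 0 ≤ 8 * c)
    have h2 : 4 / √(8 * c) * c = √(8 * c) / 2 := by
      field_simp
      linarith
    have := h _ hs
    linarith

/-- The comparison of the expectations for the product law of the two samples, given a bound for
the distance of the model probabilities from the nominal weights. -/
theorem integral_hellinger_discretized_le {n m : ℕ} (hm : 0 < m) {μ₁ μ₂ : Measure (Fin k → ℝ)}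
    [IsProbabilityMeasure μ₁] [IsProbabilityMeasure μ₂] (hμ₁ : IsContinuousOnBox a b μ₁)
    (hμ₂ : IsContinuousOnBox a b μ₂) (hl : l ≤ k) (p : List ℕ → ℕ) {c : ℝ} (hc : 0 ≤ c)
    (hbound : ∫ x : Fin n → Fin k → ℝ, hellinger (discretized a b x hl p μ₂) (nominal l p)
      ∂Measure.pi (fun _ => μ₂) ≤ c) :
    ∫ x : Fin n → Fin k → ℝ, hellinger (discretized a b x hl p μ₁) (discretized a b x hl p μ₂)
      ∂Measure.pi (fun _ => μ₂) ≤
    ∫ q : (Fin m → Fin k → ℝ) × (Fin n → Fin k → ℝ),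
      hellinger (proportion a b q.2 hl p q.1) (nominal l p)
      ∂(Measure.pi fun _ => μ₁).prod (Measure.pi fun _ => μ₂) + √(8 * c) := by
  have hd1 : ∀ (μ : Measure (Fin k → ℝ)) [IsProbabilityMeasure μ] (x : Fin n → Fin k → ℝ)
    (J : BinIndex l p), discretized a b x hl p μ J ≤ 1 := fun μ _ x J => measureReal_le_one
  have hd0 : ∀ (μ : Measure (Fin k → ℝ)) (x : Fin n → Fin k → ℝ)
    (J : BinIndex l p), 0 ≤ discretized a b x hl p μ J := fun μ x J => measureReal_nonneg
  have hi : ∀ (μ : Measure (Fin k → ℝ)) [IsProbabilityMeasure μ],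
      Integrable (fun x : Fin n → Fin k → ℝ => hellinger (discretized a b x hl p μ) (nominal l p))
        (Measure.pi fun _ => μ₂) := fun μ _ =>
    integrable_of_nonneg_of_le
      (measurable_hellinger_discretized_nominal a b hl p μ).aestronglyMeasurable
      (fun x => hellinger_nonneg _ _) fun x => hellinger_le_card (hd1 μ x) (nominal_le_one l p)
  have hi12 : Integrable (fun x : Fin n → Fin k → ℝ =>
      hellinger (discretized a b x hl p μ₁) (discretized a b x hl p μ₂))
        (Measure.pi fun _ => μ₂) :=
    integrable_of_nonneg_of_le
      (measurable_hellinger_discretized a b hl p μ₁ μ₂).aestronglyMeasurable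
      (fun x => hellinger_nonneg _ _) fun x => hellinger_le_card (hd1 μ₁ x) (hd1 μ₂ x)
  have hG : Integrable (fun q : (Fin m → Fin k → ℝ) × (Fin n → Fin k → ℝ) =>
      hellinger (proportion a b q.2 hl p q.1) (nominal l p))
      ((Measure.pi fun _ => μ₁).prod (Measure.pi fun _ => μ₂)) :=
    integrable_of_nonneg_of_le (measurable_hellinger_proportion a b hl p).aestronglyMeasurable
      (fun q => hellinger_nonneg _ _)
      fun q => hellinger_le_card (proportion_le_one q.2 hl p q.1) (nominal_le_one l p)
  have hjensen : ∫ x : Fin n → Fin k → ℝ, hellinger (discretized a b x hl p μ₁) (nominal l p)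
      ∂Measure.pi (fun _ => μ₂) ≤
      ∫ q : (Fin m → Fin k → ℝ) × (Fin n → Fin k → ℝ),
        hellinger (proportion a b q.2 hl p q.1) (nominal l p)
        ∂(Measure.pi fun _ => μ₁).prod (Measure.pi fun _ => μ₂) := by
    -- The sample that builds the bins is integrated last, so that Jensen's inequality applies with
    -- the bins fixed.
    rw [integral_prod_symm _ hG]
    exact integral_mono (hi μ₁) hG.integral_prod_right fun x =>
      hellinger_discretized_le_integral hm μ₁ x hl p
  refine (le_add_sqrt_of_forall_pos hc fun t ht => ?_).trans (add_le_add_left hjensen _)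
  have hae : ∀ᵐ x : Fin n → Fin k → ℝ ∂Measure.pi (fun _ => μ₂), ∀ τ, x τ ∈ halfOpenBox a b := by
    rw [ae_all_iff]
    exact fun τ => (measurePreserving_eval (fun _ : Fin n => μ₂) τ).quasiMeasurePreserving.ae
      hμ₂.ae_mem_halfOpenBox
  calc ∫ x : Fin n → Fin k → ℝ, hellinger (discretized a b x hl p μ₁) (discretized a b x hl p μ₂)
        ∂Measure.pi (fun _ => μ₂)
      ≤ ∫ x : Fin n → Fin k → ℝ, (hellinger (discretized a b x hl p μ₁) (nominal l p) +
        (4 / t * hellinger (discretized a b x hl p μ₂) (nominal l p) + t / 2))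
          ∂Measure.pi (fun _ => μ₂) := by
        refine integral_mono_ae hi12
          ((hi μ₁).add (((hi μ₂).const_mul _).add (integrable_const _))) ?_
        filter_upwards [hae] with x hx
        refine hellinger_triangle (hd0 μ₁ x) (hd0 μ₂ x) (nominal_nonneg l p)
          (sum_discretized_le_one hμ₁ hx hl p) ?_ ht
        rw [sum_nominal]
        exact sum_discretized_le_one hμ₂ hx hl p
    _ = ∫ x : Fin n → Fin k → ℝ, hellinger (discretized a b x hl p μ₁) (nominal l p)
          ∂Measure.pi (fun _ => μ₂) +
        (4 / t * ∫ x : Fin n → Fin k → ℝ, hellinger (discretized a b x hl p μ₂) (nominal l p)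
          ∂Measure.pi (fun _ => μ₂) + t / 2) := by
        have i2 : Integrable (fun x : Fin n → Fin k → ℝ =>
            4 / t * hellinger (discretized a b x hl p μ₂) (nominal l p))
            (Measure.pi fun _ => μ₂) := (hi μ₂).const_mul _
        have i3 : Integrable (fun _ : Fin n → Fin k → ℝ => t / 2) (Measure.pi fun _ => μ₂) :=
          integrable_const _
        have i4 : Integrable (fun x : Fin n → Fin k → ℝ =>
            4 / t * hellinger (discretized a b x hl p μ₂) (nominal l p) + t / 2)
            (Measure.pi fun _ => μ₂) := i2.add i3
        rw [integral_add (hi μ₁) i4, integral_add i2 i3, integral_const_mul,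
          integral_const, probReal_univ, one_smul]
    _ ≤ _ := by gcongr

end
end MovingRegion

open MovingRegion

theorem theorem4 {k : ℕ} (a b : Fin k → EReal)
    -- the mother distribution `μ₁` and the model distribution `μ₂`
    (μ₁ μ₂ : Measure (Fin k → ℝ)) [IsProbabilityMeasure μ₁] [IsProbabilityMeasure μ₂]
    (hμ₁ : MovingRegion.IsContinuousOnBox a b μ₁) (hμ₂ : MovingRegion.IsContinuousOnBox a b μ₂)
    -- the partition depth and the numbers of regions of the splittings
    (l : ℕ) (hl : l ≤ k) (p : List ℕ → ℕ) :
    ∃ r₁ r₂ : ℕ → ℝ,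
      (r₁ =o[atTop] fun n : ℕ => ((n : ℝ))⁻¹) ∧
      (r₂ =o[atTop] fun n : ℕ => (√(n : ℝ))⁻¹) ∧
      ∀ (n₁ n₂ : ℕ), 0 < n₁ → 0 < n₂ →
      ∀ (Ω : Type*) (_ : MeasurableSpace Ω) (P : Measure Ω) (_ : IsProbabilityMeasure P)
        (X₁ : Fin n₁ → Ω → (Fin k → ℝ)) (X₂ : Fin n₂ → Ω → (Fin k → ℝ)),
        (∀ τ, HasLaw (X₁ τ) μ₁ P) → (∀ τ, HasLaw (X₂ τ) μ₂ P) →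
        iIndepFun (Sum.elim X₁ X₂) P →
        Integrable (fun ω => MovingRegion.hellinger
          (MovingRegion.discretized a b (fun τ => X₂ τ ω) hl p μ₁)
          (MovingRegion.discretized a b (fun τ => X₂ τ ω) hl p μ₂)) P ∧
        Integrable (fun ω => MovingRegion.hellinger
          (MovingRegion.proportion a b (fun τ => X₂ τ ω) hl p (fun τ => X₁ τ ω))
          (MovingRegion.nominal l p)) P ∧
        ∫ ω, MovingRegion.hellinger
            (MovingRegion.discretized a b (fun τ => X₂ τ ω) hl p μ₁)
            (MovingRegion.discretized a b (fun τ => X₂ τ ω) hl p μ₂) ∂P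
          ≤ ∫ ω, MovingRegion.hellinger
              (MovingRegion.proportion a b (fun τ => X₂ τ ω) hl p (fun τ => X₁ τ ω))
              (MovingRegion.nominal l p) ∂P
            + √(8 * ((Fintype.card (MovingRegion.BinIndex l p) : ℝ) - 1) / (n₂ : ℝ))
            + r₁ n₁ + r₂ n₂ := by
  set K : ℝ := (Fintype.card (BinIndex l p) : ℝ) with hKdef
  have hK : 1 ≤ K := by
    rw [hKdef]
    exact_mod_cast card_binIndex_pos l p
  obtain ⟨n₀, hn₀⟩ := exists_integral_hellinger_nominal_le a b μ₂ hμ₂ hl p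
  -- The inequality holds without remainder once `n₂ ≥ n₀`. For the finitely many smaller `n₂` the
  -- trivial bound `2 * K` on a Hellinger distance over `K` bins serves as `r₂`.
  refine ⟨fun _ => 0, fun n => if n < n₀ then 2 * K else 0, isLittleO_zero _ _, ?_, ?_⟩
  · refine (isLittleO_zero _ _).congr' ?_ EventuallyEq.rfl
    filter_upwards [eventually_ge_atTop n₀] with n hn
    rw [if_neg (not_lt.2 hn)]
  intro n₁ n₂ hn₁ hn₂ Ω _ P _ X₁ X₂ h₁ h₂ hX
  have hφ := aemeasurable_two_samples h₁ h₂
  have hmap := map_two_samples h₁ h₂ hX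
  have hd1 : ∀ (μ : Measure (Fin k → ℝ)) [IsProbabilityMeasure μ] (x : Fin n₂ → Fin k → ℝ)
    (J : BinIndex l p), discretized a b x hl p μ J ≤ 1 := fun μ _ x J => measureReal_le_one
  have hF : Measurable fun q : (Fin n₁ → Fin k → ℝ) × (Fin n₂ → Fin k → ℝ) =>
      hellinger (discretized a b q.2 hl p μ₁) (discretized a b q.2 hl p μ₂) :=
    (measurable_hellinger_discretized a b hl p μ₁ μ₂).comp measurable_snd
  have hG := measurable_hellinger_proportion (n := n₂) (m := n₁) a b hl p
  have hiF : Integrable (fun ω => hellinger (discretized a b (fun τ => X₂ τ ω) hl p μ₁)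
      (discretized a b (fun τ => X₂ τ ω) hl p μ₂)) P :=
    integrable_of_nonneg_of_le (hF.comp_aemeasurable hφ).aestronglyMeasurable
      (fun _ => hellinger_nonneg _ _) fun _ => hellinger_le_card (hd1 μ₁ _) (hd1 μ₂ _)
  have hiG : Integrable (fun ω => hellinger
      (proportion a b (fun τ => X₂ τ ω) hl p (fun τ => X₁ τ ω)) (nominal l p)) P :=
    integrable_of_nonneg_of_le (hG.comp_aemeasurable hφ).aestronglyMeasurable
      (fun _ => hellinger_nonneg _ _)
      fun _ => hellinger_le_card (proportion_le_one _ hl p _) (nominal_le_one l p)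
  refine ⟨hiF, hiG, ?_⟩
  dsimp only
  split_ifs with hn
  · have hle : ∫ ω, hellinger (discretized a b (fun τ => X₂ τ ω) hl p μ₁)
        (discretized a b (fun τ => X₂ τ ω) hl p μ₂) ∂P ≤ ∫ _, 2 * K ∂P :=
      integral_mono hiF (integrable_const _) fun _ => hellinger_le_card (hd1 μ₁ _) (hd1 μ₂ _)
    rw [integral_const, probReal_univ, one_smul] at hle
    have h0 : 0 ≤ ∫ ω, hellinger (proportion a b (fun τ => X₂ τ ω) hl p (fun τ => X₁ τ ω))
        (nominal l p) ∂P := integral_nonneg fun _ => hellinger_nonneg _ _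
    have := Real.sqrt_nonneg (8 * (K - 1) / n₂)
    linarith
  · have e1 : ∫ ω, hellinger (discretized a b (fun τ => X₂ τ ω) hl p μ₁)
        (discretized a b (fun τ => X₂ τ ω) hl p μ₂) ∂P =
        ∫ x : Fin n₂ → Fin k → ℝ, hellinger (discretized a b x hl p μ₁)
          (discretized a b x hl p μ₂) ∂Measure.pi (fun _ => μ₂) := by
      have h := integral_map hφ hF.aestronglyMeasurable
      have h' := integral_map
        (μ := (Measure.pi fun _ : Fin n₁ => μ₁).prod (Measure.pi fun _ : Fin n₂ => μ₂))
        measurable_snd.aemeasurable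
        (measurable_hellinger_discretized a b hl p μ₁ μ₂).aestronglyMeasurable
      rw [(measurePreserving_snd).map_eq] at h'
      rw [hmap] at h
      exact (h'.trans h).symm
    have e2 : ∫ ω, hellinger (proportion a b (fun τ => X₂ τ ω) hl p (fun τ => X₁ τ ω))
        (nominal l p) ∂P = _ := (integral_map hφ hG.aestronglyMeasurable).symm
    rw [e1, e2, hmap, add_zero, add_zero, mul_div_assoc]
    exact integral_hellinger_discretized_le hn₁ hμ₁ hμ₂ hl p
      (div_nonneg (by linarith) (Nat.cast_nonneg _)) (hn₀ n₂ (not_lt.1 hn))
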